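/- Conventions. Let $k$ be a field; $\otimes=\otimes_k$, algebras are associative and unital over $k$ unless said otherwise, and tensors are written in Sweedler style with summation understood. A quasi-Hopf algebra $H$ is an algebra with algebra maps $\Delta:H\to H\otimes H$, $\Delta(h)=h_1\otimes h_2$, and $\varepsilon:H\to k$, an invertible $\Phi=X^1\otimes X^2\otimes X^3\in H^{\otimes 3}$ with inverse $\Phi^{-1}=x^1\otimes x^2\otimes x^3$, an algebra anti-automorphism $S$ of $H$ and $\alpha,\beta\in H$, such that $$(\mathrm{id}\otimes\Delta)\Delta(h)=\Phi(\Delta\otimes\mathrm{id})(\Delta(h))\Phi^{-1},\quad (\mathrm{id}\otimes\varepsilon)\Delta(h)=h=(\varepsilon\otimes\mathrm{id})\Delta(h),$$ $$(1\otimes\Phi)(\mathrm{id}\otimes\Delta\otimes\mathrm{id})(\Phi)(\Phi\otimes1)=(\mathrm{id}\otimes\mathrm{id}\otimes\Delta)(\Phi)(\Delta\otimes\mathrm{id}\otimes\mathrm{id})(\Phi),$$ applying $\varepsilon$ to any one factor of $\Phi$ gives $1\otimes1$, and $$S(h_1)\alpha h_2=\varepsilon(h)\alpha,\quad h_1\beta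 S(h_2)=\varepsilon(h)\beta,\quad X^1\beta S(X^2)\alpha X^3=1=S(x^1)\alpha x^2\beta S(x^3),$$ normalized by $\varepsilon(\alpha)=\varepsilon(\beta)=1$. Put $A^1\otimes A^2\otimes A^3\otimes A^4=(\Phi\otimes1)(\Delta\otimes\mathrm{id}\otimes\mathrm{id})(\Phi^{-1})$, $g=S(A^2)\alpha A^3\otimes S(A^1)\alpha A^4$ and $$f=f^1\otimes f^2=\bigl(S((x^1)_2)\otimes S((x^1)_1)\bigr)\,g\,\Delta\bigl(x^2\beta S(x^3)\bigr).$$ An $H$-bimodule algebra $\mathcal A$ is an $H$-bimodule with a $k$-bilinear (not necessarily associative) multiplication with unit $1_{\mathcal A}$ such that $(\varphi\psi)\xi=(X^1\cdot\varphi\cdot x^1)[(X^2\cdot\psi\cdot x^2)(X^3\cdot\xi\cdot x^3)]$, $h\cdot(\varphi\psi)=(h_1\cdot\varphi)(h_2\cdot\psi)$, $(\varphi\psi)\cdot h=(\varphi\cdot h_1)(\psi\cdot h_2)$ and $h\cdot1_{\mathcal A}=\varepsilon(h)1_{\mathcal A}=1_{\mathcal A}\cdot h$. An $H$-bicomodule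 algebra $\mathbb A$ is an algebra with algebra maps $\lambda:\mathbb A\to H\otimes\mathbb A$, $\lambda(u)=u_{[-1]}\otimes u_{[0]}$, and $\rho:\mathbb A\to\mathbb A\otimes H$, $\rho(u)=u_{<0>}\otimes u_{<1>}$, and invertible elements $\Phi_\lambda=\tilde X^1_\lambda\otimes\tilde X^2_\lambda\otimes\tilde X^3_\lambda\in H\otimes H\otimes\mathbb A$, $\Phi_\rho=\tilde X^1_\rho\otimes\tilde X^2_\rho\otimes\tilde X^3_\rho\in\mathbb A\otimes H\otimes H$, $\Phi_{\lambda,\rho}\in H\otimes\mathbb A\otimes H$, with inverses $\Phi_\lambda^{-1}=\tilde x^1_\lambda\otimes\tilde x^2_\lambda\otimes\tilde x^3_\lambda$, $\Phi_\rho^{-1}=\tilde x^1_\rho\otimes\tilde x^2_\rho\otimes\tilde x^3_\rho$, $\Phi_{\lambda,\rho}^{-1}=\theta^1\otimes\theta^2\otimes\theta^3$, such that for all $u\in\mathbb A$: $$\Phi_\rho(\rho\otimes\mathrm{id})\rho(u)=(\mathrm{id}\otimes\Delta)(\rho(u))\Phi_\rho,\qquad(\mathrm{id}\otimes\lambda)(\lambda(u))\Phi_\lambda=\Phi_\lambda(\Delta\otimes\mathrm{id})\lambda(u),$$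 $$\Phi_{\lambda,\rho}(\lambda\otimes\mathrm{id})\rho(u)=(\mathrm{id}\otimes\rho)(\lambda(u))\Phi_{\lambda,\rho},$$ $$(1\otimes\Phi)(\mathrm{id}\otimes\Delta\otimes\mathrm{id})(\Phi_\rho)(\Phi_\rho\otimes1)=(\mathrm{id}\otimes\mathrm{id}\otimes\Delta)(\Phi_\rho)(\rho\otimes\mathrm{id}\otimes\mathrm{id})(\Phi_\rho),$$ $$(1\otimes\Phi_\lambda)(\mathrm{id}\otimes\Delta\otimes\mathrm{id})(\Phi_\lambda)(\Phi\otimes1)=(\mathrm{id}\otimes\mathrm{id}\otimes\lambda)(\Phi_\lambda)(\Delta\otimes\mathrm{id}\otimes\mathrm{id})(\Phi_\lambda),$$ $$(1\otimes\Phi_{\lambda,\rho})(\mathrm{id}\otimes\lambda\otimes\mathrm{id})(\Phi_{\lambda,\rho})(\Phi_\lambda\otimes1)=(\mathrm{id}\otimes\mathrm{id}\otimes\rho)(\Phi_\lambda)(\Delta\otimes\mathrm{id}\otimes\mathrm{id})(\Phi_{\lambda,\rho}),$$ $$(1\otimes\Phi_\rho)(\mathrm{id}\otimes\rho\otimes\mathrm{id})(\Phi_{\lambda,\rho})(\Phi_{\lambda,\rho}\otimes1)=(\mathrm{id}\otimes\mathrm{id}\otimes\Delta)(\Phi_{\lambda,\rho})(\lambda\otimes\mathrm{id}\otimes\mathrm{id})(\Phi_\rho),$$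 $(\mathrm{id}\otimes\varepsilon)\rho=\mathrm{id}=(\varepsilon\otimes\mathrm{id})\lambda$, and applying $\varepsilon$ to any one $H$-factor of $\Phi_\lambda$ or $\Phi_\rho$ gives $1\otimes1$. Let $$\tilde p=\tilde p^1\otimes\tilde p^2=\tilde x^1_\rho\otimes\tilde x^2_\rho\beta S(\tilde x^3_\rho),\qquad\tilde q=\tilde q^1\otimes\tilde q^2=\tilde X^1_\rho\otimes S^{-1}(\alpha\tilde X^3_\rho)\tilde X^2_\rho\quad\text{in }\mathbb A\otimes H,$$ and let $\Omega=\Omega^1\otimes\cdots\otimes\Omega^5\in H^{\otimes2}\otimes\mathbb A\otimes H^{\otimes2}$ be the element $$(\tilde X^1_\rho)_{[-1]_1}\tilde x^1_\lambda\theta^1\otimes(\tilde X^1_\rho)_{[-1]_2}\tilde x^2_\lambda\theta^2_{[-1]}\otimes(\tilde X^1_\rho)_{[0]}\tilde x^3_\lambda\theta^2_{[0]}\otimes S^{-1}(f^1\tilde X^2_\rho\theta^3)\otimes S^{-1}(f^2\tilde X^3_\rho).$$ The generalized diagonal crossed product $\mathcal A\bowtie\mathbb A$ is $\mathcal A\otimes\mathbb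 A$ (with $\varphi\bowtie u$ for $\varphi\otimes u$), with unit $1_{\mathcal A}\bowtie1_{\mathbb A}$ and multiplication $$(\varphi\bowtie u)(\varphi'\bowtie u')=(\Omega^1\cdot\varphi\cdot\Omega^5)(\Omega^2u_{<0>_{[-1]}}\cdot\varphi'\cdot S^{-1}(u_{<1>})\Omega^4)\bowtie\Omega^3u_{<0>_{[0]}}u'.$$ Define linear maps $\Gamma:\mathcal A\to\mathcal A\bowtie\mathbb A$, $\Gamma(\varphi)=\tilde p^1_{[-1]}\cdot\varphi\cdot S^{-1}(\tilde p^2)\bowtie\tilde p^1_{[0]}$, and $j:\mathbb A\to\mathcal A\bowtie\mathbb A$, $j(u)=1_{\mathcal A}\bowtie u$. Proposition. Let $H$ be a quasi-Hopf algebra, $\mathcal A$ an $H$-bimodule algebra, $\mathbb A$ an $H$-bicomodule algebra, $B$ an associative unital algebra, $\gamma:\mathbb A\to B$ an algebra map and $v:\mathcal A\to B$ a linear map such that, for all $\varphi,\varphi'\in\mathcal A$ and $u\in\mathbb A$, $$\gamma(u_{<0>})v(\varphi\cdot u_{<1>})=v(u_{[-1]}\cdot\varphi)\gamma(u_{[0]}),$$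 $$v(\varphi\varphi')=\gamma(\tilde X^1_\rho)\,v(\theta^1\tilde X^1_\lambda\cdot\varphi\cdot\tilde X^2_\rho)\,\gamma(\theta^2)\,v(\tilde X^2_\lambda\cdot\varphi'\cdot\tilde X^3_\rho\theta^3)\,\gamma(\tilde X^3_\lambda),$$ $$v(1_{\mathcal A})=1_B.$$ Then there exists a unique algebra map (that is, a linear map preserving the unit and products) $w:\mathcal A\bowtie\mathbb A\to B$ such that $w\circ\Gamma=v$ and $w\circ j=\gamma$. Moreover, for all $\varphi\in\mathcal A$ and $u\in\mathbb A$, $$w(\varphi\bowtie u)=\gamma(\tilde q^1)\,v(\varphi\cdot\tilde q^2)\,\gamma(u).$$ -/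

import Mathlib

open scoped TensorProduct

set_option linter.unusedSectionVars false

noncomputable section

namespace QuasiHopf

/-! ### Evaluating Sweedler-type expressions -/

section Sweedler

variable {k : Type*} [Field k]

/-- The linear map `x ⊗ y ↦ f x * g y`. Iterating it evaluates Sweedler-type products. -/
def prodMap {X Y E : Type*} [AddCommMonoid X] [Module k X] [AddCommMonoid Y] [Module k Y]
    [NonUnitalNonAssocSemiring E] [Module k E] [SMulCommClass k E E] [IsScalarTower k E E]
    (f : X →ₗ[k] E) (g : Y →ₗ[k] E) : X ⊗[k] Y →ₗ[k] E :=
  LinearMap.mul' k E ∘ₗ TensorProduct.map f g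

@[simp] theorem prodMap_tmul {X Y E : Type*} [AddCommMonoid X] [Module k X] [AddCommMonoid Y]
    [Module k Y] [NonUnitalNonAssocSemiring E] [Module k E] [SMulCommClass k E E]
    [IsScalarTower k E E] (f : X →ₗ[k] E) (g : Y →ₗ[k] E) (x : X) (y : Y) :
    prodMap f g (x ⊗ₜ[k] y) = f x * g y := by
  simp [prodMap]

/-- Let an endomorphism act on the first tensor factor. -/
def onFst (M N : Type*) [AddCommMonoid M] [Module k M] [AddCommMonoid N] [Module k N] :
    Module.End k M →ₗ[k] Module.End k (M ⊗[k] N) :=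
  LinearMap.rTensorHom N

/-- Let an endomorphism act on the second tensor factor. -/
def onSnd (M N : Type*) [AddCommMonoid M] [Module k M] [AddCommMonoid N] [Module k N] :
    Module.End k N →ₗ[k] Module.End k (M ⊗[k] N) :=
  LinearMap.lTensorHom M

@[simp] theorem onFst_tmul {M N : Type*} [AddCommMonoid M] [Module k M] [AddCommMonoid N]
    [Module k N] (f : Module.End k M) (m : M) (n : N) :
    onFst M N f (m ⊗ₜ[k] n) = f m ⊗ₜ[k] n := by
  simp [onFst]

@[simp] theorem onSnd_tmul {M N : Type*} [AddCommMonoid M] [Module k M] [AddCommMonoid N]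
    [Module k N] (f : Module.End k N) (m : M) (n : N) :
    onSnd M N f (m ⊗ₜ[k] n) = m ⊗ₜ[k] f n := by
  simp [onSnd]

/-- If `X` acts on `M` and `Y` acts on `N`, then `X ⊗ Y` acts on `M ⊗ N`, factor by factor. -/
def tensorAct {X Y M N : Type*} [AddCommMonoid X] [Module k X] [AddCommMonoid Y] [Module k Y]
    [AddCommMonoid M] [Module k M] [AddCommMonoid N] [Module k N]
    (a : X →ₗ[k] Module.End k M) (b : Y →ₗ[k] Module.End k N) :
    X ⊗[k] Y →ₗ[k] Module.End k (M ⊗[k] N) :=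
  prodMap (onFst M N ∘ₗ a) (onSnd M N ∘ₗ b)

@[simp] theorem tensorAct_tmul {X Y M N : Type*} [AddCommMonoid X] [Module k X]
    [AddCommMonoid Y] [Module k Y] [AddCommMonoid M] [Module k M] [AddCommMonoid N] [Module k N]
    (a : X →ₗ[k] Module.End k M) (b : Y →ₗ[k] Module.End k N) (x : X) (y : Y) (m : M) (n : N) :
    tensorAct a b (x ⊗ₜ[k] y) (m ⊗ₜ[k] n) = a x m ⊗ₜ[k] b y n := by
  simp [tensorAct]

/-- For an algebra map `f : X → Y ⊗ Z`, the algebra map `f ⊗ id : X ⊗ W → Y ⊗ (Z ⊗ W)`. All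
iterated tensor products are bracketed to the right. -/
def splitFst {X Y Z : Type*} [Ring X] [Algebra k X] [Ring Y] [Algebra k Y] [Ring Z]
    [Algebra k Z] (W : Type*) [Ring W] [Algebra k W] (f : X →ₐ[k] Y ⊗[k] Z) :
    X ⊗[k] W →ₐ[k] Y ⊗[k] (Z ⊗[k] W) :=
  (Algebra.TensorProduct.assoc k k k Y Z W).toAlgHom.comp
    (Algebra.TensorProduct.map f (AlgHom.id k W))

/-- The algebra map `id ⊗ f : W ⊗ X → W ⊗ Y`. -/
def onRight {X Y : Type*} [Ring X] [Algebra k X] [Ring Y] [Algebra k Y]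
    (W : Type*) [Ring W] [Algebra k W] (f : X →ₐ[k] Y) : W ⊗[k] X →ₐ[k] W ⊗[k] Y :=
  Algebra.TensorProduct.map (AlgHom.id k W) f

/-- The algebra map `f ⊗ id : X ⊗ W → Y ⊗ W`. -/
def onLeft {X Y : Type*} [Ring X] [Algebra k X] [Ring Y] [Algebra k Y]
    (W : Type*) [Ring W] [Algebra k W] (f : X →ₐ[k] Y) : X ⊗[k] W →ₐ[k] Y ⊗[k] W :=
  Algebra.TensorProduct.map f (AlgHom.id k W)

/-- The algebra map `x ↦ x ⊗ 1`. -/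
def tmulOne (X W : Type*) [Ring X] [Algebra k X] [Ring W] [Algebra k W] :
    X →ₐ[k] X ⊗[k] W :=
  Algebra.TensorProduct.includeLeft

/-- The algebra map `x ↦ 1 ⊗ x`. -/
def oneTmul (W X : Type*) [Ring X] [Algebra k X] [Ring W] [Algebra k W] :
    X →ₐ[k] W ⊗[k] X :=
  Algebra.TensorProduct.includeRight

end Sweedler

/-! ### Quasi-bialgebras and quasi-Hopf algebras -/

/-- A quasi-bialgebra `(H, Δ, ε, Φ)` over the field `k`. -/
class QuasiBialgebra (k H : Type*) [Field k] [Ring H] [Algebra k H] where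
  /-- the coproduct `Δ` -/
  comul : H →ₐ[k] H ⊗[k] H
  /-- the counit `ε` -/
  counit : H →ₐ[k] k
  /-- the reassociator `Φ` -/
  Phi : (H ⊗[k] (H ⊗[k] H))ˣ
  /-- `(id ⊗ Δ)(Δ(h)) = Φ (Δ ⊗ id)(Δ(h)) Φ⁻¹` -/
  coassoc : ∀ h : H, onRight H comul (comul h) =
    (Phi : H ⊗[k] (H ⊗[k] H)) * splitFst H comul (comul h) * ((Phi⁻¹ : (H ⊗[k] (H ⊗[k] H))ˣ) :
      H ⊗[k] (H ⊗[k] H))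
  /-- `(id ⊗ ε)(Δ(h)) = h ⊗ 1` -/
  counit_right : ∀ h : H, onRight H counit (comul h) = h ⊗ₜ[k] 1
  /-- `(ε ⊗ id)(Δ(h)) = 1 ⊗ h` -/
  counit_left : ∀ h : H, onLeft H counit (comul h) = 1 ⊗ₜ[k] h
  /-- `(1 ⊗ Φ)(id ⊗ Δ ⊗ id)(Φ)(Φ ⊗ 1) = (id ⊗ id ⊗ Δ)(Φ)(Δ ⊗ id ⊗ id)(Φ)` -/
  pentagon : oneTmul H (H ⊗[k] (H ⊗[k] H)) Phi * onRight H (splitFst H comul) Phi *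
      onRight H (onRight H (tmulOne H H)) Phi =
    onRight H (onRight H comul) Phi * splitFst (H ⊗[k] H) comul Phi
  /-- `(ε ⊗ id ⊗ id)(Φ) = 1` -/
  counit_Phi_fst : onLeft (H ⊗[k] H) counit (Phi : H ⊗[k] (H ⊗[k] H)) = 1
  /-- `(id ⊗ ε ⊗ id)(Φ) = 1` -/
  counit_Phi_snd : onRight H (onLeft H counit) (Phi : H ⊗[k] (H ⊗[k] H)) = 1
  /-- `(id ⊗ id ⊗ ε)(Φ) = 1` -/
  counit_Phi_trd : onRight H (onRight H counit) (Phi : H ⊗[k] (H ⊗[k] H)) = 1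

/-- The reassociator `Φ`, as an element of `H ⊗ H ⊗ H`. -/
def phi (k H : Type*) [Field k] [Ring H] [Algebra k H] [QuasiBialgebra k H] :
    H ⊗[k] (H ⊗[k] H) :=
  (QuasiBialgebra.Phi (k := k) (H := H) : (H ⊗[k] (H ⊗[k] H))ˣ)

/-- The inverse `Φ⁻¹` of the reassociator. -/
def PhiInv (k H : Type*) [Field k] [Ring H] [Algebra k H] [QuasiBialgebra k H] :
    H ⊗[k] (H ⊗[k] H) :=
  ((QuasiBialgebra.Phi (k := k) (H := H))⁻¹ : (H ⊗[k] (H ⊗[k] H))ˣ)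

open QuasiBialgebra in
/-- A quasi-Hopf algebra: a quasi-bialgebra with an algebra anti-automorphism `S` and elements
`α, β`, with the usual normalization `ε(α) = ε(β) = 1`. (`S 1 = 1` and `ε ∘ S = ε` follow.) -/
class QuasiHopfAlgebra (k H : Type*) [Field k] [Ring H] [Algebra k H] extends
    QuasiBialgebra k H where
  /-- the antipode `S` (bijective) -/
  antipode : H ≃ₗ[k] H
  /-- `S` reverses products -/
  antipode_mul : ∀ g h : H, antipode (g * h) = antipode h * antipode g
  /-- the element `α` -/
  alpha : H
  /-- the element `β` -/
  beta : H
  /-- `S(h₁) α h₂ = ε(h) α` -/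
  antipode_alpha : ∀ h : H,
    prodMap (LinearMap.mulRight k alpha ∘ₗ antipode.toLinearMap) LinearMap.id (comul h) =
      counit h • alpha
  /-- `h₁ β S(h₂) = ε(h) β` -/
  antipode_beta : ∀ h : H,
    prodMap (LinearMap.mulRight k beta) antipode.toLinearMap (comul h) =
      counit h • beta
  /-- `X¹ β S(X²) α X³ = 1`, where `Φ = X¹ ⊗ X² ⊗ X³` -/
  antipode_Phi : prodMap (LinearMap.mulRight k beta)
    (prodMap (LinearMap.mulRight k alpha ∘ₗ antipode.toLinearMap) LinearMap.id)
    (phi k H) = 1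
  /-- `S(x¹) α x² β S(x³) = 1`, where `Φ⁻¹ = x¹ ⊗ x² ⊗ x³` -/
  antipode_PhiInv : prodMap (LinearMap.mulRight k alpha ∘ₗ antipode.toLinearMap)
    (prodMap (LinearMap.mulRight k beta) antipode.toLinearMap) (PhiInv k H) = 1
  /-- `ε(α) = 1` -/
  counit_alpha : counit alpha = 1
  /-- `ε(β) = 1` -/
  counit_beta : counit beta = 1

section Twist

variable (k H : Type*) [Field k] [Ring H] [Algebra k H] [QuasiHopfAlgebra k H]

/-- The coproduct `Δ` of `H`. -/
abbrev Delta : H →ₐ[k] H ⊗[k] H := QuasiBialgebra.comul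

/-- The antipode `S`, as a linear map. -/
abbrev S : H →ₗ[k] H := (QuasiHopfAlgebra.antipode (k := k) (H := H)).toLinearMap

/-- The inverse `S⁻¹` of the antipode, as a linear map. -/
abbrev SInv : H →ₗ[k] H := (QuasiHopfAlgebra.antipode (k := k) (H := H)).symm.toLinearMap

/-- The linear map `h ↦ h α`. -/
abbrev mulAlpha : H →ₗ[k] H := LinearMap.mulRight k (QuasiHopfAlgebra.alpha k (H := H))

/-- The linear map `h ↦ α h`. -/
abbrev alphaMul : H →ₗ[k] H := LinearMap.mulLeft k (QuasiHopfAlgebra.alpha k (H := H))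

/-- The linear map `h ↦ h β`. -/
abbrev mulBeta : H →ₗ[k] H := LinearMap.mulRight k (QuasiHopfAlgebra.beta k (H := H))

/-- The element `A¹ ⊗ A² ⊗ A³ ⊗ A⁴ = (Φ ⊗ 1)(Δ ⊗ id ⊗ id)(Φ⁻¹)`. -/
def elemA : H ⊗[k] (H ⊗[k] (H ⊗[k] H)) :=
  onRight H (onRight H (tmulOne H H)) (phi k H) *
    splitFst (H ⊗[k] H) (Delta k H) (PhiInv k H)

/-- The linear map `a₁ ⊗ a₂ ⊗ a₃ ⊗ a₄ ↦ S(a₂) α a₃ ⊗ S(a₁) α a₄`. -/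
def gammaMap : H ⊗[k] (H ⊗[k] (H ⊗[k] H)) →ₗ[k] H ⊗[k] H :=
  prodMap ((oneTmul H H).toLinearMap ∘ₗ mulAlpha k H ∘ₗ S k H)
    (prodMap ((tmulOne H H).toLinearMap ∘ₗ mulAlpha k H ∘ₗ S k H)
      (prodMap (tmulOne H H).toLinearMap (oneTmul H H).toLinearMap))

theorem gammaMap_tmul (a₁ a₂ a₃ a₄ : H) :
    gammaMap k H (a₁ ⊗ₜ (a₂ ⊗ₜ (a₃ ⊗ₜ a₄))) =
      (S k H a₂ * QuasiHopfAlgebra.alpha k * a₃) ⊗ₜ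
        (S k H a₁ * QuasiHopfAlgebra.alpha k * a₄) := by
  simp [gammaMap, oneTmul, tmulOne]

/-- The element `γ = S(A²) α A³ ⊗ S(A¹) α A⁴`. -/
def gammaElem : H ⊗[k] H := gammaMap k H (elemA k H)

/-- The linear map `h ↦ (S ⊗ S)(Δᶜᵒᵖ(h))`, where `Δᶜᵒᵖ(h) = h₂ ⊗ h₁`. -/
def antipodeCop : H →ₗ[k] H ⊗[k] H :=
  TensorProduct.map (S k H) (S k H) ∘ₗ (TensorProduct.comm k H H).toLinearMap ∘ₗ
    (Delta k H).toLinearMap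

/-- Drinfeld's gauge transformation
`f = (S ⊗ S)(Δᶜᵒᵖ(x¹)) γ Δ(x² β S(x³))`, where `Φ⁻¹ = x¹ ⊗ x² ⊗ x³`. -/
def drinfeldTwist : H ⊗[k] H :=
  prodMap (LinearMap.mulRight k (gammaElem k H) ∘ₗ antipodeCop k H)
    ((Delta k H).toLinearMap ∘ₗ prodMap (mulBeta k H) (S k H)) (PhiInv k H)

end Twist

/-! ### Comodule algebras and bicomodule algebras -/

open QuasiBialgebra in
/-- A right `H`-comodule algebra `(A, ρ, Φ_ρ)` over a quasi-bialgebra `H`. -/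
class RightComoduleAlgebra (k H A : Type*) [Field k] [Ring H] [Algebra k H]
    [QuasiBialgebra k H] [Ring A] [Algebra k A] where
  /-- the right coaction `ρ(a) = a_{<0>} ⊗ a_{<1>}` -/
  rho : A →ₐ[k] A ⊗[k] H
  /-- the invertible element `Φ_ρ` -/
  PhiRho : (A ⊗[k] (H ⊗[k] H))ˣ
  /-- `Φ_ρ (ρ ⊗ id)(ρ(a)) = (id ⊗ Δ)(ρ(a)) Φ_ρ` -/
  rho_coassoc : ∀ a : A, (PhiRho : A ⊗[k] (H ⊗[k] H)) * splitFst H rho (rho a) =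
    onRight A comul (rho a) * (PhiRho : A ⊗[k] (H ⊗[k] H))
  /-- `(1 ⊗ Φ)(id ⊗ Δ ⊗ id)(Φ_ρ)(Φ_ρ ⊗ 1) = (id ⊗ id ⊗ Δ)(Φ_ρ)(ρ ⊗ id ⊗ id)(Φ_ρ)` -/
  rho_pentagon : oneTmul A (H ⊗[k] (H ⊗[k] H)) (phi k H) * onRight A (splitFst H comul) PhiRho *
      onRight A (onRight H (tmulOne H H)) PhiRho =
    onRight A (onRight H comul) PhiRho * splitFst (H ⊗[k] H) rho PhiRho
  /-- `(id ⊗ ε) ∘ ρ = id` -/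
  rho_counit : ∀ a : A, onRight A counit (rho a) = a ⊗ₜ[k] 1
  /-- `(id ⊗ ε ⊗ id)(Φ_ρ) = 1` -/
  counit_PhiRho_snd : onRight A (onLeft H counit) (PhiRho : A ⊗[k] (H ⊗[k] H)) = 1
  /-- `(id ⊗ id ⊗ ε)(Φ_ρ) = 1` -/
  counit_PhiRho_trd : onRight A (onRight H counit) (PhiRho : A ⊗[k] (H ⊗[k] H)) = 1

open QuasiBialgebra in
/-- A left `H`-comodule algebra `(A, λ, Φ_λ)` over a quasi-bialgebra `H`. -/
class LeftComoduleAlgebra (k H A : Type*) [Field k] [Ring H] [Algebra k H]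
    [QuasiBialgebra k H] [Ring A] [Algebra k A] where
  /-- the left coaction `λ(a) = a_{[-1]} ⊗ a_{[0]}` -/
  lam : A →ₐ[k] H ⊗[k] A
  /-- the invertible element `Φ_λ` -/
  PhiLam : (H ⊗[k] (H ⊗[k] A))ˣ
  /-- `(id ⊗ λ)(λ(a)) Φ_λ = Φ_λ (Δ ⊗ id)(λ(a))` -/
  lam_coassoc : ∀ a : A, onRight H lam (lam a) * (PhiLam : H ⊗[k] (H ⊗[k] A)) =
    (PhiLam : H ⊗[k] (H ⊗[k] A)) * splitFst A comul (lam a)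
  /-- `(1 ⊗ Φ_λ)(id ⊗ Δ ⊗ id)(Φ_λ)(Φ ⊗ 1) = (id ⊗ id ⊗ λ)(Φ_λ)(Δ ⊗ id ⊗ id)(Φ_λ)` -/
  lam_pentagon : oneTmul H (H ⊗[k] (H ⊗[k] A)) PhiLam * onRight H (splitFst A comul) PhiLam *
      onRight H (onRight H (tmulOne H A)) (phi k H) =
    onRight H (onRight H lam) PhiLam * splitFst (H ⊗[k] A) comul PhiLam
  /-- `(ε ⊗ id) ∘ λ = id` -/
  lam_counit : ∀ a : A, onLeft A counit (lam a) = 1 ⊗ₜ[k] a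
  /-- `(id ⊗ ε ⊗ id)(Φ_λ) = 1` -/
  counit_PhiLam_snd : onRight H (onLeft A counit) (PhiLam : H ⊗[k] (H ⊗[k] A)) = 1
  /-- `(ε ⊗ id ⊗ id)(Φ_λ) = 1` -/
  counit_PhiLam_fst : onLeft (H ⊗[k] A) counit (PhiLam : H ⊗[k] (H ⊗[k] A)) = 1

open QuasiBialgebra RightComoduleAlgebra LeftComoduleAlgebra in
/-- An `H`-bicomodule algebra `(A, λ, ρ, Φ_λ, Φ_ρ, Φ_{λ,ρ})` over a quasi-bialgebra `H`. -/
class BicomoduleAlgebra (k H A : Type*) [Field k] [Ring H] [Algebra k H]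
    [QuasiBialgebra k H] [Ring A] [Algebra k A] extends
    RightComoduleAlgebra k H A, LeftComoduleAlgebra k H A where
  /-- the invertible element `Φ_{λ,ρ}` -/
  PhiLamRho : (H ⊗[k] (A ⊗[k] H))ˣ
  /-- `Φ_{λ,ρ} (λ ⊗ id)(ρ(u)) = (id ⊗ ρ)(λ(u)) Φ_{λ,ρ}` -/
  lam_rho : ∀ u : A, (PhiLamRho : H ⊗[k] (A ⊗[k] H)) * splitFst H lam (rho u) =
    onRight H rho (lam u) * (PhiLamRho : H ⊗[k] (A ⊗[k] H))
  /-- `(1 ⊗ Φ_{λ,ρ})(id ⊗ λ ⊗ id)(Φ_{λ,ρ})(Φ_λ ⊗ 1) =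
  (id ⊗ id ⊗ ρ)(Φ_λ)(Δ ⊗ id ⊗ id)(Φ_{λ,ρ})` -/
  lam_lam_rho : oneTmul H (H ⊗[k] (A ⊗[k] H)) PhiLamRho *
      onRight H (splitFst H lam) PhiLamRho * onRight H (onRight H (tmulOne A H)) PhiLam =
    onRight H (onRight H rho) PhiLam * splitFst (A ⊗[k] H) comul PhiLamRho
  /-- `(1 ⊗ Φ_ρ)(id ⊗ ρ ⊗ id)(Φ_{λ,ρ})(Φ_{λ,ρ} ⊗ 1) =
  (id ⊗ id ⊗ Δ)(Φ_{λ,ρ})(λ ⊗ id ⊗ id)(Φ_ρ)` -/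
  lam_rho_rho : oneTmul H (A ⊗[k] (H ⊗[k] H)) PhiRho *
      onRight H (splitFst H rho) PhiLamRho * onRight H (onRight A (tmulOne H H)) PhiLamRho =
    onRight H (onRight A comul) PhiLamRho * splitFst (H ⊗[k] H) lam PhiRho

/-! ### Bimodule algebras -/

section Actions

variable (k H 𝒜 : Type*) [Field k] [Ring H] [Algebra k H] [AddCommGroup 𝒜] [Module k 𝒜]

/-- The left action `h ↦ (φ ↦ h · φ)`. -/
def actL [Module H 𝒜] [IsScalarTower k H 𝒜] : H →ₗ[k] Module.End k 𝒜 :=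
  (Algebra.lsmul k k 𝒜 : H →ₐ[k] Module.End k 𝒜).toLinearMap

/-- The right action `h ↦ (φ ↦ φ · h)`; a right `H`-module is a module over the opposite
algebra. -/
def actR [Module Hᵐᵒᵖ 𝒜] [IsScalarTower k Hᵐᵒᵖ 𝒜] : H →ₗ[k] Module.End k 𝒜 :=
  (Algebra.lsmul k k 𝒜 : Hᵐᵒᵖ →ₐ[k] Module.End k 𝒜).toLinearMap ∘ₗ
    (MulOpposite.opLinearEquiv k).toLinearMap

@[simp] theorem actL_apply [Module H 𝒜] [IsScalarTower k H 𝒜] (h : H) (φ : 𝒜) :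
    actL k H 𝒜 h φ = h • φ := by
  simp [actL]

@[simp] theorem actR_apply [Module Hᵐᵒᵖ 𝒜] [IsScalarTower k Hᵐᵒᵖ 𝒜] (h : H) (φ : 𝒜) :
    actR k H 𝒜 h φ = MulOpposite.op h • φ := by
  simp [actR]

end Actions

/-- An `H`-bimodule algebra over a quasi-bialgebra `H`: an `H`-bimodule `𝒜` (left and right
actions that commute) with a bilinear, not necessarily associative multiplication with unit, which
is an algebra in the monoidal category of `H`-bimodules. -/
class BimoduleAlgebra (k H 𝒜 : Type*) [Field k] [Ring H] [Algebra k H] [QuasiBialgebra k H]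
    [NonAssocRing 𝒜] [Module k 𝒜] [SMulCommClass k 𝒜 𝒜] [IsScalarTower k 𝒜 𝒜]
    [Module H 𝒜] [IsScalarTower k H 𝒜] [Module Hᵐᵒᵖ 𝒜] [IsScalarTower k Hᵐᵒᵖ 𝒜]
    [SMulCommClass H Hᵐᵒᵖ 𝒜] : Prop where
  /-- `(φ ψ) ξ = (X¹ · φ · x¹) [(X² · ψ · x²) (X³ · ξ · x³)]`, where `Φ = X¹ ⊗ X² ⊗ X³` and
  `Φ⁻¹ = x¹ ⊗ x² ⊗ x³` -/
  mul_assoc' : ∀ φ ψ ξ : 𝒜, (φ * ψ) * ξ =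
    prodMap LinearMap.id (prodMap LinearMap.id LinearMap.id)
      (tensorAct (actR k H 𝒜) (tensorAct (actR k H 𝒜) (actR k H 𝒜)) (PhiInv k H)
        (tensorAct (actL k H 𝒜) (tensorAct (actL k H 𝒜) (actL k H 𝒜))
          (phi k H) (φ ⊗ₜ[k] (ψ ⊗ₜ[k] ξ))))
  /-- `h · (φ ψ) = (h₁ · φ)(h₂ · ψ)` -/
  smul_mul' : ∀ (h : H) (φ ψ : 𝒜), h • (φ * ψ) =
    prodMap LinearMap.id LinearMap.id
      (tensorAct (actL k H 𝒜) (actL k H 𝒜) (QuasiBialgebra.comul h) (φ ⊗ₜ[k] ψ))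
  /-- `(φ ψ) · h = (φ · h₁)(ψ · h₂)` -/
  mul_smul' : ∀ (h : H) (φ ψ : 𝒜), MulOpposite.op h • (φ * ψ) =
    prodMap LinearMap.id LinearMap.id
      (tensorAct (actR k H 𝒜) (actR k H 𝒜) (QuasiBialgebra.comul h) (φ ⊗ₜ[k] ψ))
  /-- `h · 1 = ε(h) 1` -/
  smul_one' : ∀ h : H, h • (1 : 𝒜) = (QuasiBialgebra.counit h : k) • (1 : 𝒜)
  /-- `1 · h = ε(h) 1` -/
  one_smul' : ∀ h : H, MulOpposite.op h • (1 : 𝒜) = (QuasiBialgebra.counit h : k) • (1 : 𝒜)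

/-! ### The generalized diagonal crossed product -/

section Elements

open RightComoduleAlgebra LeftComoduleAlgebra BicomoduleAlgebra

variable (k H 𝔸 : Type*) [Field k] [Ring H] [Algebra k H] [QuasiHopfAlgebra k H]
  [Ring 𝔸] [Algebra k 𝔸]

/-- `Φ_ρ`, as an element of `𝔸 ⊗ H ⊗ H`. -/
def phiRho [RightComoduleAlgebra k H 𝔸] : 𝔸 ⊗[k] (H ⊗[k] H) :=
  (PhiRho : (𝔸 ⊗[k] (H ⊗[k] H))ˣ)

/-- The inverse of `Φ_ρ`. -/
def phiRhoInv [RightComoduleAlgebra k H 𝔸] : 𝔸 ⊗[k] (H ⊗[k] H) :=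
  ((PhiRho : (𝔸 ⊗[k] (H ⊗[k] H))ˣ)⁻¹ : (𝔸 ⊗[k] (H ⊗[k] H))ˣ)

/-- `Φ_λ`, as an element of `H ⊗ H ⊗ 𝔸`. -/
def phiLam [LeftComoduleAlgebra k H 𝔸] : H ⊗[k] (H ⊗[k] 𝔸) :=
  (PhiLam : (H ⊗[k] (H ⊗[k] 𝔸))ˣ)

/-- The inverse of `Φ_λ`. -/
def phiLamInv [LeftComoduleAlgebra k H 𝔸] : H ⊗[k] (H ⊗[k] 𝔸) :=
  ((PhiLam : (H ⊗[k] (H ⊗[k] 𝔸))ˣ)⁻¹ : (H ⊗[k] (H ⊗[k] 𝔸))ˣ)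

/-- The inverse `θ¹ ⊗ θ² ⊗ θ³` of `Φ_{λ,ρ}`. -/
def theta [BicomoduleAlgebra k H 𝔸] : H ⊗[k] (𝔸 ⊗[k] H) :=
  ((PhiLamRho : (H ⊗[k] (𝔸 ⊗[k] H))ˣ)⁻¹ : (H ⊗[k] (𝔸 ⊗[k] H))ˣ)

/-- `p̃ = x̃¹ ⊗ x̃² β S(x̃³)`, where `Φ_ρ⁻¹ = x̃¹ ⊗ x̃² ⊗ x̃³`. -/
def pRho [RightComoduleAlgebra k H 𝔸] : 𝔸 ⊗[k] H :=
  TensorProduct.map LinearMap.id (prodMap (mulBeta k H) (S k H)) (phiRhoInv k H 𝔸)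

/-- `q̃ = X̃¹ ⊗ S⁻¹(α X̃³) X̃²`, where `Φ_ρ = X̃¹ ⊗ X̃² ⊗ X̃³`. -/
def qRho [RightComoduleAlgebra k H 𝔸] : 𝔸 ⊗[k] H :=
  TensorProduct.map LinearMap.id
    (prodMap (SInv k H ∘ₗ alphaMul k H) LinearMap.id ∘ₗ (TensorProduct.comm k H H).toLinearMap)
    (phiRho k H 𝔸)

/-- With `Φ_ρ = X¹ ⊗ X² ⊗ X³`, `Φ_λ⁻¹ = x¹ ⊗ x² ⊗ x³`, `Φ_{λ,ρ}⁻¹ = θ¹ ⊗ θ² ⊗ θ³` and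
`f = f¹ ⊗ f²`, the element
`X¹_{[-1]_1} x¹ θ¹ ⊗ X¹_{[-1]_2} x² θ²_{[-1]} ⊗ X¹_{[0]} x³ θ²_{[0]} ⊗ f¹ X² θ³ ⊗ f² X³`. -/
def omegaAux [BicomoduleAlgebra k H 𝔸] : H ⊗[k] (H ⊗[k] (𝔸 ⊗[k] (H ⊗[k] H))) :=
  oneTmul H _ (oneTmul H _ (oneTmul 𝔸 _ (drinfeldTwist k H))) *
    splitFst (𝔸 ⊗[k] (H ⊗[k] H)) (Delta k H)
      (splitFst (H ⊗[k] H) (lam (k := k) (H := H) (A := 𝔸)) (phiRho k H 𝔸)) *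
    onRight H (onRight H (tmulOne 𝔸 (H ⊗[k] H))) (phiLamInv k H 𝔸) *
    onRight H (onRight H (onRight 𝔸 (tmulOne H H)))
      (onRight H (splitFst H (lam (k := k) (H := H) (A := 𝔸))) (theta k H 𝔸))

/-- The element
`Ω = X¹_{[-1]_1} x¹ θ¹ ⊗ X¹_{[-1]_2} x² θ²_{[-1]} ⊗ X¹_{[0]} x³ θ²_{[0]} ⊗ S⁻¹(f¹ X² θ³) ⊗
S⁻¹(f² X³)`. -/
def Omega [BicomoduleAlgebra k H 𝔸] : H ⊗[k] (H ⊗[k] (𝔸 ⊗[k] (H ⊗[k] H))) :=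
  TensorProduct.map LinearMap.id (TensorProduct.map LinearMap.id (TensorProduct.map LinearMap.id
    (TensorProduct.map (SInv k H) (SInv k H)))) (omegaAux k H 𝔸)

/-- `u_{<0>_{[-1]}} ⊗ u_{<0>_{[0]}} ⊗ S⁻¹(u_{<1>})`, as a linear function of
`u_{<0>} ⊗ u_{<1>}`. -/
def lamSInv [LeftComoduleAlgebra k H 𝔸] : 𝔸 ⊗[k] H →ₗ[k] H ⊗[k] (𝔸 ⊗[k] H) :=
  TensorProduct.map LinearMap.id (TensorProduct.map LinearMap.id (SInv k H)) ∘ₗ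
    (splitFst H (lam (k := k) (H := H) (A := 𝔸))).toLinearMap

theorem lamSInv_tmul [LeftComoduleAlgebra k H 𝔸] (a : 𝔸) (h x : H) (b : 𝔸)
    (hab : lam (k := k) (H := H) a = x ⊗ₜ[k] b) :
    lamSInv k H 𝔸 (a ⊗ₜ h) = x ⊗ₜ (b ⊗ₜ SInv k H h) := by
  simp [lamSInv, splitFst, hab]

end Elements

section Crossed

variable (k H 𝒜 𝔸 : Type*) [Field k] [Ring H] [Algebra k H]
  [NonAssocRing 𝒜] [Module k 𝒜] [SMulCommClass k 𝒜 𝒜] [IsScalarTower k 𝒜 𝒜]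
  [Module H 𝒜] [IsScalarTower k H 𝒜] [Module Hᵐᵒᵖ 𝒜] [IsScalarTower k Hᵐᵒᵖ 𝒜]
  [Ring 𝔸] [Algebra k 𝔸]

/-- Left multiplication `a ↦ (b ↦ a b)` on `𝔸`. -/
abbrev mulL : 𝔸 →ₗ[k] Module.End k 𝔸 := LinearMap.mul k 𝔸

/-- `h ⊗ a ⊗ h'` acts on `𝒜 ⊗ 𝔸` by `φ ⊗ u ↦ (h · φ · h') ⊗ a u`. -/
def act3 : H ⊗[k] (𝔸 ⊗[k] H) →ₗ[k] Module.End k (𝒜 ⊗[k] 𝔸) :=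
  prodMap (onFst 𝒜 𝔸 ∘ₗ actL k H 𝒜)
    (prodMap (onSnd 𝒜 𝔸 ∘ₗ mulL k 𝔸) (onFst 𝒜 𝔸 ∘ₗ actR k H 𝒜))

theorem act3_tmul (h h' : H) (a u : 𝔸) (φ : 𝒜) :
    act3 k H 𝒜 𝔸 (h ⊗ₜ (a ⊗ₜ h')) (φ ⊗ₜ u) =
      (h • MulOpposite.op h' • φ) ⊗ₜ (a * u) := by
  simp [act3]

/-- `h₁ ⊗ h₂ ⊗ a ⊗ h₄ ⊗ h₅` acts on `𝒜 ⊗ 𝒜 ⊗ 𝔸` by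
`φ ⊗ φ' ⊗ u ↦ (h₁ · φ · h₅) ⊗ (h₂ · φ' · h₄) ⊗ a u`. -/
def act5 : H ⊗[k] (H ⊗[k] (𝔸 ⊗[k] (H ⊗[k] H))) →ₗ[k] Module.End k (𝒜 ⊗[k] (𝒜 ⊗[k] 𝔸)) :=
  prodMap (onFst 𝒜 (𝒜 ⊗[k] 𝔸) ∘ₗ actL k H 𝒜)
    (prodMap (onSnd 𝒜 (𝒜 ⊗[k] 𝔸) ∘ₗ onFst 𝒜 𝔸 ∘ₗ actL k H 𝒜)
      (prodMap (onSnd 𝒜 (𝒜 ⊗[k] 𝔸) ∘ₗ onSnd 𝒜 𝔸 ∘ₗ mulL k 𝔸)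
        (prodMap (onSnd 𝒜 (𝒜 ⊗[k] 𝔸) ∘ₗ onFst 𝒜 𝔸 ∘ₗ actR k H 𝒜)
          (onFst 𝒜 (𝒜 ⊗[k] 𝔸) ∘ₗ actR k H 𝒜))))

theorem act5_tmul (h₁ h₂ h₄ h₅ : H) (a u : 𝔸) (φ φ' : 𝒜) :
    act5 k H 𝒜 𝔸 (h₁ ⊗ₜ (h₂ ⊗ₜ (a ⊗ₜ (h₄ ⊗ₜ h₅)))) (φ ⊗ₜ (φ' ⊗ₜ u)) =
      (h₁ • MulOpposite.op h₅ • φ) ⊗ₜ ((h₂ • MulOpposite.op h₄ • φ') ⊗ₜ (a * u)) := by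
  simp [act5]

/-- The linear map `φ ⊗ φ' ⊗ u ↦ φ φ' ⊗ u`. -/
def mulFst : 𝒜 ⊗[k] (𝒜 ⊗[k] 𝔸) →ₗ[k] 𝒜 ⊗[k] 𝔸 :=
  (LinearMap.mul' k 𝒜).rTensor 𝔸 ∘ₗ (TensorProduct.assoc k 𝒜 𝒜 𝔸).symm.toLinearMap

theorem mulFst_tmul (φ φ' : 𝒜) (u : 𝔸) :
    mulFst k 𝒜 𝔸 (φ ⊗ₜ (φ' ⊗ₜ u)) = (φ * φ') ⊗ₜ u := by
  simp [mulFst]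

/-- The underlying vector space `𝒜 ⊗ 𝔸` of the generalized diagonal crossed product `𝒜 ⋈ 𝔸`. -/
@[nolint unusedArguments]
def DiagonalCrossedProduct (k _H 𝒜 𝔸 : Type*) [Field k] [AddCommGroup 𝒜] [Module k 𝒜]
    [AddCommGroup 𝔸] [Module k 𝔸] : Type _ :=
  𝒜 ⊗[k] 𝔸

namespace DiagonalCrossedProduct

instance : AddCommGroup (DiagonalCrossedProduct k H 𝒜 𝔸) :=
  inferInstanceAs (AddCommGroup (𝒜 ⊗[k] 𝔸))

instance : Module k (DiagonalCrossedProduct k H 𝒜 𝔸) :=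
  inferInstanceAs (Module k (𝒜 ⊗[k] 𝔸))

/-- The identification of vector spaces `𝒜 ⊗ 𝔸 = 𝒜 ⋈ 𝔸`. -/
def of : 𝒜 ⊗[k] 𝔸 ≃ₗ[k] DiagonalCrossedProduct k H 𝒜 𝔸 :=
  LinearEquiv.refl k (𝒜 ⊗[k] 𝔸)

variable {k 𝒜 𝔸}

/-- The element `φ ⋈ u` of `𝒜 ⋈ 𝔸`. -/
def mk (φ : 𝒜) (u : 𝔸) : DiagonalCrossedProduct k H 𝒜 𝔸 := of k H 𝒜 𝔸 (φ ⊗ₜ[k] u)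

variable (k 𝒜 𝔸)
variable [QuasiHopfAlgebra k H] [BicomoduleAlgebra k H 𝔸]

/-- For fixed `φ ⊗ u`, the linear map
`φ' ⊗ u' ↦ (Ω¹ · φ · Ω⁵)(Ω² u_{<0>_{[-1]}} · φ' · S⁻¹(u_{<1>}) Ω⁴) ⊗ Ω³ u_{<0>_{[0]}} u'`. -/
def mulAux : 𝒜 ⊗[k] 𝔸 →ₗ[k] 𝒜 ⊗[k] 𝔸 →ₗ[k] 𝒜 ⊗[k] 𝔸 :=
  TensorProduct.lift (LinearMap.mk₂ k
    (fun (φ : 𝒜) (u : 𝔸) =>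
      mulFst k 𝒜 𝔸 ∘ₗ act5 k H 𝒜 𝔸 (Omega k H 𝔸) ∘ₗ TensorProduct.mk k 𝒜 (𝒜 ⊗[k] 𝔸) φ ∘ₗ
        act3 k H 𝒜 𝔸 (lamSInv k H 𝔸 (RightComoduleAlgebra.rho u)))
    (fun φ φ' u => by simp only [map_add, LinearMap.add_comp, LinearMap.comp_add])
    (fun c φ u => by simp only [map_smul, LinearMap.smul_comp, LinearMap.comp_smul])
    (fun φ u u' => by simp only [map_add, LinearMap.comp_add])
    (fun c φ u => by simp only [map_smul, LinearMap.comp_smul]))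

/-- The multiplication of `𝒜 ⋈ 𝔸`. -/
instance : Mul (DiagonalCrossedProduct k H 𝒜 𝔸) :=
  ⟨fun x y => of k H 𝒜 𝔸 (mulAux k H 𝒜 𝔸 ((of k H 𝒜 𝔸).symm x) ((of k H 𝒜 𝔸).symm y))⟩

/-- The unit `1 ⋈ 1` of `𝒜 ⋈ 𝔸`. -/
instance : One (DiagonalCrossedProduct k H 𝒜 𝔸) := ⟨mk H 1 1⟩

theorem mk_mul_mk (φ φ' : 𝒜) (u u' : 𝔸) :
    (mk H φ u * mk H φ' u' : DiagonalCrossedProduct k H 𝒜 𝔸) =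
      of k H 𝒜 𝔸 (mulFst k 𝒜 𝔸 (act5 k H 𝒜 𝔸 (Omega k H 𝔸)
        (φ ⊗ₜ act3 k H 𝒜 𝔸 (lamSInv k H 𝔸 (RightComoduleAlgebra.rho u)) (φ' ⊗ₜ u')))) :=
  rfl

/-- The linear map `Γ(φ) = p̃¹_{[-1]} · φ · S⁻¹(p̃²) ⋈ p̃¹_{[0]}`. -/
def Gam : 𝒜 →ₗ[k] DiagonalCrossedProduct k H 𝒜 𝔸 :=
  (of k H 𝒜 𝔸).toLinearMap ∘ₗ act3 k H 𝒜 𝔸 (lamSInv k H 𝔸 (pRho k H 𝔸)) ∘ₗ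
    (TensorProduct.mk k 𝒜 𝔸).flip 1

/-- The linear map `j(u) = 1 ⋈ u`. -/
def j : 𝔸 →ₗ[k] DiagonalCrossedProduct k H 𝒜 𝔸 :=
  (of k H 𝒜 𝔸).toLinearMap ∘ₗ TensorProduct.mk k 𝒜 𝔸 1

theorem j_apply (u : 𝔸) : j k H 𝒜 𝔸 u = mk H 1 u := rfl

/-- A linear map from `𝒜 ⋈ 𝔸` to an algebra is an algebra map if it preserves the unit and the
multiplication. -/
structure IsAlgMap {k H 𝒜 𝔸 B : Type*} [Field k] [Ring H] [Algebra k H]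
    [NonAssocRing 𝒜] [Module k 𝒜] [SMulCommClass k 𝒜 𝒜] [IsScalarTower k 𝒜 𝒜]
    [Module H 𝒜] [IsScalarTower k H 𝒜] [Module Hᵐᵒᵖ 𝒜] [IsScalarTower k Hᵐᵒᵖ 𝒜]
    [Ring 𝔸] [Algebra k 𝔸] [QuasiHopfAlgebra k H] [BicomoduleAlgebra k H 𝔸]
    [Ring B] [Algebra k B] (w : DiagonalCrossedProduct k H 𝒜 𝔸 →ₗ[k] B) : Prop where
  map_one : w 1 = 1
  map_mul : ∀ x y : DiagonalCrossedProduct k H 𝒜 𝔸, w (x * y) = w x * w y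

end DiagonalCrossedProduct

/-! ### Expressions in the target algebra -/

variable {k H 𝒜 𝔸} {B : Type*} [Ring B] [Algebra k B]

/-- The linear map `h ↦ v(h · φ)`. -/
def vL (v : 𝒜 →ₗ[k] B) (φ : 𝒜) : H →ₗ[k] B := v ∘ₗ (actL k H 𝒜).flip φ

/-- The linear map `h ↦ v(φ · h)`. -/
def vR (v : 𝒜 →ₗ[k] B) (φ : 𝒜) : H →ₗ[k] B := v ∘ₗ (actR k H 𝒜).flip φ

theorem vL_apply (v : 𝒜 →ₗ[k] B) (φ : 𝒜) (h : H) : vL v φ h = v (h • φ) := by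
  simp [vL]

theorem vR_apply (v : 𝒜 →ₗ[k] B) (φ : 𝒜) (h : H) :
    vR v φ h = v (MulOpposite.op h • φ) := by
  simp [vR]

variable (k 𝒜 𝔸) in
/-- The space of words `a ⊗ φ ⊗ b ⊗ φ' ⊗ c`. -/
abbrev Word : Type _ := 𝔸 ⊗[k] (𝒜 ⊗[k] (𝔸 ⊗[k] (𝒜 ⊗[k] 𝔸)))

/-- `a ⊗ φ ⊗ b ⊗ φ' ⊗ c ↦ γ(a) v(φ) γ(b) v(φ') γ(c)`. -/
def wordEval (γ : 𝔸 →ₐ[k] B) (v : 𝒜 →ₗ[k] B) : Word k 𝒜 𝔸 →ₗ[k] B :=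
  prodMap γ.toLinearMap (prodMap v (prodMap γ.toLinearMap (prodMap v γ.toLinearMap)))

variable (k 𝒜 𝔸) in
/-- Act on the first letter `a` of a word. -/
def onWord1 : Module.End k 𝔸 →ₗ[k] Module.End k (Word k 𝒜 𝔸) :=
  onFst 𝔸 (𝒜 ⊗[k] (𝔸 ⊗[k] (𝒜 ⊗[k] 𝔸)))

variable (k 𝒜 𝔸) in
/-- Act on the second letter `φ` of a word. -/
def onWord2 : Module.End k 𝒜 →ₗ[k] Module.End k (Word k 𝒜 𝔸) :=
  onSnd 𝔸 (𝒜 ⊗[k] (𝔸 ⊗[k] (𝒜 ⊗[k] 𝔸))) ∘ₗ onFst 𝒜 (𝔸 ⊗[k] (𝒜 ⊗[k] 𝔸))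

variable (k 𝒜 𝔸) in
/-- Act on the third letter `b` of a word. -/
def onWord3 : Module.End k 𝔸 →ₗ[k] Module.End k (Word k 𝒜 𝔸) :=
  onSnd 𝔸 (𝒜 ⊗[k] (𝔸 ⊗[k] (𝒜 ⊗[k] 𝔸))) ∘ₗ onSnd 𝒜 (𝔸 ⊗[k] (𝒜 ⊗[k] 𝔸)) ∘ₗ
    onFst 𝔸 (𝒜 ⊗[k] 𝔸)

variable (k 𝒜 𝔸) in
/-- Act on the fourth letter `φ'` of a word. -/
def onWord4 : Module.End k 𝒜 →ₗ[k] Module.End k (Word k 𝒜 𝔸) :=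
  onSnd 𝔸 (𝒜 ⊗[k] (𝔸 ⊗[k] (𝒜 ⊗[k] 𝔸))) ∘ₗ onSnd 𝒜 (𝔸 ⊗[k] (𝒜 ⊗[k] 𝔸)) ∘ₗ
    onSnd 𝔸 (𝒜 ⊗[k] 𝔸) ∘ₗ onFst 𝒜 𝔸

variable (k 𝒜 𝔸) in
/-- Act on the fifth letter `c` of a word. -/
def onWord5 : Module.End k 𝔸 →ₗ[k] Module.End k (Word k 𝒜 𝔸) :=
  onSnd 𝔸 (𝒜 ⊗[k] (𝔸 ⊗[k] (𝒜 ⊗[k] 𝔸))) ∘ₗ onSnd 𝒜 (𝔸 ⊗[k] (𝒜 ⊗[k] 𝔸)) ∘ₗ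
    onSnd 𝔸 (𝒜 ⊗[k] 𝔸) ∘ₗ onSnd 𝒜 𝔸

variable (k H 𝒜 𝔸) in
/-- `x ⊗ h ⊗ h'` sends `a ⊗ φ ⊗ b ⊗ φ' ⊗ c` to `x a ⊗ φ · h ⊗ b ⊗ φ' · h' ⊗ c`. -/
def wordRho : 𝔸 ⊗[k] (H ⊗[k] H) →ₗ[k] Module.End k (Word k 𝒜 𝔸) :=
  prodMap (onWord1 k 𝒜 𝔸 ∘ₗ mulL k 𝔸)
    (prodMap (onWord2 k 𝒜 𝔸 ∘ₗ actR k H 𝒜) (onWord4 k 𝒜 𝔸 ∘ₗ actR k H 𝒜))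

variable (k H 𝒜 𝔸) in
/-- `h ⊗ h' ⊗ x` sends `a ⊗ φ ⊗ b ⊗ φ' ⊗ c` to `a ⊗ h · φ ⊗ b ⊗ h' · φ' ⊗ x c`. -/
def wordLam : H ⊗[k] (H ⊗[k] 𝔸) →ₗ[k] Module.End k (Word k 𝒜 𝔸) :=
  prodMap (onWord2 k 𝒜 𝔸 ∘ₗ actL k H 𝒜)
    (prodMap (onWord4 k 𝒜 𝔸 ∘ₗ actL k H 𝒜) (onWord5 k 𝒜 𝔸 ∘ₗ mulL k 𝔸))

variable (k H 𝒜 𝔸) in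
/-- `h ⊗ x ⊗ h'` sends `a ⊗ φ ⊗ b ⊗ φ' ⊗ c` to `a ⊗ h · φ ⊗ x b ⊗ φ' · h' ⊗ c`. -/
def wordTheta : H ⊗[k] (𝔸 ⊗[k] H) →ₗ[k] Module.End k (Word k 𝒜 𝔸) :=
  prodMap (onWord2 k 𝒜 𝔸 ∘ₗ actL k H 𝒜)
    (prodMap (onWord3 k 𝒜 𝔸 ∘ₗ mulL k 𝔸) (onWord4 k 𝒜 𝔸 ∘ₗ actR k H 𝒜))

/-- For `R = X¹ ⊗ X² ⊗ X³`, `T = θ¹ ⊗ θ² ⊗ θ³` and `L = Y¹ ⊗ Y² ⊗ Y³`, the element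
`γ(X¹) v(θ¹ Y¹ · φ · X²) γ(θ²) v(Y² · φ' · X³ θ³) γ(Y³)`. -/
def vMulExpr (γ : 𝔸 →ₐ[k] B) (v : 𝒜 →ₗ[k] B) (R : 𝔸 ⊗[k] (H ⊗[k] H))
    (T : H ⊗[k] (𝔸 ⊗[k] H)) (L : H ⊗[k] (H ⊗[k] 𝔸)) (φ φ' : 𝒜) : B :=
  wordEval γ v (wordTheta k H 𝒜 𝔸 T (wordRho k H 𝒜 𝔸 R (wordLam k H 𝒜 𝔸 L
    (1 ⊗ₜ[k] (φ ⊗ₜ[k] (1 ⊗ₜ[k] (φ' ⊗ₜ[k] 1)))))))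

theorem vMulExpr_tmul [SMulCommClass H Hᵐᵒᵖ 𝒜] (γ : 𝔸 →ₐ[k] B) (v : 𝒜 →ₗ[k] B)
    (x₁ t₂ y₃ : 𝔸) (x₂ x₃ t₁ t₃ y₁ y₂ : H) (φ φ' : 𝒜) :
    vMulExpr γ v (x₁ ⊗ₜ (x₂ ⊗ₜ x₃)) (t₁ ⊗ₜ (t₂ ⊗ₜ t₃)) (y₁ ⊗ₜ (y₂ ⊗ₜ y₃)) φ φ' =
      γ x₁ * v ((t₁ * y₁) • MulOpposite.op x₂ • φ) * γ t₂ *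
        v (y₂ • MulOpposite.op (x₃ * t₃) • φ') * γ y₃ := by
  simp [vMulExpr, wordEval, wordTheta, wordRho, wordLam, onWord1, onWord2, onWord3,
    onWord4, onWord5, mul_smul, mul_assoc,
    smul_comm y₁ (MulOpposite.op x₂), smul_comm y₂ (MulOpposite.op t₃),
    smul_comm y₂ (MulOpposite.op x₃)]

end Crossed

end QuasiHopf

end

open QuasiHopf

set_option maxSynthPendingDepth 6

noncomputable section

namespace QuasiHopf

/-! ### Formal rules for algebra maps on iterated tensor products. -/

section Sweedler

variable {k : Type*} [Field k]

/-! The only candidate is w(φ ⋈ u) = γ(q̃¹) v(φ·q̃²) γ(u). The counit normalizations give (φ ⋈ u)(1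
⋈ u') = φ ⋈ uu' and (1 ⋈ u)(φ ⋈ u') = u_{<0>[-1]}·φ·S⁻¹(u_{<1>}) ⋈ u_{<0>[0]}u'. With ρ(q̃¹) p̃ [1 ⊗
S(q̃²)] = 1 ⊗ 1 (`rho_qRho_mul_pRho`) they yield φ ⋈ 1 = j(q̃¹) Γ(φ·q̃²), so an algebra map with the
prescribed values on Γ and j must be w (`IsAlgMap.apply_mk`).

Conversely, the commutation hypothesis on γ and v trades the left coaction for the right one. It
reduces w ∘ Γ = v to [1 ⊗ S⁻¹(p̃²)] q̃ ρ(p̃¹) = 1 ⊗ 1 (`qMap_phiRho_mul_splitFst_pRho`), and w(j(u)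
x) = γ(u) w(x) to [1 ⊗ S⁻¹(u_{<1>})] q̃ ρ(u_{<0>}) = [u ⊗ 1] q̃ (`qMap_phiRho_mul_splitFst_rho`); w
∘ j = γ follows from v(1) = 1 and ε(q̃²) q̃¹ = 1.

What remains of multiplicativity is `wTilde_mulFst_omegaAux`. After v of a product is expanded, Φ_λ
cancels the Φ_λ⁻¹ inside Ω, and the coaction terms are moved into the right coaction. The part built
from f and Φ_ρ becomes (q̃ ⊗ 1)(ρ ⊗ id)(q̃) by a formula for the coproduct of q̃
(`onRight_comul_qRho`). Finally the two copies of Φ_{λ,ρ}⁻¹ are absorbed (`lTensor_qMap_theta`),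
leaving two independent copies of q̃, one for each factor.

The coproduct formula rests on f Δ(S(a)) = (S ⊗ S)(Δᶜᵒᵖ(a)) f and f Δ(α) = g, where g = S(A²) α A³ ⊗
S(A¹) α A⁴. Both come from one uniqueness-of-antipode argument for a general triple (σ, δ, T). The
recurring mechanism is that S(–) α – and – β S(–) absorb a coproduct next to α or β and turn it into
a counit. When a pentagon is evaluated this way, each factor containing such a Δ becomes trivial. -/

@[simp] theorem onRight_tmul {X Y W : Type*} [Ring X] [Algebra k X] [Ring Y] [Algebra k Y]
    [Ring W] [Algebra k W] (f : X →ₐ[k] Y) (w : W) (x : X) :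
    onRight W f (w ⊗ₜ[k] x) = w ⊗ₜ f x := by
  simp [onRight]

@[simp] theorem onLeft_tmul {X Y W : Type*} [Ring X] [Algebra k X] [Ring Y] [Algebra k Y]
    [Ring W] [Algebra k W] (f : X →ₐ[k] Y) (w : W) (x : X) :
    onLeft W f (x ⊗ₜ[k] w) = f x ⊗ₜ w := by
  simp [onLeft]

theorem splitFst_tmul {X Y Z W : Type*} [Ring X] [Algebra k X] [Ring Y] [Algebra k Y] [Ring Z]
    [Algebra k Z] [Ring W] [Algebra k W] (f : X →ₐ[k] Y ⊗[k] Z) (x : X) (w : W) :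
    splitFst W f (x ⊗ₜ[k] w) = TensorProduct.assoc k Y Z W (f x ⊗ₜ w) := by
  simp [splitFst]
  rfl

@[simp] theorem tmulOne_apply {X W : Type*} [Ring X] [Algebra k X] [Ring W] [Algebra k W]
    (x : X) : tmulOne X W x = x ⊗ₜ[k] 1 := rfl

@[simp] theorem oneTmul_apply {X W : Type*} [Ring X] [Algebra k X] [Ring W] [Algebra k W]
    (x : X) : oneTmul W X x = 1 ⊗ₜ[k] x := rfl

theorem onRight_comp {X Y Z W : Type*} [Ring X] [Algebra k X] [Ring Y] [Algebra k Y] [Ring Z]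
    [Algebra k Z] [Ring W] [Algebra k W] (f : Y →ₐ[k] Z) (g : X →ₐ[k] Y) :
    onRight W (f.comp g) = (onRight W f).comp (onRight W g) := by
  ext <;> simp

theorem splitFst_comp {X Y Z V W : Type*} [Ring X] [Algebra k X] [Ring Y] [Algebra k Y] [Ring Z]
    [Algebra k Z] [Ring W] [Algebra k W] [Ring V] [Algebra k V] (f : Y →ₐ[k] Z ⊗[k] V)
    (g : X →ₐ[k] Y) : splitFst W (f.comp g) = (splitFst W f).comp (onLeft W g) := by
  ext <;> simp [splitFst_tmul]

/-- Two linear maps on a tensor product agree if they agree on pure tensors. -/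
theorem tensor_ext {X Y M : Type*} [AddCommMonoid X] [Module k X] [AddCommMonoid Y] [Module k Y]
    [AddCommMonoid M] [Module k M] {f g : X ⊗[k] Y →ₗ[k] M}
    (h : ∀ x y, f (x ⊗ₜ y) = g (x ⊗ₜ y)) (t : X ⊗[k] Y) : f t = g t :=
  congrFun (congrArg DFunLike.coe (TensorProduct.ext' h)) t

end Sweedler

/-! ### The antipode and the evaluations a ⊗ b ↦ S(a) α b and a ⊗ b ↦ a β S(b). -/

section QuasiHopfAlgebra

variable (k H : Type*) [Field k] [Ring H] [Algebra k H] [QuasiHopfAlgebra k H]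

open QuasiBialgebra QuasiHopfAlgebra

/-- The linear map `a ⊗ b ↦ S(a) α b`. -/
def evalAlpha : H ⊗[k] H →ₗ[k] H := prodMap (mulAlpha k H ∘ₗ S k H) LinearMap.id

/-- The linear map `a ⊗ b ↦ a β S(b)`. -/
def evalBeta : H ⊗[k] H →ₗ[k] H := prodMap (mulBeta k H) (S k H)

/-- The algebra map `h ↦ ε(h) 1` into an algebra `E`. -/
def counitTo (E : Type*) [Ring E] [Algebra k E] : H →ₐ[k] E := (Algebra.ofId k E).comp counit

variable {k H}

@[simp] theorem evalAlpha_tmul (a b : H) :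
    evalAlpha k H (a ⊗ₜ b) = S k H a * alpha k * b := by
  simp [evalAlpha]

@[simp] theorem evalBeta_tmul (a b : H) :
    evalBeta k H (a ⊗ₜ b) = a * beta k * S k H b := by
  simp [evalBeta]

theorem counitTo_apply (E : Type*) [Ring E] [Algebra k E] (h : H) :
    counitTo k H E h = (counit h : k) • (1 : E) := by
  simp [counitTo, Algebra.ofId_apply, Algebra.algebraMap_eq_smul_one]

theorem S_mul (a b : H) : S k H (a * b) = S k H b * S k H a := antipode_mul a b

@[simp] theorem SInv_S (a : H) : SInv k H (S k H a) = a := by simp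

@[simp] theorem S_SInv (a : H) : S k H (SInv k H a) = a := by simp

theorem SInv_mul (a b : H) : SInv k H (a * b) = SInv k H b * SInv k H a := by
  apply (antipode (k := k) (H := H)).injective
  change S k H _ = S k H _
  rw [S_mul]; simp only [S_SInv]

-- Surjectivity forces this: 1 = S(S⁻¹(1)), and antimultiplicativity evaluates S(S⁻¹(1) · 1) as S(1)
-- · 1.
@[simp] theorem S_one : S k H 1 = 1 := by
  have h := S_mul (k := k) (SInv k H 1) (1 : H)
  rw [mul_one, S_SInv, mul_one] at h
  exact h.symm

@[simp] theorem SInv_one : SInv k H 1 = 1 := by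
  have h := SInv_S (k := k) (1 : H)
  rwa [S_one] at h

theorem evalAlpha_mul_tmul (d : H ⊗[k] H) (a b : H) :
    evalAlpha k H (d * a ⊗ₜ b) = S k H a * evalAlpha k H d * b := by
  induction d using TensorProduct.induction_on with
  | zero => simp
  | tmul x y => simp only [Algebra.TensorProduct.tmul_mul_tmul, evalAlpha_tmul, S_mul, mul_assoc]
  | add x y hx hy => simp only [add_mul, map_add, hx, hy, mul_add]

theorem evalBeta_tmul_mul (d : H ⊗[k] H) (a b : H) :
    evalBeta k H (a ⊗ₜ b * d) = a * evalBeta k H d * S k H b := by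
  induction d using TensorProduct.induction_on with
  | zero => simp
  | tmul x y => simp only [Algebra.TensorProduct.tmul_mul_tmul, evalBeta_tmul, S_mul, mul_assoc]
  | add x y hx hy => simp only [add_mul, map_add, hx, hy, mul_add]

/-- Because S reverses products, a factor multiplied on the left lands innermost, on both sides of
α, where the antipode axiom applies. -/
theorem evalAlpha_comul_mul (h : H) (t : H ⊗[k] H) :
    evalAlpha k H (Delta k H h * t) = (counit h : k) • evalAlpha k H t := by
  induction t using TensorProduct.induction_on with
  | zero => simp
  | tmul x y =>
    rw [evalAlpha_mul_tmul, show evalAlpha k H (Delta k H h) = _ from antipode_alpha h]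
    simp
  | add x y hx hy => simp only [mul_add, map_add, hx, hy, smul_add]

/-- For β the innermost position is the one on the right, so it is right multiplication by a
coproduct that is absorbed. -/
theorem evalBeta_mul_comul (h : H) (t : H ⊗[k] H) :
    evalBeta k H (t * Delta k H h) = (counit h : k) • evalBeta k H t := by
  induction t using TensorProduct.induction_on with
  | zero => simp
  | tmul x y =>
    rw [evalBeta_tmul_mul, show evalBeta k H (Delta k H h) = _ from antipode_beta h]
    simp
  | add x y hx hy => simp only [add_mul, map_add, hx, hy, smul_add]

theorem onRight_counitTo {W : Type*} [Ring W] [Algebra k W] (E : Type*) [Ring E] [Algebra k E] :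
    onRight W (counitTo k H E) = (onRight W (Algebra.ofId k E)).comp (onRight W counit) :=
  onRight_comp ..

theorem splitFst_counitTo {W : Type*} [Ring W] [Algebra k W] (Y Z : Type*) [Ring Y] [Algebra k Y]
    [Ring Z] [Algebra k Z] :
    splitFst W (counitTo k H (Y ⊗[k] Z)) =
      (splitFst W (Algebra.ofId k (Y ⊗[k] Z))).comp (onLeft W counit) :=
  splitFst_comp ..

end QuasiHopfAlgebra

/-! ### The uniqueness-of-antipode argument for an antimultiplicative σ, an algebra map δ and an
element T. -/

section AbstractTwist

variable {k H E : Type*} [Field k] [Ring H] [Algebra k H] [QuasiHopfAlgebra k H]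
  [Ring E] [Algebra k E]

open QuasiBialgebra QuasiHopfAlgebra

/-- For `σ : H → E` (reversing products), `δ : H → E` and `T : E`, the linear map
`a ⊗ b ↦ σ(a) T δ(b)`. -/
def sandwich (σ : H →ₗ[k] E) (δ : H →ₐ[k] E) (T : E) : H ⊗[k] H →ₗ[k] E :=
  prodMap (LinearMap.mulRight k T ∘ₗ σ) δ.toLinearMap

@[simp] theorem sandwich_tmul (σ : H →ₗ[k] E) (δ : H →ₐ[k] E) (T : E) (a b : H) :
    sandwich σ δ T (a ⊗ₜ b) = σ a * T * δ b := by
  simp [sandwich]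

/-- `σ(x¹) T δ(x² β S(x³))`, as a linear function of `x¹ ⊗ x² ⊗ x³`. -/
def twistMap (σ : H →ₗ[k] E) (δ : H →ₐ[k] E) (T : E) : H ⊗[k] (H ⊗[k] H) →ₗ[k] E :=
  sandwich σ δ T ∘ₗ (evalBeta k H).lTensor H

@[simp] theorem twistMap_tmul (σ : H →ₗ[k] E) (δ : H →ₐ[k] E) (T : E) (a : H) (t : H ⊗[k] H) :
    twistMap σ δ T (a ⊗ₜ t) = σ a * T * δ (evalBeta k H t) := by
  simp [twistMap]

/-- The linear map `b ⊗ c ⊗ d ↦ b β S(c) α d`. -/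
def evalBetaAlpha (k H : Type*) [Field k] [Ring H] [Algebra k H] [QuasiHopfAlgebra k H] :
    H ⊗[k] (H ⊗[k] H) →ₗ[k] H :=
  prodMap (mulBeta k H) (evalAlpha k H)

@[simp] theorem evalBetaAlpha_tmul (a : H) (t : H ⊗[k] H) :
    evalBetaAlpha k H (a ⊗ₜ t) = a * beta k * evalAlpha k H t := by
  simp [evalBetaAlpha]

theorem evalBetaAlpha_Phi : evalBetaAlpha k H (phi k H) = 1 := antipode_Phi

/-- In b β S(c) α d the last two legs surround α. Writing the result with `counitTo` instead of a
scalar keeps the number of tensor factors, so the counit normalizations of the reassociators can be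
applied afterwards. The later absorption lemmas have the same form. -/
theorem evalBetaAlpha_onRight_comul_mul (t : H ⊗[k] H) (y : H ⊗[k] (H ⊗[k] H)) :
    evalBetaAlpha k H (onRight H (Delta k H) t * y) =
      evalBetaAlpha k H (onRight H (counitTo k H (H ⊗[k] H)) t * y) := by
  induction t using TensorProduct.induction_on with
  | zero => simp
  | add x y hx hy => simp only [map_add, add_mul, hx, hy]
  | tmul a b =>
    induction y using TensorProduct.induction_on with
    | zero => simp
    | add x y hx hy => simp only [map_add, mul_add, hx, hy]
    | tmul c s => simp [evalAlpha_comul_mul, counitTo_apply]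

/-- Here the first two legs surround β, so the coproduct is absorbed from the right. -/
theorem evalBetaAlpha_mul_splitFst_comul (t : H ⊗[k] H) (y : H ⊗[k] (H ⊗[k] H)) :
    evalBetaAlpha k H (y * splitFst H (Delta k H) t) =
      evalBetaAlpha k H (y * splitFst H (counitTo k H (H ⊗[k] H)) t) := by
  have key : ∀ (d : H ⊗[k] H) (a b c e : H),
      evalBetaAlpha k H ((a ⊗ₜ (b ⊗ₜ c)) * TensorProduct.assoc k H H H (d ⊗ₜ e)) =
        evalBeta k H (a ⊗ₜ b * d) * alpha k * c * e := by
    intro d a b c e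
    induction d using TensorProduct.induction_on with
    | zero => simp
    | add x y hx hy => simp only [map_add, mul_add, add_mul, TensorProduct.add_tmul, hx, hy]
    | tmul c s => simp [mul_assoc, S_mul]
  induction t using TensorProduct.induction_on with
  | zero => simp
  | add x y hx hy => simp only [map_add, mul_add, hx, hy]
  | tmul e f =>
    induction y using TensorProduct.induction_on with
    | zero => simp
    | add x y hx hy => simp only [map_add, add_mul, hx, hy]
    | tmul a s =>
      induction s using TensorProduct.induction_on with
      | zero => simp
      | add x y hx hy => simp only [map_add, add_mul, TensorProduct.tmul_add, hx, hy]
      | tmul b c =>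
        rw [splitFst_tmul, splitFst_tmul, key, key, evalBeta_mul_comul, counitTo_apply]
        simp

theorem counit_Phi_fst' (Y Z) [Ring Y] [Algebra k Y] [Ring Z] [Algebra k Z] :
    splitFst (H ⊗[k] H) (counitTo k H (Y ⊗[k] Z)) (phi k H) = 1 := by
  rw [splitFst_counitTo, AlgHom.comp_apply, show onLeft (H ⊗[k] H) counit (phi k H) = 1 from
    counit_Phi_fst, map_one]

theorem counit_Phi_snd' (Y Z) [Ring Y] [Algebra k Y] [Ring Z] [Algebra k Z] :
    onRight H (splitFst H (counitTo k H (Y ⊗[k] Z))) (phi k H) = 1 := by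
  rw [splitFst_counitTo, onRight_comp, AlgHom.comp_apply,
    show onRight H (onLeft H counit) (phi k H) = 1 from counit_Phi_snd, map_one]

theorem counit_Phi_trd' (E) [Ring E] [Algebra k E] :
    onRight H (onRight H (counitTo k H E)) (phi k H) = 1 := by
  rw [onRight_counitTo, onRight_comp, AlgHom.comp_apply,
    show onRight H (onRight H counit) (phi k H) = 1 from counit_Phi_trd, map_one]

theorem phi_mul_PhiInv : phi k H * PhiInv k H = 1 := Units.mul_inv _
theorem PhiInv_mul_phi : PhiInv k H * phi k H = 1 := Units.inv_mul _

theorem map_PhiInv_eq_one {E : Type*} [Ring E] [Algebra k E] (f : H ⊗[k] (H ⊗[k] H) →ₐ[k] E)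
    (hf : f (phi k H) = 1) : f (PhiInv k H) = 1 := by
  have h : f (phi k H * PhiInv k H) = 1 := by rw [phi_mul_PhiInv, map_one]
  rwa [map_mul, hf, one_mul] at h

variable {σ : H →ₗ[k] E} {δ : H →ₐ[k] E} {T : E}

theorem sandwich_mul_tmul (hσ : ∀ a b, σ (a * b) = σ b * σ a) (d : H ⊗[k] H) (a b : H) :
    sandwich σ δ T (d * a ⊗ₜ b) = σ a * sandwich σ δ T d * δ b := by
  induction d using TensorProduct.induction_on with
  | zero => simp
  | add x y hx hy => simp only [map_add, mul_add, add_mul, hx, hy]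
  | tmul c s => simp [mul_assoc, hσ]

theorem sandwich_comul_mul (hσ : ∀ a b, σ (a * b) = σ b * σ a)
    (hT : ∀ h, sandwich σ δ T (Delta k H h) = (counit h : k) • T) (h : H) (t : H ⊗[k] H) :
    sandwich σ δ T (Delta k H h * t) = (counit h : k) • sandwich σ δ T t := by
  induction t using TensorProduct.induction_on with
  | zero => simp
  | add x y hx hy => simp only [map_add, mul_add, smul_add, hx, hy]
  | tmul c s => rw [sandwich_mul_tmul hσ, hT]; simp

/-- Hypothesis `hT` makes T play the role of α: the first two legs enter as σ(–) T δ(–), with the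
left factor innermost. -/
theorem twistMap_splitFst_comul_mul (hσ : ∀ a b, σ (a * b) = σ b * σ a)
    (hT : ∀ h, sandwich σ δ T (Delta k H h) = (counit h : k) • T)
    (t : H ⊗[k] H) (y : H ⊗[k] (H ⊗[k] H)) :
    twistMap σ δ T (splitFst H (Delta k H) t * y) =
      twistMap σ δ T (splitFst H (counitTo k H (H ⊗[k] H)) t * y) := by
  have key : ∀ (d : H ⊗[k] H) (a b c e : H),
      twistMap σ δ T (TensorProduct.assoc k H H H (d ⊗ₜ e) * (a ⊗ₜ (b ⊗ₜ c))) =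
        sandwich σ δ T (d * a ⊗ₜ (b * beta k * S k H (e * c))) := by
    intro d a b c e
    induction d using TensorProduct.induction_on with
    | zero => simp
    | add x y hx hy => simp only [map_add, add_mul, TensorProduct.add_tmul, hx, hy]
    | tmul c s => simp [mul_assoc]
  induction t using TensorProduct.induction_on with
  | zero => simp
  | add x y hx hy => simp only [map_add, add_mul, hx, hy]
  | tmul e f =>
    induction y using TensorProduct.induction_on with
    | zero => simp
    | add x y hx hy => simp only [map_add, mul_add, hx, hy]
    | tmul a s =>
      induction s using TensorProduct.induction_on with
      | zero => simp
      | add x y hx hy => simp only [map_add, mul_add, TensorProduct.tmul_add, hx, hy]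
      | tmul b c =>
        rw [splitFst_tmul, splitFst_tmul, key, key, sandwich_comul_mul hσ hT, counitTo_apply]
        simp

theorem twistMap_mul_onRight_comul (t : H ⊗[k] H) (y : H ⊗[k] (H ⊗[k] H)) :
    twistMap σ δ T (y * onRight H (Delta k H) t) =
      twistMap σ δ T (y * onRight H (counitTo k H (H ⊗[k] H)) t) := by
  induction t using TensorProduct.induction_on with
  | zero => simp
  | add x y hx hy => simp only [map_add, mul_add, hx, hy]
  | tmul e f =>
    induction y using TensorProduct.induction_on with
    | zero => simp
    | add x y hx hy => simp only [map_add, add_mul, hx, hy]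
    | tmul a s => simp [evalBeta_mul_comul, counitTo_apply]

theorem splitFst_counitTo_comul (h : H) :
    splitFst H (counitTo k H (H ⊗[k] H)) (Delta k H h) = 1 ⊗ₜ (1 ⊗ₜ h) := by
  rw [splitFst_counitTo, AlgHom.comp_apply,
    show onLeft H counit (Delta k H h) = _ from counit_left h]
  simp [splitFst_tmul]

theorem onRight_counitTo_comul (E) [Ring E] [Algebra k E] (h : H) :
    onRight H (counitTo k H E) (Delta k H h) = h ⊗ₜ 1 := by
  rw [onRight_counitTo, AlgHom.comp_apply,
    show onRight H counit (Delta k H h) = _ from counit_right h]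
  simp

/-- `F δ(S(a)) = σ(a) F` for `F = σ(x¹) T δ(x² β S(x³))`. -/
theorem twistMap_PhiInv_mul_S (hσ : ∀ a b, σ (a * b) = σ b * σ a)
    (hT : ∀ h, sandwich σ δ T (Delta k H h) = (counit h : k) • T) (a : H) :
    twistMap σ δ T (PhiInv k H) * δ (S k H a) = σ a * twistMap σ δ T (PhiInv k H) := by
  -- Quasi-coassociativity is evaluated under σ(x¹) T δ(x² β S(x³)). On the left β absorbs the inner
  -- coproduct and leaves a in leg one, hence σ(a); on the right T absorbs it and leaves a in leg
  -- three, hence δ(S(a)).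
  have h1 : PhiInv k H * onRight H (Delta k H) (Delta k H a) =
      splitFst H (Delta k H) (Delta k H a) * PhiInv k H := by
    rw [show onRight H (Delta k H) (Delta k H a) = phi k H * _ * PhiInv k H from coassoc a,
      ← mul_assoc, ← mul_assoc, PhiInv_mul_phi, one_mul]
  have h2 := congrArg (twistMap σ δ T) h1
  rw [twistMap_mul_onRight_comul, twistMap_splitFst_comul_mul hσ hT, splitFst_counitTo_comul,
    onRight_counitTo_comul] at h2
  have h3 : ∀ y, twistMap σ δ T (y * a ⊗ₜ 1) = σ a * twistMap σ δ T y := by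
    intro y
    induction y using TensorProduct.induction_on with
    | zero => simp
    | add x y hx hy => simp only [map_add, mul_add, add_mul, hx, hy]
    | tmul c s => simp [hσ, mul_assoc]
  have h4 : ∀ y, twistMap σ δ T ((1 ⊗ₜ (1 ⊗ₜ a)) * y) = twistMap σ δ T y * δ (S k H a) := by
    intro y
    induction y using TensorProduct.induction_on with
    | zero => simp
    | add x y hx hy => simp only [map_add, mul_add, add_mul, hx, hy]
    | tmul c s => simp [evalBeta_tmul_mul, mul_assoc]
  rw [h3, h4] at h2
  exact h2.symm

/-- `σ(a) T δ(b β S(c) α d)`, as a linear function of `a ⊗ b ⊗ c ⊗ d`. -/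
def twistMapAlpha (σ : H →ₗ[k] E) (δ : H →ₐ[k] E) (T : E) :
    H ⊗[k] (H ⊗[k] (H ⊗[k] H)) →ₗ[k] E :=
  sandwich σ δ T ∘ₗ (evalBetaAlpha k H).lTensor H

@[simp] theorem twistMapAlpha_tmul (a : H) (t : H ⊗[k] (H ⊗[k] H)) :
    twistMapAlpha σ δ T (a ⊗ₜ t) = σ a * T * δ (evalBetaAlpha k H t) := by
  simp [twistMapAlpha]

theorem twistMapAlpha_splitFst_comul_mul (hσ : ∀ a b, σ (a * b) = σ b * σ a)
    (hT : ∀ h, sandwich σ δ T (Delta k H h) = (counit h : k) • T)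
    (t : H ⊗[k] (H ⊗[k] H)) (y : H ⊗[k] (H ⊗[k] (H ⊗[k] H))) :
    twistMapAlpha σ δ T (splitFst (H ⊗[k] H) (Delta k H) t * y) =
      twistMapAlpha σ δ T (splitFst (H ⊗[k] H) (counitTo k H (H ⊗[k] H)) t * y) := by
  have key : ∀ (d : H ⊗[k] H) (a b : H) (c e : H ⊗[k] H),
      twistMapAlpha σ δ T (TensorProduct.assoc k H H _ (d ⊗ₜ e) * (a ⊗ₜ (b ⊗ₜ c))) =
        sandwich σ δ T (d * a ⊗ₜ (b * beta k * evalAlpha k H (e * c))) := by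
    intro d a b c e
    induction d using TensorProduct.induction_on with
    | zero => simp
    | add x y hx hy => simp only [map_add, add_mul, TensorProduct.add_tmul, hx, hy]
    | tmul c s => simp [mul_assoc]
  induction t using TensorProduct.induction_on with
  | zero => simp
  | add x y hx hy => simp only [map_add, add_mul, hx, hy]
  | tmul e f =>
    induction y using TensorProduct.induction_on with
    | zero => simp
    | add x y hx hy => simp only [map_add, mul_add, hx, hy]
    | tmul a s =>
      induction s using TensorProduct.induction_on with
      | zero => simp
      | add x y hx hy => simp only [map_add, mul_add, TensorProduct.tmul_add, hx, hy]
      | tmul b c =>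
        rw [splitFst_tmul, splitFst_tmul, key, key, sandwich_comul_mul hσ hT, counitTo_apply]
        simp

theorem lTensor_evalBetaAlpha_onRight_comul_mul {A : Type*} [Ring A] [Algebra k A]
    (t : A ⊗[k] (H ⊗[k] H)) (y : A ⊗[k] (H ⊗[k] (H ⊗[k] H))) :
    (evalBetaAlpha k H).lTensor A (onRight A (onRight H (Delta k H)) t * y) =
      (evalBetaAlpha k H).lTensor A (onRight A (onRight H (counitTo k H (H ⊗[k] H))) t * y) := by
  induction t using TensorProduct.induction_on with
  | zero => simp
  | add x y hx hy => simp only [map_add, add_mul, hx, hy]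
  | tmul e f =>
    induction y using TensorProduct.induction_on with
    | zero => simp
    | add x y hx hy => simp only [map_add, mul_add, hx, hy]
    | tmul a s => simp [evalBetaAlpha_onRight_comul_mul]

theorem lTensor_evalBetaAlpha_mul_splitFst_comul {A : Type*} [Ring A] [Algebra k A]
    (t : A ⊗[k] (H ⊗[k] H)) (y : A ⊗[k] (H ⊗[k] (H ⊗[k] H))) :
    (evalBetaAlpha k H).lTensor A (y * onRight A (splitFst H (Delta k H)) t) =
      (evalBetaAlpha k H).lTensor A
        (y * onRight A (splitFst H (counitTo k H (H ⊗[k] H))) t) := by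
  induction t using TensorProduct.induction_on with
  | zero => simp
  | add x y hx hy => simp only [map_add, mul_add, hx, hy]
  | tmul e f =>
    induction y using TensorProduct.induction_on with
    | zero => simp
    | add x y hx hy => simp only [map_add, add_mul, hx, hy]
    | tmul a s => simp [evalBetaAlpha_mul_splitFst_comul]

/-- `F δ(α) = T` for `F = σ(x¹) T δ(x² β S(x³))`. -/
theorem twistMap_PhiInv_mul_alpha (hσ : ∀ a b, σ (a * b) = σ b * σ a) (hσ1 : σ 1 = 1)
    (hT : ∀ h, sandwich σ δ T (Delta k H h) = (counit h : k) • T) :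
    twistMap σ δ T (PhiInv k H) * δ (alpha k) = T := by
  -- The pentagon is rearranged to isolate Φ⁻¹ ⊗ 1 on the right. Under σ(a) T δ(b β S(c) α d) the
  -- three factors containing Δ are absorbed by α, β and T and become trivial. Then Φ⁻¹ ⊗ 1 yields F
  -- δ(α), while 1 ⊗ Φ yields T, since X¹ β S(X²) α X³ = 1 and σ(1) = 1.
  have h1 : onRight H (onRight H (Delta k H)) (PhiInv k H) * oneTmul H _ (phi k H) *
      onRight H (splitFst H (Delta k H)) (phi k H) =
      splitFst (H ⊗[k] H) (Delta k H) (phi k H) *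
        onRight H (onRight H (tmulOne H H)) (PhiInv k H) := by
    have h := pentagon (k := k) (H := H)
    change oneTmul H _ (phi k H) * onRight H (splitFst H (Delta k H)) (phi k H) *
      onRight H (onRight H (tmulOne H H)) (phi k H) = onRight H (onRight H (Delta k H)) (phi k H) *
      splitFst (H ⊗[k] H) (Delta k H) (phi k H) at h
    have h' := congrArg (fun z => onRight H (onRight H (Delta k H)) (PhiInv k H) * z *
        onRight H (onRight H (tmulOne H H)) (PhiInv k H)) h
    simp only [mul_assoc] at h' ⊢
    rw [← map_mul (onRight H (onRight H (tmulOne H H))), phi_mul_PhiInv, map_one, mul_one] at h'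
    rw [h', ← mul_assoc, ← map_mul (onRight H (onRight H (Delta k H))), PhiInv_mul_phi, map_one,
      one_mul]
  have h2 := congrArg (twistMapAlpha σ δ T) h1
  rw [twistMapAlpha_splitFst_comul_mul hσ hT, counit_Phi_fst', one_mul, mul_assoc] at h2
  have h3 := lTensor_evalBetaAlpha_onRight_comul_mul (PhiInv k H)
    (oneTmul H _ (phi k H) * onRight H (splitFst H (Delta k H)) (phi k H))
  rw [map_PhiInv_eq_one (onRight H (onRight H (counitTo k H (H ⊗[k] H)))) (counit_Phi_trd' _),
    one_mul, lTensor_evalBetaAlpha_mul_splitFst_comul] at h3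
  rw [counit_Phi_snd', mul_one] at h3
  rw [twistMapAlpha, LinearMap.comp_apply, h3] at h2
  have h4 : ∀ y, sandwich σ δ T ((evalBetaAlpha k H).lTensor H
      (onRight H (onRight H (tmulOne H H)) y)) = twistMap σ δ T y * δ (alpha k) := by
    intro y
    induction y using TensorProduct.induction_on with
    | zero => simp
    | add x y hx hy => simp only [map_add, add_mul, hx, hy]
    | tmul c s =>
      induction s using TensorProduct.induction_on with
      | zero => simp
      | add x y hx hy => simp only [map_add, add_mul, TensorProduct.tmul_add, hx, hy]
      | tmul a b => simp [mul_assoc]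
  rw [LinearMap.comp_apply, h4] at h2
  rw [← h2]
  simp [evalBetaAlpha_Phi, hσ1]

end AbstractTwist

/-! ### Drinfeld's twist f: the case σ = (S ⊗ S)Δᶜᵒᵖ, δ = Δ, T = g. -/

section DrinfeldTwist

variable {k H : Type*} [Field k] [Ring H] [Algebra k H] [QuasiHopfAlgebra k H]

open QuasiBialgebra QuasiHopfAlgebra

theorem antipodeCop_mul (a b : H) :
    antipodeCop k H (a * b) = antipodeCop k H b * antipodeCop k H a := by
  simp only [antipodeCop, LinearMap.comp_apply, AlgHom.toLinearMap_apply, map_mul,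
    LinearEquiv.coe_coe]
  generalize Delta k H a = x
  generalize Delta k H b = y
  induction x using TensorProduct.induction_on with
  | zero => simp
  | add x y hx hy => simp only [map_add, add_mul, mul_add, hx, hy]
  | tmul a b =>
    induction y using TensorProduct.induction_on with
    | zero => simp
    | add x y hx hy => simp only [map_add, add_mul, mul_add, hx, hy]
    | tmul c d => simp [-LinearEquiv.coe_coe, S_mul]

theorem antipodeCop_one : antipodeCop k H 1 = 1 := by
  simp [antipodeCop, -LinearEquiv.coe_coe, Algebra.TensorProduct.one_def]

/-- The outer factors move inside: legs one and two occur under S, in flipped order, and legs three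
and four occur plainly, which is exactly how (S ⊗ S)Δᶜᵒᵖ(a) and Δ(b) multiply from the two sides. -/
theorem sandwich_gammaMap (d : H ⊗[k] H) (y : H ⊗[k] (H ⊗[k] (H ⊗[k] H))) :
    sandwich (antipodeCop k H) (Delta k H) (gammaMap k H y) d =
      gammaMap k H (y * splitFst (H ⊗[k] H) (Delta k H) (onRight H (Delta k H) d)) := by
  have key : ∀ p r : H ⊗[k] H,
      TensorProduct.map (S k H) (S k H) (TensorProduct.comm k H H p) * gammaMap k H y * r =
        gammaMap k H (y * TensorProduct.assoc k H H (H ⊗[k] H) (p ⊗ₜ r)) := by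
    intro p r
    induction p using TensorProduct.induction_on with
    | zero => simp
    | add x y hx hy => simp only [map_add, add_mul, mul_add, TensorProduct.add_tmul, hx, hy]
    | tmul a b =>
    induction r using TensorProduct.induction_on with
    | zero => simp
    | add x y hx hy => simp only [map_add, mul_add, TensorProduct.tmul_add, hx, hy]
    | tmul c d =>
    induction y using TensorProduct.induction_on with
    | zero => simp
    | add x y hx hy => simp only [map_add, add_mul, mul_add, hx, hy]
    | tmul y₁ y =>
    induction y using TensorProduct.induction_on with
    | zero => simp
    | add x y hx hy => simp only [map_add, add_mul, mul_add, TensorProduct.tmul_add, hx, hy]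
    | tmul y₂ y =>
    induction y using TensorProduct.induction_on with
    | zero => simp
    | add x y hx hy => simp only [map_add, add_mul, mul_add, TensorProduct.tmul_add, hx, hy]
    | tmul y₃ y₄ =>
      simp only [TensorProduct.comm_tmul, TensorProduct.map_tmul, TensorProduct.assoc_tmul,
        Algebra.TensorProduct.tmul_mul_tmul, gammaMap_tmul, S_mul, mul_assoc]
  induction d using TensorProduct.induction_on with
  | zero => simp
  | add x y hx hy => simp only [map_add, mul_add, hx, hy]
  | tmul a b =>
    rw [sandwich_tmul, onRight_tmul, splitFst_tmul, ← key]
    rfl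

theorem splitFst_splitFst_tmul {A : Type*} [Ring A] [Algebra k A] (f : A →ₐ[k] A ⊗[k] H)
    (d : A ⊗[k] H) (y : H) :
    splitFst (H ⊗[k] H) f (TensorProduct.assoc k A H H (d ⊗ₜ y)) =
      onRight A (onRight H (tmulOne H H)) (splitFst H f d) * 1 ⊗ₜ (1 ⊗ₜ (1 ⊗ₜ y)) := by
  induction d using TensorProduct.induction_on with
  | zero => simp
  | add x y hx hy => simp only [map_add, add_mul, TensorProduct.add_tmul, hx, hy]
  | tmul a b =>
    simp only [TensorProduct.assoc_tmul, splitFst_tmul]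
    generalize f a = r
    induction r using TensorProduct.induction_on with
    | zero => simp
    | add x y hx hy => simp only [map_add, add_mul, TensorProduct.add_tmul, hx, hy]
    | tmul a b => simp

theorem onRight_splitFst_tmul {A : Type*} [Ring A] [Algebra k A] (d : A ⊗[k] H) (y : H) :
    onRight A (splitFst H (Delta k H)) (TensorProduct.assoc k A H H (d ⊗ₜ y)) =
      onRight A (onRight H (tmulOne H H)) (onRight A (Delta k H) d) *
        1 ⊗ₜ (1 ⊗ₜ (1 ⊗ₜ y)) := by
  induction d using TensorProduct.induction_on with
  | zero => simp
  | add x y hx hy => simp only [map_add, add_mul, TensorProduct.add_tmul, hx, hy]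
  | tmul a b =>
    simp only [TensorProduct.assoc_tmul, onRight_tmul, splitFst_tmul]
    generalize Delta k H b = r
    induction r using TensorProduct.induction_on with
    | zero => simp
    | add x y hx hy =>
      simp only [map_add, add_mul, TensorProduct.add_tmul, TensorProduct.tmul_add, hx, hy]
    | tmul a b => simp

theorem phi_mul_splitFst_comul (a : H) :
    phi k H * splitFst H (Delta k H) (Delta k H a) =
      onRight H (Delta k H) (Delta k H a) * phi k H := by
  rw [show onRight H (Delta k H) (Delta k H a) = phi k H * _ * PhiInv k H from coassoc a,
      mul_assoc (_ * _), PhiInv_mul_phi, mul_one]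

theorem splitFst_comul_mul_PhiInv (a : H) :
    PhiInv k H * onRight H (Delta k H) (Delta k H a) =
      splitFst H (Delta k H) (Delta k H a) * PhiInv k H := by
  rw [show onRight H (Delta k H) (Delta k H a) = phi k H * _ * PhiInv k H from coassoc a,
      ← mul_assoc, ← mul_assoc, PhiInv_mul_phi, one_mul]

/-- `(Φ ⊗ 1)((Δ ⊗ id)Δ ⊗ id)(d) = ((id ⊗ Δ)Δ ⊗ id)(d)(Φ ⊗ 1)`. -/
theorem phi_tmul_one_mul_splitFst (d : H ⊗[k] H) :
    onRight H (onRight H (tmulOne H H)) (phi k H) *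
        splitFst (H ⊗[k] H) (Delta k H) (splitFst H (Delta k H) d) =
      onRight H (splitFst H (Delta k H)) (splitFst H (Delta k H) d) *
        onRight H (onRight H (tmulOne H H)) (phi k H) := by
  induction d using TensorProduct.induction_on with
  | zero => simp
  | add x y hx hy => simp only [map_add, add_mul, mul_add, hx, hy]
  | tmul a b =>
    -- The second tensor factor of d sits in leg four, where Φ ⊗ 1 is trivial.
    have hc : ∀ z : H ⊗[k] (H ⊗[k] H),
        Commute ((1 : H) ⊗ₜ[k] ((1 : H) ⊗ₜ[k] ((1 : H) ⊗ₜ[k] b)))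
          (onRight H (onRight H (tmulOne H H)) z) := by
      intro z
      induction z using TensorProduct.induction_on with
      | zero => simp
      | add x y hx hy => rw [map_add]; exact hx.add_right hy
      | tmul c z =>
      induction z using TensorProduct.induction_on with
      | zero => simp
      | add x y hx hy => rw [TensorProduct.tmul_add, map_add]; exact hx.add_right hy
      | tmul d e => simp [Commute, SemiconjBy]
    rw [splitFst_tmul, splitFst_splitFst_tmul, onRight_splitFst_tmul, mul_assoc, (hc _).eq,
      ← mul_assoc, ← mul_assoc, ← map_mul, ← map_mul, phi_mul_splitFst_comul]

/-- A is made of Φ⁻¹ followed by Φ, so two rebracketings turn Δ(h₁) ⊗ Δ(h₂) into the nested form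
with a coproduct in the two middle legs. Nesting is what lets S(A²) α A³ absorb first and S(A¹) α A⁴
afterwards. -/
theorem elemA_mul_comul (h : H) :
    elemA k H * splitFst (H ⊗[k] H) (Delta k H) (onRight H (Delta k H) (Delta k H h)) =
      onRight H (splitFst H (Delta k H)) (splitFst H (Delta k H) (Delta k H h)) *
        elemA k H := by
  rw [elemA, mul_assoc, ← map_mul, splitFst_comul_mul_PhiInv, map_mul, ← mul_assoc,
    phi_tmul_one_mul_splitFst, mul_assoc]

/-- The middle legs two and three are the ones that surround the first α. -/
theorem gammaMap_onRight_splitFst_comul_mul (t : H ⊗[k] (H ⊗[k] H))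
    (y : H ⊗[k] (H ⊗[k] (H ⊗[k] H))) :
    gammaMap k H (onRight H (splitFst H (Delta k H)) t * y) =
      gammaMap k H (onRight H (splitFst H (counitTo k H (H ⊗[k] H))) t * y) := by
  have key : ∀ (a b y₁ y₂ y₃ y₄ : H) (d : H ⊗[k] H),
      gammaMap k H ((a ⊗ₜ TensorProduct.assoc k H H H (d ⊗ₜ b)) *
        y₁ ⊗ₜ (y₂ ⊗ₜ (y₃ ⊗ₜ y₄))) =
      evalAlpha k H (d * y₂ ⊗ₜ y₃) ⊗ₜ (S k H (a * y₁) * alpha k * (b * y₄)) := by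
    intro a b y₁ y₂ y₃ y₄ d
    induction d using TensorProduct.induction_on with
    | zero => simp
    | add x y hx hy =>
      simp only [map_add, add_mul, TensorProduct.add_tmul, TensorProduct.tmul_add, hx, hy]
    | tmul c s => simp only [TensorProduct.assoc_tmul, Algebra.TensorProduct.tmul_mul_tmul,
        gammaMap_tmul, evalAlpha_tmul]
  induction t using TensorProduct.induction_on with
  | zero => simp
  | add x y hx hy => simp only [map_add, add_mul, hx, hy]
  | tmul a t =>
  induction t using TensorProduct.induction_on with
  | zero => simp
  | add x y hx hy => simp only [map_add, add_mul, TensorProduct.tmul_add, hx, hy]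
  | tmul c b =>
  induction y using TensorProduct.induction_on with
  | zero => simp
  | add x y hx hy => simp only [map_add, mul_add, hx, hy]
  | tmul y₁ y =>
  induction y using TensorProduct.induction_on with
  | zero => simp
  | add x y hx hy => simp only [map_add, mul_add, TensorProduct.tmul_add, hx, hy]
  | tmul y₂ y =>
  induction y using TensorProduct.induction_on with
  | zero => simp
  | add x y hx hy => simp only [map_add, mul_add, TensorProduct.tmul_add, hx, hy]
  | tmul y₃ y₄ =>
    rw [onRight_tmul, splitFst_tmul, key, onRight_tmul, splitFst_tmul, key, evalAlpha_comul_mul,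
      counitTo_apply]
    simp

theorem onRight_splitFst_counitTo_splitFst_comul (d : H ⊗[k] H) :
    onRight H (splitFst H (counitTo k H (H ⊗[k] H))) (splitFst H (Delta k H) d) =
      onRight H ((oneTmul H (H ⊗[k] H)).comp (oneTmul H H)) d := by
  induction d using TensorProduct.induction_on with
  | zero => simp
  | add x y hx hy => simp only [map_add, hx, hy]
  | tmul a b =>
    have h2 : ∀ r : H ⊗[k] H, onRight H (splitFst H (counitTo k H (H ⊗[k] H)))
        (TensorProduct.assoc k H H H (r ⊗ₜ b)) =
        onRight H (counitTo k H (H ⊗[k] (H ⊗[k] H))) r * 1 ⊗ₜ (1 ⊗ₜ (1 ⊗ₜ b)) := by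
      intro r
      induction r using TensorProduct.induction_on with
      | zero => simp
      | add x y hx hy => simp only [map_add, add_mul, TensorProduct.add_tmul, hx, hy]
      | tmul a c =>
        simp [splitFst_tmul, counitTo_apply, TensorProduct.smul_tmul',
          Algebra.TensorProduct.one_def]
    rw [splitFst_tmul, h2, onRight_counitTo_comul]
    simp

/-- `(S ⊗ S)(Δᶜᵒᵖ(h₁)) γ Δ(h₂) = ε(h) γ`. -/
theorem sandwich_gammaElem_comul (h : H) :
    sandwich (antipodeCop k H) (Delta k H) (gammaElem k H) (Delta k H h) =
      (counit h : k) • gammaElem k H := by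
  -- The inner coproduct is absorbed here. Only the outer legs h₁ and h₂ remain, in positions one
  -- and four, and these are absorbed by the second α.
  rw [gammaElem, sandwich_gammaMap, elemA_mul_comul, gammaMap_onRight_splitFst_comul_mul]
  have h3 : ∀ d : H ⊗[k] H, ∀ y₁ y₂ y₃ y₄ : H,
      gammaMap k H (onRight H ((oneTmul H (H ⊗[k] H)).comp (oneTmul H H)) d *
        y₁ ⊗ₜ (y₂ ⊗ₜ (y₃ ⊗ₜ y₄))) =
      (S k H y₂ * alpha k * y₃) ⊗ₜ evalAlpha k H (d * y₁ ⊗ₜ y₄) := by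
    intro d y₁ y₂ y₃ y₄
    induction d using TensorProduct.induction_on with
    | zero => simp
    | add x y hx hy => simp only [map_add, add_mul, TensorProduct.tmul_add, hx, hy]
    | tmul a c =>
      simp [-LinearEquiv.coe_coe, gammaMap_tmul]
  rw [onRight_splitFst_counitTo_splitFst_comul]
  generalize elemA k H = y
  induction y using TensorProduct.induction_on with
  | zero => simp
  | add x y hx hy => simp only [map_add, mul_add, smul_add, hx, hy]
  | tmul y₁ y =>
  induction y using TensorProduct.induction_on with
  | zero => simp
  | add x y hx hy => simp only [map_add, mul_add, smul_add, TensorProduct.tmul_add, hx, hy]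
  | tmul y₂ y =>
  induction y using TensorProduct.induction_on with
  | zero => simp
  | add x y hx hy => simp only [map_add, mul_add, smul_add, TensorProduct.tmul_add, hx, hy]
  | tmul y₃ y₄ =>
    rw [h3, evalAlpha_comul_mul]
    simp [-LinearEquiv.coe_coe, gammaMap_tmul]

/-- Apply ε to S(h₁) α h₂ = ε(h) α and use ε(α) = 1. -/
theorem counit_S (h : H) : (counit (S k H h) : k) = counit h := by
  have h1 := congrArg (counit (k := k) (H := H)) (antipode_alpha (k := k) h)
  have h2 : ∀ d : H ⊗[k] H, (counit (evalAlpha k H d) : k) =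
      counit (S k H (TensorProduct.rid k H (onRight H counit d))) := by
    intro d
    induction d using TensorProduct.induction_on with
    | zero => simp
    | add x y hx hy => simp only [map_add, hx, hy]
    | tmul a c => simp [-LinearEquiv.coe_coe, counit_alpha, mul_comm]
  change counit (evalAlpha k H (Delta k H h)) = counit _ at h1
  rw [h2, counit_right] at h1
  simpa [counit_alpha] using h1

theorem counit_SInv (h : H) : (counit (SInv k H h) : k) = counit h := by
  have h1 := counit_S (k := k) (SInv k H h)
  rw [S_SInv] at h1
  exact h1.symm

theorem drinfeldTwist_eq :
    drinfeldTwist k H =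
      twistMap (antipodeCop k H) (Delta k H) (gammaElem k H) (PhiInv k H) := by
  simp only [drinfeldTwist]
  refine tensor_ext (fun a b => ?_) _
  simp only [prodMap_tmul, twistMap_tmul]
  rfl

/-- `f Δ(S(a)) = (S ⊗ S)(Δᶜᵒᵖ(a)) f`. -/
theorem drinfeldTwist_mul_comul_S (a : H) :
    drinfeldTwist k H * Delta k H (S k H a) = antipodeCop k H a * drinfeldTwist k H := by
  rw [drinfeldTwist_eq]
  exact twistMap_PhiInv_mul_S antipodeCop_mul sandwich_gammaElem_comul a

/-- `f Δ(α) = γ`. -/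
theorem drinfeldTwist_mul_comul_alpha :
    drinfeldTwist k H * Delta k H (alpha k) = gammaElem k H := by
  rw [drinfeldTwist_eq]
  exact twistMap_PhiInv_mul_alpha antipodeCop_mul antipodeCop_one sandwich_gammaElem_comul

end DrinfeldTwist

/-! ### Counit normalizations of g and f. -/

section Counit

variable (k H Y : Type*) [Field k] [Ring H] [Algebra k H] [QuasiHopfAlgebra k H]
  [Ring Y] [Algebra k Y]

open QuasiBialgebra QuasiHopfAlgebra

/-- The algebra map `h ⊗ y ↦ ε(h) y`. -/
def counitFst : H ⊗[k] Y →ₐ[k] Y :=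
  (Algebra.TensorProduct.lid k Y).toAlgHom.comp (onLeft Y counit)

/-- The algebra map `y ⊗ h ↦ ε(h) y`. -/
def counitSnd : Y ⊗[k] H →ₐ[k] Y :=
  (Algebra.TensorProduct.rid k k Y).toAlgHom.comp (onRight Y counit)

variable {k H Y}

@[simp] theorem counitFst_tmul (h : H) (y : Y) :
    counitFst k H Y (h ⊗ₜ y) = (counit h : k) • y := by
  simp [counitFst]

@[simp] theorem counitSnd_tmul (h : H) (y : Y) :
    counitSnd k H Y (y ⊗ₜ h) = (counit h : k) • y := by
  simp [counitSnd]

@[simp] theorem counitFst_comul (h : H) : counitFst k H H (Delta k H h) = h := by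
  rw [counitFst, AlgHom.comp_apply, show onLeft H counit (Delta k H h) = _ from counit_left h]
  simp

@[simp] theorem counitSnd_comul (h : H) : counitSnd k H H (Delta k H h) = h := by
  rw [counitSnd, AlgHom.comp_apply, show onRight H counit (Delta k H h) = _ from counit_right h]
  simp

theorem counitFst_phi : counitFst k H (H ⊗[k] H) (phi k H) = 1 := by
  rw [counitFst, AlgHom.comp_apply, show onLeft _ counit (phi k H) = _ from counit_Phi_fst,
    map_one]

theorem onRight_counitFst_phi : onRight H (counitFst k H H) (phi k H) = 1 := by
  rw [counitFst, onRight_comp, AlgHom.comp_apply,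
    show onRight H (onLeft _ counit) (phi k H) = _ from counit_Phi_snd, map_one]

theorem onRight_counitSnd_phi : onRight H (counitSnd k H H) (phi k H) = 1 := by
  rw [counitSnd, onRight_comp, AlgHom.comp_apply,
    show onRight H (onRight _ counit) (phi k H) = _ from counit_Phi_trd, map_one]

theorem counitFst_splitFst_comul {W : Type*} [Ring W] [Algebra k W] (t : H ⊗[k] W) :
    counitFst k H (H ⊗[k] W) (splitFst W (Delta k H) t) = t := by
  induction t using TensorProduct.induction_on with
  | zero => simp
  | add x y hx hy => simp only [map_add, hx, hy]
  | tmul a w =>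
    have h : ∀ d : H ⊗[k] H, counitFst k H (H ⊗[k] W) (TensorProduct.assoc k H H W (d ⊗ₜ w)) =
        counitFst k H H d ⊗ₜ w := by
      intro d
      induction d using TensorProduct.induction_on with
      | zero => simp
      | add x y hx hy => simp only [map_add, TensorProduct.add_tmul, hx, hy]
      | tmul b c => simp [TensorProduct.smul_tmul']
    rw [splitFst_tmul, h, counitFst_comul]

theorem onRight_counitFst_splitFst {W A : Type*} [Ring W] [Algebra k W] [Ring A] [Algebra k A]
    (f : A →ₐ[k] A ⊗[k] H) (hf : ∀ a, counitSnd k H A (f a) = a) (t : A ⊗[k] W) :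
    onRight A (counitFst k H W) (splitFst W f t) = t := by
  induction t using TensorProduct.induction_on with
  | zero => simp
  | add x y hx hy => simp only [map_add, hx, hy]
  | tmul a w =>
    have h : ∀ d : A ⊗[k] H, onRight A (counitFst k H W) (TensorProduct.assoc k A H W (d ⊗ₜ w)) =
        counitSnd k H A d ⊗ₜ w := by
      intro d
      induction d using TensorProduct.induction_on with
      | zero => simp
      | add x y hx hy => simp only [map_add, TensorProduct.add_tmul, hx, hy]
      | tmul b c => simp [TensorProduct.smul_tmul']
    rw [splitFst_tmul, h, hf]

/-- The counit on S(A²) α A³ kills legs two and three of A. Each of the two factors of A then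
reduces to the middle normalization of Φ or Φ⁻¹, and S(1) α 1 is left. -/
theorem counitFst_gammaElem : counitFst k H H (gammaElem k H) = alpha k := by
  have h1 : ∀ y, counitFst k H H (gammaMap k H y) =
      evalAlpha k H (onRight H ((counitFst k H H).comp (counitFst k H (H ⊗[k] H))) y) := by
    intro y
    induction y using TensorProduct.induction_on with
    | zero => simp
    | add x y hx hy => simp only [map_add, hx, hy]
    | tmul y₁ y =>
    induction y using TensorProduct.induction_on with
    | zero => simp
    | add x y hx hy => simp only [map_add, TensorProduct.tmul_add, hx, hy]
    | tmul y₂ y =>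
    induction y using TensorProduct.induction_on with
    | zero => simp
    | add x y hx hy => simp only [map_add, TensorProduct.tmul_add, hx, hy]
    | tmul y₃ y₄ =>
      simp only [gammaMap_tmul, counitFst_tmul, map_mul, counit_S, counit_alpha]
      simp [smul_smul, mul_comm]
  have h2 : ∀ y, onRight H ((counitFst k H H).comp (counitFst k H (H ⊗[k] H)))
      (onRight H (onRight H (tmulOne H H)) y) =
      onRight H (counitTo k H H) (onRight H (counitFst k H H) y) := by
    intro y
    induction y using TensorProduct.induction_on with
    | zero => simp
    | add x y hx hy => simp only [map_add, hx, hy]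
    | tmul y₁ y =>
    induction y using TensorProduct.induction_on with
    | zero => simp
    | add x y hx hy => simp only [map_add, TensorProduct.tmul_add, hx, hy]
    | tmul y₂ y => simp [counitTo_apply, smul_smul]
  rw [gammaElem, h1, elemA, map_mul, h2, onRight_counitFst_phi, map_one, one_mul, onRight_comp,
    AlgHom.comp_apply, onRight_counitFst_splitFst _ counitSnd_comul,
    map_PhiInv_eq_one _ onRight_counitFst_phi, Algebra.TensorProduct.one_def]
  simp

/-- Now legs one and four of A are killed, so the normalizations in the first and third factors of Φ
and Φ⁻¹ are the relevant ones. -/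
theorem counitSnd_gammaElem : counitSnd k H H (gammaElem k H) = alpha k := by
  have h1 : ∀ y, counitSnd k H H (gammaMap k H y) =
      evalAlpha k H (onRight H (counitSnd k H H) (counitFst k H _ y)) := by
    intro y
    induction y using TensorProduct.induction_on with
    | zero => simp
    | add x y hx hy => simp only [map_add, hx, hy]
    | tmul y₁ y =>
    induction y using TensorProduct.induction_on with
    | zero => simp
    | add x y hx hy => simp only [map_add, TensorProduct.tmul_add, hx, hy]
    | tmul y₂ y =>
    induction y using TensorProduct.induction_on with
    | zero => simp
    | add x y hx hy => simp only [map_add, TensorProduct.tmul_add, hx, hy]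
    | tmul y₃ y₄ =>
      simp only [gammaMap_tmul, counitFst_tmul, counitSnd_tmul, map_mul, counit_S, counit_alpha]
      simp [smul_smul, mul_comm]
  have h2 : ∀ y, onRight H (counitSnd k H H) (counitFst k H _
      (onRight H (onRight H (tmulOne H H)) y)) = counitFst k H _ y := by
    intro y
    induction y using TensorProduct.induction_on with
    | zero => simp
    | add x y hx hy => simp only [map_add, hx, hy]
    | tmul y₁ y =>
    induction y using TensorProduct.induction_on with
    | zero => simp
    | add x y hx hy => simp only [map_add, TensorProduct.tmul_add, hx, hy]
    | tmul y₂ y => simp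
  rw [gammaElem, h1, elemA, map_mul, map_mul, h2, counitFst_phi, one_mul,
    counitFst_splitFst_comul,
    map_PhiInv_eq_one _ onRight_counitSnd_phi, Algebra.TensorProduct.one_def]
  simp

/-- Two maps are needed because of the flip in Δᶜᵒᵖ: the counit on one leg after the flip is the
counit on the other leg before it. -/
theorem map_antipodeCop (e e' : H ⊗[k] H →ₐ[k] H)
    (he : ∀ a b, e (S k H b ⊗ₜ S k H a) = S k H (e' (a ⊗ₜ b)))
    (he' : ∀ h, e' (Delta k H h) = h) (h : H) : e (antipodeCop k H h) = S k H h := by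
  have h1 : ∀ d : H ⊗[k] H, e (TensorProduct.map (S k H) (S k H)
      (TensorProduct.comm k H H d)) = S k H (e' d) := by
    intro d
    induction d using TensorProduct.induction_on with
    | zero => simp
    | add x y hx hy => simp only [map_add, hx, hy]
    | tmul a b => exact he a b
  conv_rhs => rw [← he' h, ← h1]
  rfl

/-- Under e the defining expression of f becomes S(x¹) α x² β S(x³), which is 1. -/
theorem map_drinfeldTwist (e : H ⊗[k] H →ₐ[k] H) (hS : ∀ h, e (antipodeCop k H h) = S k H h)
    (hg : e (gammaElem k H) = alpha k) (hΔ : ∀ h, e (Delta k H h) = h) :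
    e (drinfeldTwist k H) = 1 := by
  have h1 : ∀ y, e (twistMap (antipodeCop k H) (Delta k H) (gammaElem k H) y) =
      prodMap (mulAlpha k H ∘ₗ S k H) (evalBeta k H) y := by
    intro y
    induction y using TensorProduct.induction_on with
    | zero => simp
    | add x y hx hy => simp only [map_add, hx, hy]
    | tmul y₁ y => simp [-LinearEquiv.coe_coe, hS, hg, hΔ]
  rw [drinfeldTwist_eq, h1]
  exact antipode_PhiInv

theorem counitFst_drinfeldTwist : counitFst k H H (drinfeldTwist k H) = 1 := by
  refine map_drinfeldTwist _ (map_antipodeCop _ (counitSnd k H H) ?_ counitSnd_comul)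
    counitFst_gammaElem counitFst_comul
  intro a b
  rw [counitFst_tmul, counitSnd_tmul, counit_S, map_smul]

theorem counitSnd_drinfeldTwist : counitSnd k H H (drinfeldTwist k H) = 1 := by
  refine map_drinfeldTwist _ (map_antipodeCop _ (counitFst k H H) ?_ counitFst_comul)
    counitSnd_gammaElem counitSnd_comul
  intro a b
  rw [counitFst_tmul, counitSnd_tmul, counit_S, map_smul]

end Counit

/-! ### The elements p̃ and q̃ of a right comodule algebra and their inversion identities. -/

section Comodule

variable {k H 𝔸 : Type*} [Field k] [Ring H] [Algebra k H] [QuasiHopfAlgebra k H]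
  [Ring 𝔸] [Algebra k 𝔸]

open QuasiBialgebra QuasiHopfAlgebra RightComoduleAlgebra LeftComoduleAlgebra BicomoduleAlgebra

variable (k H 𝔸) in
/-- The linear map `a ⊗ b ⊗ c ↦ a ⊗ S⁻¹(α c) b`. -/
def qMap : 𝔸 ⊗[k] (H ⊗[k] H) →ₗ[k] 𝔸 ⊗[k] H :=
  (SInv k H ∘ₗ evalAlpha k H).lTensor 𝔸

@[simp] theorem qMap_tmul (a : 𝔸) (t : H ⊗[k] H) :
    qMap k H 𝔸 (a ⊗ₜ t) = a ⊗ₜ SInv k H (evalAlpha k H t) := by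
  simp [qMap]

theorem SInv_evalAlpha_tmul (a b : H) :
    SInv k H (evalAlpha k H (a ⊗ₜ b)) = SInv k H (alpha k * b) * a := by
  rw [evalAlpha_tmul, mul_assoc, SInv_mul, SInv_S]

theorem SInv_evalAlpha_mul_tmul (d : H ⊗[k] H) (a b : H) :
    SInv k H (evalAlpha k H (d * a ⊗ₜ b)) = SInv k H b * SInv k H (evalAlpha k H d) * a := by
  rw [evalAlpha_mul_tmul, SInv_mul, SInv_mul, SInv_S, mul_assoc]

theorem qMap_onRight_comul_mul (t : 𝔸 ⊗[k] H) (y : 𝔸 ⊗[k] (H ⊗[k] H)) :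
    qMap k H 𝔸 (onRight 𝔸 (Delta k H) t * y) =
      qMap k H 𝔸 (onRight 𝔸 (counitTo k H (H ⊗[k] H)) t * y) := by
  induction t using TensorProduct.induction_on with
  | zero => simp
  | add x y hx hy => simp only [map_add, add_mul, hx, hy]
  | tmul a b =>
  induction y using TensorProduct.induction_on with
  | zero => simp
  | add x y hx hy => simp only [map_add, mul_add, hx, hy]
  | tmul c s => simp [evalAlpha_comul_mul, counitTo_apply]

theorem qMap_tmul_one_mul (a : 𝔸) (y : 𝔸 ⊗[k] (H ⊗[k] H)) :
    qMap k H 𝔸 (a ⊗ₜ 1 * y) = a ⊗ₜ 1 * qMap k H 𝔸 y := by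
  induction y using TensorProduct.induction_on with
  | zero => simp
  | add x y hx hy => simp only [map_add, mul_add, hx, hy]
  | tmul c s => simp

section Right

variable [RightComoduleAlgebra k H 𝔸]

/-- Since S⁻¹(αX³) X² = S⁻¹(S(X²) α X³), q̃ is S⁻¹ of an α-evaluation, and coproducts are absorbed
as before. -/
theorem qRho_eq : qRho k H 𝔸 = qMap k H 𝔸 (phiRho k H 𝔸) := by
  rw [qRho]
  refine tensor_ext (fun a t => ?_) _
  rw [qMap_tmul, TensorProduct.map_tmul]
  congr 1
  change (prodMap (SInv k H ∘ₗ alphaMul k H) LinearMap.id ∘ₗ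
    (TensorProduct.comm k H H).toLinearMap) t = (SInv k H ∘ₗ evalAlpha k H) t
  refine tensor_ext (fun a b => ?_) t
  simp only [LinearMap.comp_apply]
  rw [SInv_evalAlpha_tmul]
  simp

theorem phiRho_mul_splitFst_rho (a : 𝔸) :
    phiRho k H 𝔸 * splitFst H (rho (k := k) (H := H)) (rho a) =
      onRight 𝔸 (Delta k H) (rho a) * phiRho k H 𝔸 := rho_coassoc a

theorem phiRho_mul_phiRhoInv : phiRho k H 𝔸 * phiRhoInv k H 𝔸 = 1 := Units.mul_inv _

theorem phiRhoInv_mul_phiRho : phiRhoInv k H 𝔸 * phiRho k H 𝔸 = 1 := Units.inv_mul _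

theorem map_phiRhoInv_eq_one {E : Type*} [Ring E] [Algebra k E]
    (f : 𝔸 ⊗[k] (H ⊗[k] H) →ₐ[k] E)
    (hf : f (phiRho k H 𝔸) = 1) : f (phiRhoInv k H 𝔸) = 1 := by
  have h : f (phiRho k H 𝔸 * phiRhoInv k H 𝔸) = 1 := by rw [phiRho_mul_phiRhoInv, map_one]
  rwa [map_mul, hf, one_mul] at h

theorem onRight_counitFst_phiRho : onRight 𝔸 (counitFst k H H) (phiRho k H 𝔸) = 1 := by
  rw [counitFst, onRight_comp, AlgHom.comp_apply,
    show onRight 𝔸 (onLeft _ counit) (phiRho k H 𝔸) = _ from counit_PhiRho_snd, map_one]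

theorem onRight_counitSnd_phiRho : onRight 𝔸 (counitSnd k H H) (phiRho k H 𝔸) = 1 := by
  rw [counitSnd, onRight_comp, AlgHom.comp_apply,
    show onRight 𝔸 (onRight _ counit) (phiRho k H 𝔸) = _ from counit_PhiRho_trd, map_one]

theorem onRight_splitFst_counitTo_phiRho (Y Z) [Ring Y] [Algebra k Y] [Ring Z] [Algebra k Z] :
    onRight 𝔸 (splitFst H (counitTo k H (Y ⊗[k] Z))) (phiRho k H 𝔸) = 1 := by
  rw [splitFst_counitTo, onRight_comp, AlgHom.comp_apply,
    show onRight 𝔸 (onLeft H counit) (phiRho k H 𝔸) = 1 from counit_PhiRho_snd, map_one]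

theorem onRight_onRight_counitTo_phiRho (E) [Ring E] [Algebra k E] :
    onRight 𝔸 (onRight H (counitTo k H E)) (phiRho k H 𝔸) = 1 := by
  rw [onRight_counitTo, onRight_comp, AlgHom.comp_apply,
    show onRight 𝔸 (onRight H counit) (phiRho k H 𝔸) = 1 from counit_PhiRho_trd, map_one]

@[simp] theorem counitSnd_rho (a : 𝔸) : counitSnd k H 𝔸 (rho a) = a := by
  rw [counitSnd, AlgHom.comp_apply, rho_counit]
  simp

theorem onRight_counitTo_rho (E) [Ring E] [Algebra k E] (a : 𝔸) :
    onRight 𝔸 (counitTo k H E) (rho a) = a ⊗ₜ 1 := by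
  rw [onRight_counitTo, AlgHom.comp_apply, rho_counit]
  simp

theorem phiRho_pentagon :
    oneTmul 𝔸 (H ⊗[k] (H ⊗[k] H)) (phi k H) *
      onRight 𝔸 (splitFst H (Delta k H)) (phiRho k H 𝔸) *
      onRight 𝔸 (onRight H (tmulOne H H)) (phiRho k H 𝔸) =
    onRight 𝔸 (onRight H (Delta k H)) (phiRho k H 𝔸) *
      splitFst (H ⊗[k] H) (rho (k := k) (H := H)) (phiRho k H 𝔸) := rho_pentagon

/-- `[1 ⊗ S⁻¹(a_{<1>})] q̃ ρ(a_{<0>}) = [a ⊗ 1] q̃`. -/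
theorem qMap_phiRho_mul_splitFst_rho (a : 𝔸) :
    qMap k H 𝔸 (phiRho k H 𝔸 * splitFst H (rho (k := k) (H := H)) (rho a)) =
      a ⊗ₜ 1 * qRho k H 𝔸 := by
  rw [phiRho_mul_splitFst_rho, qMap_onRight_comul_mul, onRight_counitTo_rho, qMap_tmul_one_mul,
    qRho_eq]

/-- Right multiplication on leg two comes out on the right of S⁻¹(αc) b, whereas on leg three it
passes through S⁻¹ and comes out on the left. -/
theorem qMap_mul_splitFst_tmul (f : 𝔸 →ₐ[k] 𝔸 ⊗[k] H) (y : 𝔸 ⊗[k] (H ⊗[k] H)) (a : 𝔸) (h : H) :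
    qMap k H 𝔸 (y * splitFst H f (a ⊗ₜ h)) = 1 ⊗ₜ SInv k H h * qMap k H 𝔸 y * f a := by
  rw [splitFst_tmul]
  generalize f a = r
  induction r using TensorProduct.induction_on with
  | zero => simp
  | add x y hx hy => simp only [map_add, mul_add, TensorProduct.add_tmul, hx, hy]
  | tmul b c =>
  induction y using TensorProduct.induction_on with
  | zero => simp
  | add x y hx hy => simp only [map_add, mul_add, add_mul, hx, hy]
  | tmul d s =>
    rw [TensorProduct.assoc_tmul, Algebra.TensorProduct.tmul_mul_tmul, qMap_tmul,
      SInv_evalAlpha_mul_tmul]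
    simp

theorem pRho_eq : pRho k H 𝔸 = (evalBeta k H).lTensor 𝔸 (phiRhoInv k H 𝔸) := rfl

/-- `[1 ⊗ S⁻¹(p̃²)] q̃ ρ(p̃¹) = 1 ⊗ 1`. -/
theorem qMap_phiRho_mul_splitFst_pRho :
    qMap k H 𝔸 (phiRho k H 𝔸 * splitFst H (rho (k := k) (H := H)) (pRho k H 𝔸)) = 1 := by
  -- The expression is S⁻¹ of a ⊗ b ⊗ c ↦ S(a) α b β S(c), the instance σ = S, δ = id, T = α of the
  -- general twist.
  set N : H ⊗[k] (H ⊗[k] H) →ₗ[k] H := twistMap (S k H) (AlgHom.id k H) (alpha k) with hN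
  have hS : ∀ h, sandwich (S k H) (AlgHom.id k H) (alpha k) (Delta k H h) =
    (counit h : k) • alpha k := antipode_alpha
  have h1 : ∀ u y, qMap k H 𝔸 (u * splitFst H (rho (k := k) (H := H))
      ((evalBeta k H).lTensor 𝔸 y)) = (SInv k H).lTensor 𝔸 (N.lTensor 𝔸
        (onRight 𝔸 (onRight H (tmulOne H H)) u *
          splitFst (H ⊗[k] H) (rho (k := k) (H := H)) y)) := by
    intro u y
    induction y using TensorProduct.induction_on with
    | zero => simp
    | add x y hx hy => simp only [map_add, mul_add, hx, hy]
    | tmul a s =>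
    rw [LinearMap.lTensor_tmul, splitFst_tmul, splitFst_tmul]
    generalize rho (k := k) (H := H) a = r
    induction r using TensorProduct.induction_on with
    | zero => simp
    | add x y hx hy => simp only [map_add, mul_add, TensorProduct.add_tmul, hx, hy]
    | tmul b c =>
    induction s using TensorProduct.induction_on with
    | zero => simp
    | add x y hx hy => simp only [map_add, mul_add, TensorProduct.tmul_add, hx, hy]
    | tmul s₁ s₂ =>
    induction u using TensorProduct.induction_on with
    | zero => simp
    | add x y hx hy => simp only [map_add, add_mul, hx, hy]
    | tmul u₁ u =>
    induction u using TensorProduct.induction_on with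
    | zero => simp
    | add x y hx hy => simp only [map_add, add_mul, TensorProduct.tmul_add, hx, hy]
    | tmul u₂ u₃ =>
      simp [-LinearEquiv.coe_coe, hN, mul_assoc]
  -- In this form of the Φ_ρ pentagon the right side has two factors containing Δ, absorbed by α and
  -- β, with 1 ⊗ Φ⁻¹ between them. The latter contributes S(x¹) α x² β S(x³) = 1.
  have h2 : onRight 𝔸 (onRight H (tmulOne H H)) (phiRho k H 𝔸) *
      splitFst (H ⊗[k] H) (rho (k := k) (H := H)) (phiRhoInv k H 𝔸) =
      onRight 𝔸 (splitFst H (Delta k H)) (phiRhoInv k H 𝔸) *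
        (oneTmul 𝔸 _ (PhiInv k H) * onRight 𝔸 (onRight H (Delta k H)) (phiRho k H 𝔸)) := by
    have h := congrArg (fun z => onRight 𝔸 (splitFst H (Delta k H)) (phiRhoInv k H 𝔸) *
      oneTmul 𝔸 _ (PhiInv k H) * z *
        splitFst (H ⊗[k] H) (rho (k := k) (H := H)) (phiRhoInv k H 𝔸))
      (phiRho_pentagon (k := k) (H := H) (𝔸 := 𝔸))
    simp only [mul_assoc] at h ⊢
    rw [← map_mul (splitFst (H ⊗[k] H) (rho (k := k) (H := H))), phiRho_mul_phiRhoInv, map_one,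
      mul_one] at h
    rw [← h, ← mul_assoc (oneTmul 𝔸 _ (PhiInv k H)), ← map_mul (oneTmul 𝔸 _), PhiInv_mul_phi,
      map_one, one_mul, ← mul_assoc, ← map_mul (onRight 𝔸 (splitFst H (Delta k H))),
      phiRhoInv_mul_phiRho, map_one, one_mul]
  have h3 : ∀ t y, N.lTensor 𝔸 (onRight 𝔸 (splitFst H (Delta k H)) t * y) =
      N.lTensor 𝔸 (onRight 𝔸 (splitFst H (counitTo k H (H ⊗[k] H))) t * y) := by
    intro t y
    induction t using TensorProduct.induction_on with
    | zero => simp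
    | add x y hx hy => simp only [map_add, add_mul, hx, hy]
    | tmul a b =>
    induction y using TensorProduct.induction_on with
    | zero => simp
    | add x y hx hy => simp only [map_add, mul_add, hx, hy]
    | tmul c s =>
      simp only [onRight_tmul, Algebra.TensorProduct.tmul_mul_tmul, LinearMap.lTensor_tmul, hN,
        twistMap_splitFst_comul_mul S_mul hS]
  have h4 : ∀ t y, N.lTensor 𝔸 (y * onRight 𝔸 (onRight H (Delta k H)) t) =
      N.lTensor 𝔸 (y * onRight 𝔸 (onRight H (counitTo k H (H ⊗[k] H))) t) := by
    intro t y
    induction t using TensorProduct.induction_on with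
    | zero => simp
    | add x y hx hy => simp only [map_add, mul_add, hx, hy]
    | tmul a b =>
    induction y using TensorProduct.induction_on with
    | zero => simp
    | add x y hx hy => simp only [map_add, add_mul, hx, hy]
    | tmul c s =>
      simp only [onRight_tmul, Algebra.TensorProduct.tmul_mul_tmul, LinearMap.lTensor_tmul, hN,
        twistMap_mul_onRight_comul]
  have h5 : N (PhiInv k H) = 1 := by
    rw [← antipode_PhiInv (k := k) (H := H)]
    exact tensor_ext (fun a b => by simp [-LinearEquiv.coe_coe, hN, evalBeta]) _
  rw [pRho_eq, h1, h2, h3, map_phiRhoInv_eq_one _ (onRight_splitFst_counitTo_phiRho _ _),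
    one_mul, h4, onRight_onRight_counitTo_phiRho, mul_one, oneTmul_apply, LinearMap.lTensor_tmul,
    h5, LinearMap.lTensor_tmul, SInv_one, Algebra.TensorProduct.one_def]

/-- `ρ(q̃¹) p̃ [1 ⊗ S(q̃²)] = 1 ⊗ 1`. -/
theorem rho_qRho_mul_pRho :
    prodMap (LinearMap.mulRight k (pRho k H 𝔸) ∘ₗ (rho (k := k) (H := H)).toLinearMap)
      ((oneTmul 𝔸 H).toLinearMap ∘ₗ S k H) (qRho k H 𝔸) = 1 := by
  have h1 : ∀ u y, prodMap (LinearMap.mulRight k ((evalBeta k H).lTensor 𝔸 y) ∘ₗ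
      (rho (k := k) (H := H)).toLinearMap)
      ((oneTmul 𝔸 H).toLinearMap ∘ₗ S k H) (qMap k H 𝔸 u) =
      (evalBetaAlpha k H).lTensor 𝔸 (splitFst (H ⊗[k] H) (rho (k := k) (H := H)) u *
        onRight 𝔸 (onRight H (tmulOne H H)) y) := by
    intro u y
    induction u using TensorProduct.induction_on with
    | zero => simp
    | add x y hx hy => simp only [map_add, add_mul, hx, hy]
    | tmul u₁ u =>
    rw [qMap_tmul, prodMap_tmul, splitFst_tmul]
    simp only [LinearMap.comp_apply, LinearMap.mulRight_apply, AlgHom.toLinearMap_apply]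
    rw [S_SInv]
    generalize rho (k := k) (H := H) u₁ = r
    induction r using TensorProduct.induction_on with
    | zero => simp
    | add x y hx hy => simp only [map_add, add_mul, TensorProduct.add_tmul, hx, hy]
    | tmul b c =>
    induction u using TensorProduct.induction_on with
    | zero => simp
    | add x y hx hy => simp only [map_add, mul_add, add_mul, TensorProduct.tmul_add, hx, hy]
    | tmul u₂ u₃ =>
    induction y using TensorProduct.induction_on with
    | zero => simp
    | add x y hx hy => simp only [map_add, mul_add, add_mul, hx, hy]
    | tmul y₁ y =>
    induction y using TensorProduct.induction_on with
    | zero => simp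
    | add x y hx hy => simp only [map_add, mul_add, add_mul, TensorProduct.tmul_add, hx, hy]
    | tmul y₂ y₃ =>
      simp [-LinearEquiv.coe_coe, S_mul, mul_assoc]
  -- The same pentagon solved the other way. The order is now β before α, so the surviving factor 1
  -- ⊗ Φ contributes X¹ β S(X²) α X³ = 1.
  have h2 : splitFst (H ⊗[k] H) (rho (k := k) (H := H)) (phiRho k H 𝔸) *
      onRight 𝔸 (onRight H (tmulOne H H)) (phiRhoInv k H 𝔸) =
      onRight 𝔸 (onRight H (Delta k H)) (phiRhoInv k H 𝔸) *
        (oneTmul 𝔸 _ (phi k H) * onRight 𝔸 (splitFst H (Delta k H)) (phiRho k H 𝔸)) := by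
    have h := congrArg (fun z => onRight 𝔸 (onRight H (Delta k H)) (phiRhoInv k H 𝔸) * z *
        onRight 𝔸 (onRight H (tmulOne H H)) (phiRhoInv k H 𝔸))
      (phiRho_pentagon (k := k) (H := H) (𝔸 := 𝔸))
    simp only [mul_assoc] at h ⊢
    rw [← map_mul (onRight 𝔸 (onRight H (tmulOne H H))), phiRho_mul_phiRhoInv, map_one,
      mul_one] at h
    rw [h, ← mul_assoc, ← map_mul (onRight 𝔸 (onRight H (Delta k H))),
      phiRhoInv_mul_phiRho, map_one, one_mul]
  rw [pRho_eq, qRho_eq, h1, h2, lTensor_evalBetaAlpha_onRight_comul_mul,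
    map_phiRhoInv_eq_one _ (onRight_onRight_counitTo_phiRho _), one_mul,
    lTensor_evalBetaAlpha_mul_splitFst_comul, onRight_splitFst_counitTo_phiRho, mul_one,
    oneTmul_apply, LinearMap.lTensor_tmul, evalBetaAlpha_Phi, Algebra.TensorProduct.one_def]

end Right

end Comodule

/-! ### The twist f after flipping and applying S⁻¹ to both legs. -/

section SwapInv

variable (k H : Type*) [Field k] [Ring H] [Algebra k H] [QuasiHopfAlgebra k H]

open QuasiBialgebra QuasiHopfAlgebra

/-- The linear map `a ⊗ b ↦ S⁻¹(b) ⊗ S⁻¹(a)`. -/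
def swapInv : H ⊗[k] H →ₗ[k] H ⊗[k] H :=
  TensorProduct.map (SInv k H) (SInv k H) ∘ₗ (TensorProduct.comm k H H).toLinearMap

variable {k H}

@[simp] theorem swapInv_tmul (a b : H) :
    swapInv k H (a ⊗ₜ b) = SInv k H b ⊗ₜ SInv k H a := rfl

theorem swapInv_mul (x y : H ⊗[k] H) :
    swapInv k H (x * y) = swapInv k H y * swapInv k H x := by
  induction x using TensorProduct.induction_on with
  | zero => simp
  | add x y hx hy => simp only [map_add, add_mul, mul_add, hx, hy]
  | tmul a b =>
  induction y using TensorProduct.induction_on with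
  | zero => simp
  | add x y hx hy => simp only [map_add, add_mul, mul_add, hx, hy]
  | tmul c d =>
    simp only [Algebra.TensorProduct.tmul_mul_tmul, swapInv_tmul, SInv_mul]

theorem swapInv_antipodeCop (h : H) : swapInv k H (antipodeCop k H h) = Delta k H h := by
  have h1 : ∀ d : H ⊗[k] H, swapInv k H (TensorProduct.map (S k H) (S k H)
      (TensorProduct.comm k H H d)) = d := by
    intro d
    induction d using TensorProduct.induction_on with
    | zero => simp
    | add x y hx hy => simp only [map_add, hx, hy]
    | tmul a b =>
      rw [TensorProduct.comm_tmul, TensorProduct.map_tmul, swapInv_tmul, SInv_S, SInv_S]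
  exact h1 _

/-- `[S⁻¹(f²) ⊗ S⁻¹(f¹)] Δ(S⁻¹(h)) = S⁻¹(f² h₂) ⊗ S⁻¹(f¹ h₁)`. -/
theorem swapInv_drinfeldTwist_mul_comul_SInv (h : H) :
    swapInv k H (drinfeldTwist k H) * Delta k H (SInv k H h) =
      swapInv k H (drinfeldTwist k H * Delta k H h) := by
  have h1 := drinfeldTwist_mul_comul_S (k := k) (SInv k H h)
  rw [S_SInv] at h1
  rw [h1, swapInv_mul, swapInv_antipodeCop]

/-- This is where f is eliminated. On S(a) α b one has f Δ(S(a) α b) = (S ⊗ S)(Δᶜᵒᵖ(a)) f Δ(α) Δ(b),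
and f Δ(α) = g, so only A and the coproducts of a and b remain. -/
theorem swapInv_drinfeldTwist_mul_comul (t z : H ⊗[k] H) :
    swapInv k H (drinfeldTwist k H * z) * Delta k H (SInv k H (evalAlpha k H t)) =
      swapInv k H (gammaMap k H (elemA k H *
        splitFst (H ⊗[k] H) (Delta k H) (onRight H (Delta k H) t)) * z) := by
  have h1 : drinfeldTwist k H * Delta k H (evalAlpha k H t) =
      sandwich (antipodeCop k H) (Delta k H) (gammaElem k H) t := by
    induction t using TensorProduct.induction_on with
    | zero => simp
    | add x y hx hy => simp only [map_add, mul_add, hx, hy]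
    | tmul a b =>
      rw [evalAlpha_tmul, map_mul, map_mul, ← mul_assoc, ← mul_assoc, drinfeldTwist_mul_comul_S,
        mul_assoc (antipodeCop k H a), drinfeldTwist_mul_comul_alpha, sandwich_tmul]
  rw [swapInv_mul, mul_assoc, swapInv_drinfeldTwist_mul_comul_SInv, h1, gammaElem,
    sandwich_gammaMap, ← swapInv_mul]

end SwapInv

/-! ### The five-leg evaluation through which (id ⊗ Δ)(q̃) is computed. -/

section Coproduct

variable {k H 𝔸 : Type*} [Field k] [Ring H] [Algebra k H] [QuasiHopfAlgebra k H]
  [Ring 𝔸] [Algebra k 𝔸]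

open QuasiBialgebra QuasiHopfAlgebra RightComoduleAlgebra LeftComoduleAlgebra BicomoduleAlgebra

variable (k H 𝔸) in
/-- The linear map `a ⊗ b ⊗ c ⊗ d ⊗ e ↦ a ⊗ S⁻¹(α e) b ⊗ S⁻¹(α d) c`. -/
def qMap₂ : 𝔸 ⊗[k] (H ⊗[k] (H ⊗[k] (H ⊗[k] H))) →ₗ[k] 𝔸 ⊗[k] (H ⊗[k] H) :=
  (swapInv k H ∘ₗ gammaMap k H).lTensor 𝔸

@[simp] theorem qMap₂_tmul (a : 𝔸) (t : H ⊗[k] (H ⊗[k] (H ⊗[k] H))) :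
    qMap₂ k H 𝔸 (a ⊗ₜ t) = a ⊗ₜ swapInv k H (gammaMap k H t) := by
  simp [qMap₂]

/-- After the flip and S⁻¹ the expression reads S⁻¹(αy₄) y₁ ⊗ S⁻¹(αy₃) y₂, so right factors join
legs one and two. -/
theorem swapInv_gammaMap_mul (y : H ⊗[k] (H ⊗[k] (H ⊗[k] H))) (x : H ⊗[k] H) :
    swapInv k H (gammaMap k H y) * x =
      swapInv k H (gammaMap k H (y * onRight H (tmulOne H (H ⊗[k] H)) x)) := by
  induction x using TensorProduct.induction_on with
  | zero => simp
  | add x y hx hy => simp only [map_add, mul_add, hx, hy]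
  | tmul a b =>
  induction y using TensorProduct.induction_on with
  | zero => simp
  | add x y hx hy => simp only [map_add, add_mul, hx, hy]
  | tmul y₁ y =>
  induction y using TensorProduct.induction_on with
  | zero => simp
  | add x y hx hy => simp only [map_add, add_mul, TensorProduct.tmul_add, hx, hy]
  | tmul y₂ y =>
  induction y using TensorProduct.induction_on with
  | zero => simp
  | add x y hx hy => simp only [map_add, add_mul, TensorProduct.tmul_add, hx, hy]
  | tmul y₃ y₄ =>
    simp only [onRight_tmul, tmulOne_apply, Algebra.TensorProduct.tmul_mul_tmul,
      Algebra.TensorProduct.one_def, mul_one, gammaMap_tmul, swapInv_tmul, SInv_mul, SInv_S,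
      S_mul, mul_assoc]

theorem gammaMap_mul (y : H ⊗[k] (H ⊗[k] (H ⊗[k] H))) (z : H ⊗[k] H) :
    gammaMap k H y * z = gammaMap k H (y * 1 ⊗ₜ (1 ⊗ₜ z)) := by
  induction z using TensorProduct.induction_on with
  | zero => simp
  | add x y hx hy => simp only [mul_add, TensorProduct.tmul_add, map_add, hx, hy]
  | tmul a b =>
  induction y using TensorProduct.induction_on with
  | zero => simp
  | add x y hx hy => simp only [map_add, add_mul, hx, hy]
  | tmul y₁ y =>
  induction y using TensorProduct.induction_on with
  | zero => simp
  | add x y hx hy => simp only [map_add, add_mul, TensorProduct.tmul_add, hx, hy]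
  | tmul y₂ y =>
  induction y using TensorProduct.induction_on with
  | zero => simp
  | add x y hx hy => simp only [map_add, add_mul, TensorProduct.tmul_add, hx, hy]
  | tmul y₃ y₄ => simp [-LinearEquiv.coe_coe, gammaMap_tmul, mul_assoc]

theorem qMap₂_mul (y : 𝔸 ⊗[k] (H ⊗[k] (H ⊗[k] (H ⊗[k] H)))) (x : 𝔸 ⊗[k] (H ⊗[k] H)) :
    qMap₂ k H 𝔸 y * x =
      qMap₂ k H 𝔸 (y * onRight 𝔸 (onRight H (tmulOne H (H ⊗[k] H))) x) := by
  induction x using TensorProduct.induction_on with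
  | zero => simp
  | add x y hx hy => simp only [map_add, mul_add, hx, hy]
  | tmul a b =>
  induction y using TensorProduct.induction_on with
  | zero => simp
  | add x y hx hy => simp only [map_add, add_mul, hx, hy]
  | tmul c d =>
    simp only [qMap₂_tmul, onRight_tmul, Algebra.TensorProduct.tmul_mul_tmul,
      swapInv_gammaMap_mul]

theorem oneTmul_mul_onRight_comul_qMap (y : 𝔸 ⊗[k] (H ⊗[k] H)) (z : H ⊗[k] H) :
    oneTmul 𝔸 _ (swapInv k H (drinfeldTwist k H * z)) *
      onRight 𝔸 (Delta k H) (qMap k H 𝔸 y) =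
    qMap₂ k H 𝔸 (oneTmul 𝔸 _ (elemA k H) *
      onRight 𝔸 ((splitFst (H ⊗[k] H) (Delta k H)).comp (onRight H (Delta k H))) y *
      1 ⊗ₜ (1 ⊗ₜ (1 ⊗ₜ z))) := by
  induction y using TensorProduct.induction_on with
  | zero => simp
  | add x y hx hy => simp only [map_add, add_mul, mul_add, hx, hy]
  | tmul a t =>
    rw [qMap_tmul, onRight_tmul, onRight_tmul, oneTmul_apply, oneTmul_apply,
      Algebra.TensorProduct.tmul_mul_tmul, Algebra.TensorProduct.tmul_mul_tmul,
      Algebra.TensorProduct.tmul_mul_tmul, qMap₂_tmul, swapInv_drinfeldTwist_mul_comul,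
      gammaMap_mul, mul_one, one_mul, AlgHom.comp_apply]

theorem onRight_comp_apply {X Y Z W : Type*} [Ring X] [Algebra k X] [Ring Y] [Algebra k Y] [Ring Z]
    [Algebra k Z] [Ring W] [Algebra k W] (f : Y →ₐ[k] Z) (g : X →ₐ[k] Y) (t : W ⊗[k] X) :
    onRight W f (onRight W g t) = onRight W (f.comp g) t := by
  rw [onRight_comp, AlgHom.comp_apply]

theorem oneTmul_mul_onRight {W X Y : Type*} [Ring X] [Algebra k X] [Ring Y] [Algebra k Y]
    [Ring W] [Algebra k W] (f g : X →ₐ[k] Y) (p : Y) (h : ∀ x, p * f x = g x * p)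
    (t : W ⊗[k] X) : oneTmul W Y p * onRight W f t = onRight W g t * oneTmul W Y p := by
  induction t using TensorProduct.induction_on with
  | zero => simp
  | add x y hx hy => simp only [map_add, add_mul, mul_add, hx, hy]
  | tmul a t => simp [h]

theorem splitFst_onRight_tmulOne {X Y : Type*} [Ring X] [Algebra k X] [Ring Y] [Algebra k Y]
    (t : H ⊗[k] X) :
    splitFst (X ⊗[k] Y) (Delta k H) (onRight H (tmulOne X Y) t) =
      onRight H (onRight H (tmulOne X Y)) (splitFst X (Delta k H) t) := by
  induction t using TensorProduct.induction_on with
  | zero => simp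
  | add x y hx hy => simp only [map_add, hx, hy]
  | tmul a b =>
    simp only [onRight_tmul, splitFst_tmul, tmulOne_apply]
    generalize Delta k H a = r
    induction r using TensorProduct.induction_on with
    | zero => simp
    | add x y hx hy => simp only [map_add, TensorProduct.add_tmul, hx, hy]
    | tmul c d => simp

theorem qMap₂_onRight_onRight_splitFst_comul_mul (t : 𝔸 ⊗[k] (H ⊗[k] (H ⊗[k] H)))
    (y : 𝔸 ⊗[k] (H ⊗[k] (H ⊗[k] (H ⊗[k] H)))) :
    qMap₂ k H 𝔸 (onRight 𝔸 (onRight H (splitFst H (Delta k H))) t * y) =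
      qMap₂ k H 𝔸 (onRight 𝔸 (onRight H (splitFst H (counitTo k H (H ⊗[k] H)))) t * y) := by
  induction t using TensorProduct.induction_on with
  | zero => simp
  | add x y hx hy => simp only [map_add, add_mul, hx, hy]
  | tmul a b =>
  induction y using TensorProduct.induction_on with
  | zero => simp
  | add x y hx hy => simp only [map_add, mul_add, hx, hy]
  | tmul c d =>
    simp only [onRight_tmul, Algebra.TensorProduct.tmul_mul_tmul, qMap₂_tmul,
      gammaMap_onRight_splitFst_comul_mul]

/-- Once the middle legs of the left factor are trivial, the two α-evaluations separate. This is
what produces two copies of q̃ from one nested expression. -/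
theorem swapInv_gammaMap_tmul_mul (b e : H) (s : H ⊗[k] (H ⊗[k] H)) :
    swapInv k H (gammaMap k H (b ⊗ₜ (1 ⊗ₜ (1 ⊗ₜ e)) * onRight H (onRight H (tmulOne H H)) s)) =
      SInv k H (evalAlpha k H (b ⊗ₜ e)) ⊗ₜ 1 * qMap k H H s := by
  induction s using TensorProduct.induction_on with
  | zero => simp
  | add x y hx hy => simp only [map_add, mul_add, hx, hy]
  | tmul s₁ s =>
  induction s using TensorProduct.induction_on with
  | zero => simp
  | add x y hx hy => simp only [map_add, mul_add, TensorProduct.tmul_add, hx, hy]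
  | tmul s₂ s₃ =>
    simp only [onRight_tmul, tmulOne_apply, Algebra.TensorProduct.tmul_mul_tmul, gammaMap_tmul,
      swapInv_tmul, qMap_tmul, evalAlpha_tmul, one_mul, mul_one, SInv_mul, S_mul, SInv_S,
      mul_assoc]

end Coproduct

/-! ### The coproduct formula for q̃. -/

section QCoproduct

variable {k H 𝔸 : Type*} [Field k] [Ring H] [Algebra k H] [QuasiHopfAlgebra k H]
  [Ring 𝔸] [Algebra k 𝔸]

open QuasiBialgebra QuasiHopfAlgebra RightComoduleAlgebra LeftComoduleAlgebra BicomoduleAlgebra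

theorem qMap₂_onRight_oneTmul_mul (t : 𝔸 ⊗[k] (H ⊗[k] H))
    (y : 𝔸 ⊗[k] (H ⊗[k] (H ⊗[k] H))) :
    qMap₂ k H 𝔸 (onRight 𝔸 (onRight H ((oneTmul H (H ⊗[k] H)).comp (oneTmul H H))) t *
        onRight 𝔸 (onRight H (onRight H (tmulOne H H))) y) =
      onRight 𝔸 (tmulOne H H) (qMap k H 𝔸 t) * (qMap k H H).lTensor 𝔸 y := by
  induction t using TensorProduct.induction_on with
  | zero => simp
  | add x y hx hy => simp only [map_add, add_mul, hx, hy]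
  | tmul a t =>
  induction t using TensorProduct.induction_on with
  | zero => simp
  | add x y hx hy => simp only [map_add, add_mul, TensorProduct.tmul_add, hx, hy]
  | tmul b e =>
  induction y using TensorProduct.induction_on with
  | zero => simp
  | add x y hx hy => simp only [map_add, mul_add, hx, hy]
  | tmul c s =>
    simp only [onRight_tmul, AlgHom.comp_apply, oneTmul_apply,
      Algebra.TensorProduct.tmul_mul_tmul, qMap₂_tmul,
      swapInv_gammaMap_tmul_mul, qMap_tmul, LinearMap.lTensor_tmul, tmulOne_apply]

theorem lTensor_qMap_onRight_comul_mul (t : 𝔸 ⊗[k] (H ⊗[k] H))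
    (y : 𝔸 ⊗[k] (H ⊗[k] (H ⊗[k] H))) :
    (qMap k H H).lTensor 𝔸 (onRight 𝔸 (onRight H (Delta k H)) t * y) =
      (qMap k H H).lTensor 𝔸 (onRight 𝔸 (onRight H (counitTo k H (H ⊗[k] H))) t * y) := by
  induction t using TensorProduct.induction_on with
  | zero => simp
  | add x y hx hy => simp only [map_add, add_mul, hx, hy]
  | tmul a b =>
  induction y using TensorProduct.induction_on with
  | zero => simp
  | add x y hx hy => simp only [map_add, mul_add, hx, hy]
  | tmul c d =>
    simp only [onRight_tmul, Algebra.TensorProduct.tmul_mul_tmul, LinearMap.lTensor_tmul,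
      qMap_onRight_comul_mul]

theorem splitFst_lTensor {X Y Z V W : Type*} [Ring X] [Algebra k X] [Ring Y] [Algebra k Y]
    [Ring Z] [Algebra k Z] [Ring V] [Algebra k V] [Ring W] [Algebra k W]
    (f : X →ₐ[k] Y ⊗[k] Z) (g : V →ₗ[k] W) (t : X ⊗[k] V) :
    splitFst W f (g.lTensor X t) = (g.lTensor Z).lTensor Y (splitFst V f t) := by
  induction t using TensorProduct.induction_on with
  | zero => simp
  | add x y hx hy => simp only [map_add, hx, hy]
  | tmul a b =>
    simp only [LinearMap.lTensor_tmul, splitFst_tmul]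
    generalize f a = r
    induction r using TensorProduct.induction_on with
    | zero => simp
    | add x y hx hy => simp only [map_add, TensorProduct.add_tmul, hx, hy]
    | tmul c d => simp

theorem splitFst_qMap {X Y Z : Type*} [Ring X] [Algebra k X] [Ring Y] [Algebra k Y]
    [Ring Z] [Algebra k Z] (f : X →ₐ[k] Y ⊗[k] Z) (t : X ⊗[k] (H ⊗[k] H)) :
    splitFst H f (qMap k H X t) = (qMap k H Z).lTensor Y (splitFst (H ⊗[k] H) f t) :=
  splitFst_lTensor ..

variable [RightComoduleAlgebra k H 𝔸]

theorem elemA_mul_splitFst_phi :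
    elemA k H * splitFst (H ⊗[k] H) (Delta k H) (phi k H) =
      onRight H (onRight H (tmulOne H H)) (phi k H) := by
  rw [elemA, mul_assoc, ← map_mul, PhiInv_mul_phi, map_one, mul_one]

/-- The Φ_ρ pentagon is used once on each side. On the left it produces a factor built from Φ that
cancels the Φ⁻¹ inside A and leaves 1 ⊗ Φ ⊗ 1; quasi-coassociativity moves this past the iterated
coproducts to match the right side. -/
theorem oneTmul_elemA_mul :
    oneTmul 𝔸 _ (elemA k H) *
      onRight 𝔸 ((splitFst (H ⊗[k] H) (Delta k H)).comp (onRight H (Delta k H)))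
        (phiRho k H 𝔸) *
      onRight 𝔸 (splitFst (H ⊗[k] H) (Delta k H))
        (splitFst (H ⊗[k] H) (rho (k := k) (H := H)) (phiRho k H 𝔸)) *
      onRight 𝔸 (onRight H (tmulOne H (H ⊗[k] H))) (phiRho k H 𝔸) =
    onRight 𝔸 ((onRight H (splitFst H (Delta k H))).comp (splitFst H (Delta k H)))
        (phiRho k H 𝔸) *
      onRight 𝔸 (onRight H (onRight H (tmulOne H H)))
        (onRight 𝔸 (onRight H (Delta k H)) (phiRho k H 𝔸) *
          splitFst (H ⊗[k] H) (rho (k := k) (H := H)) (phiRho k H 𝔸)) := by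
  have h1 := oneTmul_mul_onRight (W := 𝔸)
    ((splitFst (H ⊗[k] H) (Delta k H)).comp (splitFst H (Delta k H)))
    ((onRight H (splitFst H (Delta k H))).comp (splitFst H (Delta k H)))
    (onRight H (onRight H (tmulOne H H)) (phi k H)) phi_tmul_one_mul_splitFst (phiRho k H 𝔸)
  have h2 : (splitFst (H ⊗[k] H) (Delta k H)).comp (onRight H (tmulOne H H)) =
      (onRight H (onRight H (tmulOne H H))).comp (splitFst H (Delta k H)) :=
    AlgHom.ext fun t => splitFst_onRight_tmulOne t
  have h3 : onRight 𝔸 (onRight H (tmulOne H (H ⊗[k] H))) (phiRho k H 𝔸) =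
      onRight 𝔸 (onRight H (onRight H (tmulOne H H)))
        (onRight 𝔸 (onRight H (tmulOne H H)) (phiRho k H 𝔸)) := by
    rw [onRight_comp_apply, ← onRight_comp]
    congr 3
  rw [← phiRho_pentagon, ← onRight_comp_apply, mul_assoc (oneTmul 𝔸 _ (elemA k H)), ← map_mul,
    ← phiRho_pentagon, map_mul, map_mul, ← mul_assoc, ← mul_assoc, oneTmul_apply, oneTmul_apply,
    onRight_tmul, Algebra.TensorProduct.tmul_mul_tmul, elemA_mul_splitFst_phi, one_mul,
    onRight_comp_apply, ← oneTmul_apply, h1, onRight_comp_apply, h2, map_mul, map_mul, h3]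
  simp only [mul_assoc, oneTmul_apply, onRight_tmul, onRight_comp_apply]

/-- `[1 ⊗ S⁻¹(f² X³) ⊗ S⁻¹(f¹ X²)] (id ⊗ Δ)(q̃) Φ_ρ (ρ ⊗ id)(ρ(X¹)) = (q̃ ⊗ 1)(ρ ⊗ id)(q̃)`, where
`Φ_ρ = X¹ ⊗ X² ⊗ X³`. -/
theorem onRight_comul_qRho :
    prodMap ((oneTmul 𝔸 (H ⊗[k] H)).toLinearMap ∘ₗ swapInv k H ∘ₗ
        LinearMap.mulLeft k (drinfeldTwist k H))
      (LinearMap.mulLeft k (onRight 𝔸 (Delta k H) (qRho k H 𝔸) * phiRho k H 𝔸) ∘ₗ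
        (splitFst H (rho (k := k) (H := H))).toLinearMap ∘ₗ
          (rho (k := k) (H := H) (A := 𝔸)).toLinearMap)
      (TensorProduct.comm k 𝔸 (H ⊗[k] H) (phiRho k H 𝔸)) =
    onRight 𝔸 (tmulOne H H) (qRho k H 𝔸) *
      splitFst H (rho (k := k) (H := H)) (qRho k H 𝔸) := by
  -- Only the outer occurrence of Φ_ρ is freed to z, so that additivity reduces to pure tensors. The
  -- occurrences inside q̃ and next to the coaction stay fixed, since the intertwining property of
  -- Φ_ρ is needed.
  have h1 : ∀ z : 𝔸 ⊗[k] (H ⊗[k] H), prodMap ((oneTmul 𝔸 (H ⊗[k] H)).toLinearMap ∘ₗ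
        swapInv k H ∘ₗ LinearMap.mulLeft k (drinfeldTwist k H))
      (LinearMap.mulLeft k (onRight 𝔸 (Delta k H) (qRho k H 𝔸) * phiRho k H 𝔸) ∘ₗ
        (splitFst H (rho (k := k) (H := H))).toLinearMap ∘ₗ
          (rho (k := k) (H := H) (A := 𝔸)).toLinearMap)
      (TensorProduct.comm k 𝔸 (H ⊗[k] H) z) =
      qMap₂ k H 𝔸 (oneTmul 𝔸 _ (elemA k H) *
        onRight 𝔸 ((splitFst (H ⊗[k] H) (Delta k H)).comp (onRight H (Delta k H)))
          (phiRho k H 𝔸) *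
        onRight 𝔸 (splitFst (H ⊗[k] H) (Delta k H))
          (splitFst (H ⊗[k] H) (rho (k := k) (H := H)) z) *
        onRight 𝔸 (onRight H (tmulOne H (H ⊗[k] H))) (phiRho k H 𝔸)) := by
    intro z
    induction z using TensorProduct.induction_on with
    | zero => simp
    | add x y hx hy => simp only [map_add, mul_add, add_mul, hx, hy]
    | tmul a z =>
      have h2 : ∀ r : 𝔸 ⊗[k] H, (1 : 𝔸) ⊗ₜ[k] ((1 : H) ⊗ₜ[k] ((1 : H) ⊗ₜ[k] z)) *
          onRight 𝔸 (onRight H (tmulOne H (H ⊗[k] H))) (onRight 𝔸 (Delta k H) r) =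
          onRight 𝔸 (splitFst (H ⊗[k] H) (Delta k H))
            (TensorProduct.assoc k 𝔸 H (H ⊗[k] H) (r ⊗ₜ z)) := by
        intro r
        induction r using TensorProduct.induction_on with
        | zero => simp
        | add x y hx hy => simp only [map_add, mul_add, TensorProduct.add_tmul, hx, hy]
        | tmul b h =>
          simp only [onRight_tmul, TensorProduct.assoc_tmul, splitFst_tmul]
          generalize Delta k H h = r
          induction r using TensorProduct.induction_on with
          | zero => simp
          | add x y hx hy =>
            simp only [map_add, mul_add, TensorProduct.add_tmul, TensorProduct.tmul_add, hx, hy]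
          | tmul b h => simp
      rw [TensorProduct.comm_tmul, prodMap_tmul, splitFst_tmul, ← h2]
      simp only [LinearMap.comp_apply, LinearMap.mulLeft_apply, AlgHom.toLinearMap_apply]
      rw [mul_assoc (onRight 𝔸 (Delta k H) (qRho k H 𝔸)), phiRho_mul_splitFst_rho, ← mul_assoc,
        qRho_eq, oneTmul_mul_onRight_comul_qMap, qMap₂_mul,
        map_mul (onRight 𝔸 (onRight H (tmulOne H (H ⊗[k] H))))]
      simp only [mul_assoc]
  -- The inner coproduct is absorbed first, after which the evaluation splits in two. In the second
  -- copy a further factor containing Δ is absorbed and normalizes to 1.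
  rw [h1, oneTmul_elemA_mul, ← onRight_comp_apply, qMap₂_onRight_onRight_splitFst_comul_mul,
    onRight_comp_apply, show (onRight H (splitFst H (counitTo k H (H ⊗[k] H)))).comp
      (splitFst H (Delta k H)) = onRight H ((oneTmul H (H ⊗[k] H)).comp (oneTmul H H)) from
    AlgHom.ext fun d => onRight_splitFst_counitTo_splitFst_comul d,
    qMap₂_onRight_oneTmul_mul, lTensor_qMap_onRight_comul_mul, onRight_onRight_counitTo_phiRho,
    one_mul, qRho_eq, splitFst_qMap]

end QCoproduct

/-! ### Left coactions, and the normalization and absorption of Φ_{λ,ρ}. -/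

section Bicomodule

variable {k H 𝔸 : Type*} [Field k] [Ring H] [Algebra k H] [QuasiHopfAlgebra k H]
  [Ring 𝔸] [Algebra k 𝔸]

open QuasiBialgebra QuasiHopfAlgebra RightComoduleAlgebra LeftComoduleAlgebra BicomoduleAlgebra

section Left

variable [LeftComoduleAlgebra k H 𝔸]

@[simp] theorem counitFst_lam (a : 𝔸) : counitFst k H 𝔸 (lam a) = a := by
  rw [counitFst, AlgHom.comp_apply, lam_counit]
  simp

theorem phiLam_mul_phiLamInv : phiLam k H 𝔸 * phiLamInv k H 𝔸 = 1 := Units.mul_inv _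

theorem phiLam_mul_splitFst_lam (a : 𝔸) :
    phiLam k H 𝔸 * splitFst 𝔸 (Delta k H) (lam a) =
      onRight H (lam (k := k) (H := H)) (lam a) * phiLam k H 𝔸 := (lam_coassoc a).symm

theorem counitFst_phiLam : counitFst k H _ (phiLam k H 𝔸) = 1 := by
  rw [counitFst, AlgHom.comp_apply, show onLeft _ counit (phiLam k H 𝔸) = 1 from
    counit_PhiLam_fst, map_one]

theorem onRight_counitFst_phiLam : onRight H (counitFst k H 𝔸) (phiLam k H 𝔸) = 1 := by
  rw [counitFst, onRight_comp, AlgHom.comp_apply,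
    show onRight H (onLeft 𝔸 counit) (phiLam k H 𝔸) = 1 from counit_PhiLam_snd, map_one]

theorem map_phiLamInv_eq_one {E : Type*} [Ring E] [Algebra k E]
    (f : H ⊗[k] (H ⊗[k] 𝔸) →ₐ[k] E)
    (hf : f (phiLam k H 𝔸) = 1) : f (phiLamInv k H 𝔸) = 1 := by
  have h : f (phiLam k H 𝔸 * phiLamInv k H 𝔸) = 1 := by rw [phiLam_mul_phiLamInv, map_one]
  rwa [map_mul, hf, one_mul] at h

theorem counitFst_splitFst_lam {W : Type*} [Ring W] [Algebra k W] (t : 𝔸 ⊗[k] W) :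
    counitFst k H (𝔸 ⊗[k] W) (splitFst W (lam (k := k) (H := H)) t) = t := by
  induction t using TensorProduct.induction_on with
  | zero => simp
  | add x y hx hy => simp only [map_add, hx, hy]
  | tmul a w =>
    have h : ∀ d : H ⊗[k] 𝔸, counitFst k H (𝔸 ⊗[k] W) (TensorProduct.assoc k H 𝔸 W (d ⊗ₜ w)) =
        counitFst k H 𝔸 d ⊗ₜ w := by
      intro d
      induction d using TensorProduct.induction_on with
      | zero => simp
      | add x y hx hy => simp only [map_add, TensorProduct.add_tmul, hx, hy]
      | tmul b c => simp [TensorProduct.smul_tmul']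
    rw [splitFst_tmul, h, counitFst_lam]

end Left

variable [BicomoduleAlgebra k H 𝔸]

variable (k H 𝔸) in
/-- `Φ_{λ,ρ}`, as an element of `H ⊗ 𝔸 ⊗ H`. -/
def phiLamRho : H ⊗[k] (𝔸 ⊗[k] H) := (PhiLamRho : (H ⊗[k] (𝔸 ⊗[k] H))ˣ)

theorem phiLamRho_mul_theta : phiLamRho k H 𝔸 * theta k H 𝔸 = 1 := Units.mul_inv _

theorem theta_mul_phiLamRho : theta k H 𝔸 * phiLamRho k H 𝔸 = 1 := Units.inv_mul _

theorem map_theta_eq_one {E : Type*} [Ring E] [Algebra k E]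
    (f : H ⊗[k] (𝔸 ⊗[k] H) →ₐ[k] E)
    (hf : f (phiLamRho k H 𝔸) = 1) : f (theta k H 𝔸) = 1 := by
  have h : f (phiLamRho k H 𝔸 * theta k H 𝔸) = 1 := by rw [phiLamRho_mul_theta, map_one]
  rwa [map_mul, hf, one_mul] at h

theorem theta_mul_onRight_rho (a : 𝔸) :
    theta k H 𝔸 * onRight H (rho (k := k) (H := H)) (lam a) =
      splitFst H (lam (k := k) (H := H)) (rho a) * theta k H 𝔸 := by
  have h := congrArg (fun z => theta k H 𝔸 * z * theta k H 𝔸) (lam_rho (k := k) (H := H) a)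
  change theta k H 𝔸 * (phiLamRho k H 𝔸 * _) * theta k H 𝔸 =
    theta k H 𝔸 * (_ * phiLamRho k H 𝔸) * theta k H 𝔸 at h
  rw [← mul_assoc (theta k H 𝔸) (phiLamRho k H 𝔸), theta_mul_phiLamRho, one_mul,
    mul_assoc (theta k H 𝔸), mul_assoc (onRight H _ _), phiLamRho_mul_theta, mul_one] at h
  exact h.symm

theorem phiLamRho_lam_rho_rho :
    oneTmul H (𝔸 ⊗[k] (H ⊗[k] H)) (phiRho k H 𝔸) *
      onRight H (splitFst H (rho (k := k) (H := H))) (phiLamRho k H 𝔸) *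
      onRight H (onRight 𝔸 (tmulOne H H)) (phiLamRho k H 𝔸) =
    onRight H (onRight 𝔸 (Delta k H)) (phiLamRho k H 𝔸) *
      splitFst (H ⊗[k] H) (lam (k := k) (H := H)) (phiRho k H 𝔸) := lam_rho_rho

theorem phiLamRho_lam_lam_rho :
    oneTmul H (H ⊗[k] (𝔸 ⊗[k] H)) (phiLamRho k H 𝔸) *
      onRight H (splitFst H (lam (k := k) (H := H))) (phiLamRho k H 𝔸) *
      onRight H (onRight H (tmulOne 𝔸 H)) (phiLam k H 𝔸) =
    onRight H (onRight H (rho (k := k) (H := H))) (phiLam k H 𝔸) *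
      splitFst (𝔸 ⊗[k] H) (Delta k H) (phiLamRho k H 𝔸) := lam_lam_rho

theorem eq_one_of_mul_phiLamRho {z : H ⊗[k] (𝔸 ⊗[k] H)}
    (hz : z * phiLamRho k H 𝔸 = phiLamRho k H 𝔸) : z = 1 := by
  rw [← mul_one z, ← phiLamRho_mul_theta, ← mul_assoc, hz]

theorem eq_one_of_phiLamRho_mul {z : H ⊗[k] (𝔸 ⊗[k] H)}
    (hz : phiLamRho k H 𝔸 * z = phiLamRho k H 𝔸) : z = 1 := by
  rw [← one_mul z, ← theta_mul_phiLamRho, mul_assoc, hz]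

theorem onRight_counitFst_onRight_onRight {X X' W : Type*} [Ring X] [Algebra k X]
    [Ring X'] [Algebra k X'] [Ring W] [Algebra k W] (f : X →ₐ[k] X') (t : W ⊗[k] (H ⊗[k] X)) :
    onRight W (counitFst k H X') (onRight W (onRight H f) t) =
      onRight W f (onRight W (counitFst k H X) t) := by
  rw [onRight_comp_apply, onRight_comp_apply]
  congr 2
  ext <;> simp

theorem counitFst_onRight {X X' : Type*} [Ring X] [Algebra k X]
    [Ring X'] [Algebra k X'] (f : X →ₐ[k] X') (t : H ⊗[k] X) :
    counitFst k H X' (onRight H f t) = f (counitFst k H X t) := by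
  induction t using TensorProduct.induction_on with
  | zero => simp
  | add x y hx hy => simp only [map_add, hx, hy]
  | tmul a b => simp

/-- This normalization is a consequence of the mixed pentagon: ε on the second leg gives (1 ⊗ (ε ⊗
id ⊗ id)(Φ_{λ,ρ})) Φ_{λ,ρ} = Φ_{λ,ρ}, and Φ_{λ,ρ} is invertible. -/
theorem counitFst_phiLamRho : counitFst k H (𝔸 ⊗[k] H) (phiLamRho k H 𝔸) = 1 := by
  have h := congrArg (onRight H (counitFst k H (𝔸 ⊗[k] H)))
    (phiLamRho_lam_lam_rho (k := k) (H := H) (𝔸 := 𝔸))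
  rw [map_mul, map_mul, map_mul, oneTmul_apply, onRight_tmul, onRight_counitFst_onRight_onRight,
    onRight_counitFst_onRight_onRight, onRight_counitFst_phiLam, map_one, map_one, mul_one, one_mul,
    onRight_counitFst_splitFst _ counitSnd_comul, onRight_comp_apply,
    show (counitFst k H (𝔸 ⊗[k] H)).comp (splitFst H (lam (k := k) (H := H))) =
      AlgHom.id k _ from AlgHom.ext counitFst_splitFst_lam] at h
  have h1 : onRight H (AlgHom.id k (𝔸 ⊗[k] H)) (phiLamRho k H 𝔸) = phiLamRho k H 𝔸 := by
    simp [onRight]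
  rw [h1] at h
  have h2 := congrArg (counitFst k H _) (eq_one_of_mul_phiLamRho h)
  simpa using h2

/-- As for the first leg, but with ε on the third leg of the other mixed pentagon; Φ_{λ,ρ} is then
cancelled on the left. -/
theorem onRight_counitSnd_phiLamRho : onRight H (counitSnd k H 𝔸) (phiLamRho k H 𝔸) = 1 := by
  have h := congrArg (onRight H (onRight 𝔸 (counitFst k H H)))
    (phiLamRho_lam_rho_rho (k := k) (H := H) (𝔸 := 𝔸))
  have h1 : (onRight 𝔸 (counitFst k H H)).comp (splitFst H (rho (k := k) (H := H))) =
      AlgHom.id k (𝔸 ⊗[k] H) :=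
    AlgHom.ext fun t => onRight_counitFst_splitFst _ counitSnd_rho t
  have h2 : (onRight 𝔸 (counitFst k H H)).comp (onRight 𝔸 (Delta k H)) =
      AlgHom.id k (𝔸 ⊗[k] H) := by
    rw [← onRight_comp, show (counitFst k H H).comp (Delta k H) = AlgHom.id k H from
      AlgHom.ext counitFst_comul]
    ext <;> simp
  have h3 : (onRight 𝔸 (counitFst k H H)).comp (onRight 𝔸 (tmulOne H H)) =
      (tmulOne 𝔸 H).comp (counitSnd k H 𝔸) := by
    rw [← onRight_comp]
    ext <;> simp [TensorProduct.smul_tmul']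
  have h4 : ∀ t : 𝔸 ⊗[k] (H ⊗[k] H), onRight H (onRight 𝔸 (counitFst k H H))
      (splitFst (H ⊗[k] H) (lam (k := k) (H := H)) t) =
      splitFst H (lam (k := k) (H := H)) (onRight 𝔸 (counitFst k H H) t) := by
    intro t
    induction t using TensorProduct.induction_on with
    | zero => simp
    | add x y hx hy => simp only [map_add, hx, hy]
    | tmul a t =>
      rw [splitFst_tmul, onRight_tmul, splitFst_tmul]
      generalize lam (k := k) (H := H) a = r
      induction r using TensorProduct.induction_on with
      | zero => simp
      | add x y hx hy => simp only [map_add, TensorProduct.add_tmul, hx, hy]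
      | tmul b c => simp
  have h5 : onRight H (AlgHom.id k (𝔸 ⊗[k] H)) (phiLamRho k H 𝔸) = phiLamRho k H 𝔸 := by
    simp [onRight]
  rw [map_mul, map_mul, map_mul, oneTmul_apply, onRight_tmul, onRight_counitFst_phiRho, h4,
    onRight_counitFst_phiRho, onRight_comp_apply, h1, onRight_comp_apply, h3,
    onRight_comp_apply, h2, h5, map_one, mul_one, ← Algebra.TensorProduct.one_def, one_mul] at h
  have h6 := congrArg (onRight H (counitSnd k H 𝔸)) (eq_one_of_phiLamRho_mul h)
  rwa [map_one, ← onRight_comp_apply, onRight_comp_apply, show (counitSnd k H 𝔸).comp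
    (tmulOne 𝔸 H) = AlgHom.id k 𝔸 from AlgHom.ext fun a => by simp, onRight,
    Algebra.TensorProduct.map_id] at h6

theorem lTensor_qMap_onRight_onRight_comul_mul (t : H ⊗[k] (𝔸 ⊗[k] H))
    (y : H ⊗[k] (𝔸 ⊗[k] (H ⊗[k] H))) :
    (qMap k H 𝔸).lTensor H (onRight H (onRight 𝔸 (Delta k H)) t * y) =
      (qMap k H 𝔸).lTensor H (onRight H (onRight 𝔸 (counitTo k H (H ⊗[k] H))) t * y) := by
  induction t using TensorProduct.induction_on with
  | zero => simp
  | add x y hx hy => simp only [map_add, add_mul, hx, hy]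
  | tmul a b =>
  induction y using TensorProduct.induction_on with
  | zero => simp
  | add x y hx hy => simp only [map_add, mul_add, hx, hy]
  | tmul c d =>
    simp only [onRight_tmul, Algebra.TensorProduct.tmul_mul_tmul, LinearMap.lTensor_tmul,
      qMap_onRight_comul_mul]

theorem splitFst_lam_phiRho_mul_theta :
    splitFst (H ⊗[k] H) (lam (k := k) (H := H)) (phiRho k H 𝔸) *
      onRight H (onRight 𝔸 (tmulOne H H)) (theta k H 𝔸) *
      onRight H (splitFst H (rho (k := k) (H := H))) (theta k H 𝔸) =
    onRight H (onRight 𝔸 (Delta k H)) (theta k H 𝔸) *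
      oneTmul H (𝔸 ⊗[k] (H ⊗[k] H)) (phiRho k H 𝔸) := by
  have h := congrArg (fun z => onRight H (onRight 𝔸 (Delta k H)) (theta k H 𝔸) * z *
    (onRight H (onRight 𝔸 (tmulOne H H)) (theta k H 𝔸) *
      onRight H (splitFst H (rho (k := k) (H := H))) (theta k H 𝔸)))
    (phiLamRho_lam_rho_rho (k := k) (H := H) (𝔸 := 𝔸))
  simp only [mul_assoc] at h ⊢
  rw [← mul_assoc (onRight H (onRight 𝔸 (tmulOne H H)) _)
      (onRight H (onRight 𝔸 (tmulOne H H)) _), ← map_mul (onRight H (onRight 𝔸 (tmulOne H H))),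
    phiLamRho_mul_theta, map_one, one_mul,
    ← map_mul (onRight H (splitFst H (rho (k := k) (H := H)))), phiLamRho_mul_theta, map_one,
    mul_one, ← mul_assoc (onRight H (onRight 𝔸 (Delta k H)) (theta k H 𝔸))
      (onRight H (onRight 𝔸 (Delta k H)) (phiLamRho k H 𝔸)),
    ← map_mul (onRight H (onRight 𝔸 (Delta k H))), theta_mul_phiLamRho, map_one, one_mul] at h
  exact h.symm

/-- The inverted mixed pentagon rewrites the argument as (id ⊗ id ⊗ Δ)(θ)(1 ⊗ Φ_ρ). The α inside q̃
absorbs the coproduct, and the normalization of θ leaves q̃ alone. -/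
theorem lTensor_qMap_theta :
    (qMap k H 𝔸).lTensor H (splitFst (H ⊗[k] H) (lam (k := k) (H := H)) (phiRho k H 𝔸) *
      onRight H (onRight 𝔸 (tmulOne H H)) (theta k H 𝔸) *
      onRight H (splitFst H (rho (k := k) (H := H))) (theta k H 𝔸)) =
    1 ⊗ₜ qRho k H 𝔸 := by
  have h1 : onRight H (onRight 𝔸 (counitTo k H (H ⊗[k] H))) (theta k H 𝔸) = 1 := by
    have h2 : onRight 𝔸 (counitTo k H (H ⊗[k] H)) =
        (tmulOne 𝔸 (H ⊗[k] H)).comp (counitSnd k H 𝔸) := by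
      ext <;> simp [counitTo_apply, TensorProduct.smul_tmul']
    rw [h2, ← onRight_comp_apply, map_theta_eq_one _ onRight_counitSnd_phiLamRho, map_one]
  rw [splitFst_lam_phiRho_mul_theta, lTensor_qMap_onRight_onRight_comul_mul, h1, one_mul,
    oneTmul_apply, LinearMap.lTensor_tmul, qRho_eq]

theorem qMap_mul_tmulOne (y : 𝔸 ⊗[k] (H ⊗[k] H)) (x : 𝔸 ⊗[k] H) :
    qMap k H 𝔸 (y * onRight 𝔸 (tmulOne H H) x) = qMap k H 𝔸 y * x := by
  induction x using TensorProduct.induction_on with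
  | zero => simp
  | add x y hx hy => simp only [map_add, mul_add, hx, hy]
  | tmul a b =>
  induction y using TensorProduct.induction_on with
  | zero => simp
  | add x y hx hy => simp only [map_add, add_mul, hx, hy]
  | tmul c d =>
    rw [onRight_tmul, Algebra.TensorProduct.tmul_mul_tmul, tmulOne_apply, qMap_tmul,
      SInv_evalAlpha_mul_tmul]
    simp

theorem lTensor_qMap_mul_splitFst_tmul (y : H ⊗[k] (𝔸 ⊗[k] (H ⊗[k] H)))
    (x : H ⊗[k] (𝔸 ⊗[k] H)) (t₁ t₃ : H) (t₂ : 𝔸) :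
    (qMap k H 𝔸).lTensor H (y * onRight H (onRight 𝔸 (tmulOne H H)) x *
      onRight H (splitFst H (rho (k := k) (H := H))) (t₁ ⊗ₜ (t₂ ⊗ₜ t₃))) =
    1 ⊗ₜ (1 ⊗ₜ SInv k H t₃) * (qMap k H 𝔸).lTensor H y * x *
      onRight H (rho (k := k) (H := H)) (t₁ ⊗ₜ t₂) := by
  induction x using TensorProduct.induction_on with
  | zero => simp
  | add x y hx hy => simp only [map_add, mul_add, add_mul, hx, hy]
  | tmul a b =>
  induction y using TensorProduct.induction_on with
  | zero => simp
  | add x y hx hy => simp only [map_add, mul_add, add_mul, hx, hy]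
  | tmul c d =>
    simp only [onRight_tmul, Algebra.TensorProduct.tmul_mul_tmul, LinearMap.lTensor_tmul,
      qMap_mul_splitFst_tmul, qMap_mul_tmulOne, one_mul, ← mul_assoc]

end Bicomodule

/-! ### Actions on 𝒜 ⊗ 𝔸 and the candidate map w. -/

section CrossedAction

variable {k H 𝒜 𝔸 B : Type*} [Field k] [Ring H] [Algebra k H] [QuasiHopfAlgebra k H]
  [NonAssocRing 𝒜] [Module k 𝒜] [SMulCommClass k 𝒜 𝒜] [IsScalarTower k 𝒜 𝒜]
  [Module H 𝒜] [IsScalarTower k H 𝒜] [Module Hᵐᵒᵖ 𝒜] [IsScalarTower k Hᵐᵒᵖ 𝒜]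
  [Ring 𝔸] [Algebra k 𝔸] [Ring B] [Algebra k B]

open QuasiBialgebra QuasiHopfAlgebra RightComoduleAlgebra LeftComoduleAlgebra BicomoduleAlgebra
open MulOpposite

variable (k H 𝒜 𝔸) in
/-- `h ⊗ a ⊗ h'` acts on `𝒜 ⊗ 𝔸` by `φ ⊗ u ↦ (h · φ · S⁻¹(h')) ⊗ a u`. -/
def twistedAct3 : H ⊗[k] (𝔸 ⊗[k] H) →ₗ[k] Module.End k (𝒜 ⊗[k] 𝔸) :=
  act3 k H 𝒜 𝔸 ∘ₗ TensorProduct.map LinearMap.id (TensorProduct.map LinearMap.id (SInv k H))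

@[simp] theorem twistedAct3_tmul (h h' : H) (a u : 𝔸) (φ : 𝒜) :
    twistedAct3 k H 𝒜 𝔸 (h ⊗ₜ (a ⊗ₜ h')) (φ ⊗ₜ u) =
      (h • op (SInv k H h') • φ) ⊗ₜ (a * u) :=
  act3_tmul ..

theorem act3_lamSInv [LeftComoduleAlgebra k H 𝔸] (r : 𝔸 ⊗[k] H) :
    act3 k H 𝒜 𝔸 (lamSInv k H 𝔸 r) =
      twistedAct3 k H 𝒜 𝔸 (splitFst H (lam (k := k) (H := H)) r) := rfl

theorem twistedAct3_one : twistedAct3 k H 𝒜 𝔸 1 = 1 := by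
  refine TensorProduct.ext' fun φ u => ?_
  rw [Algebra.TensorProduct.one_def, Algebra.TensorProduct.one_def, twistedAct3_tmul, SInv_one]
  simp

/-- A right action and S⁻¹ each reverse products, so composing them gives a genuine left action of
the tensor product algebra. -/
theorem twistedAct3_mul [SMulCommClass H Hᵐᵒᵖ 𝒜] (s t : H ⊗[k] (𝔸 ⊗[k] H)) :
    twistedAct3 k H 𝒜 𝔸 (s * t) = twistedAct3 k H 𝒜 𝔸 s * twistedAct3 k H 𝒜 𝔸 t := by
  induction s using TensorProduct.induction_on with
  | zero => simp
  | add x y hx hy => simp only [map_add, add_mul, hx, hy]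
  | tmul s₁ s =>
  induction s using TensorProduct.induction_on with
  | zero => simp
  | add x y hx hy => simp only [map_add, add_mul, TensorProduct.tmul_add, hx, hy]
  | tmul s₂ s₃ =>
  induction t using TensorProduct.induction_on with
  | zero => simp
  | add x y hx hy => simp only [map_add, mul_add, hx, hy]
  | tmul t₁ t =>
  induction t using TensorProduct.induction_on with
  | zero => simp
  | add x y hx hy => simp only [map_add, mul_add, TensorProduct.tmul_add, hx, hy]
  | tmul t₂ t₃ =>
    refine TensorProduct.ext' fun φ u => ?_
    rw [Module.End.mul_apply, Algebra.TensorProduct.tmul_mul_tmul,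
      Algebra.TensorProduct.tmul_mul_tmul, twistedAct3_tmul, twistedAct3_tmul, twistedAct3_tmul,
      SInv_mul, op_mul, mul_smul, mul_smul, mul_assoc, smul_comm t₁ (op (SInv k H s₃))]

theorem twistedAct3_apply_tmul (s : H ⊗[k] (𝔸 ⊗[k] H)) (φ : 𝒜) (u u' : 𝔸) :
    twistedAct3 k H 𝒜 𝔸 s (φ ⊗ₜ (u * u')) =
      (LinearMap.mulRight k u').lTensor 𝒜 (twistedAct3 k H 𝒜 𝔸 s (φ ⊗ₜ u)) := by
  induction s using TensorProduct.induction_on with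
  | zero => simp
  | add x y hx hy => simp only [map_add, LinearMap.add_apply, hx, hy]
  | tmul s₁ s =>
  induction s using TensorProduct.induction_on with
  | zero => simp
  | add x y hx hy => simp only [map_add, LinearMap.add_apply, TensorProduct.tmul_add, hx, hy]
  | tmul s₂ s₃ => simp [-LinearEquiv.coe_coe, mul_assoc]

variable (k H 𝒜 𝔸) in
/-- `h₁ ⊗ h₂ ⊗ a ⊗ h₄ ⊗ h₅` acts on `𝒜 ⊗ 𝒜 ⊗ 𝔸` by
`φ ⊗ φ' ⊗ u ↦ (h₁ · φ · S⁻¹(h₅)) ⊗ (h₂ · φ' · S⁻¹(h₄)) ⊗ a u`. -/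
def twistedAct5 : H ⊗[k] (H ⊗[k] (𝔸 ⊗[k] (H ⊗[k] H))) →ₗ[k] Module.End k (𝒜 ⊗[k] (𝒜 ⊗[k] 𝔸)) :=
  act5 k H 𝒜 𝔸 ∘ₗ TensorProduct.map LinearMap.id (TensorProduct.map LinearMap.id
    (TensorProduct.map LinearMap.id (TensorProduct.map (SInv k H) (SInv k H))))

@[simp] theorem twistedAct5_tmul (h₁ h₂ h₄ h₅ : H) (a u : 𝔸) (φ φ' : 𝒜) :
    twistedAct5 k H 𝒜 𝔸 (h₁ ⊗ₜ (h₂ ⊗ₜ (a ⊗ₜ (h₄ ⊗ₜ h₅)))) (φ ⊗ₜ (φ' ⊗ₜ u)) =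
      (h₁ • op (SInv k H h₅) • φ) ⊗ₜ ((h₂ • op (SInv k H h₄) • φ') ⊗ₜ (a * u)) :=
  act5_tmul ..

theorem act5_Omega [BicomoduleAlgebra k H 𝔸] :
    act5 k H 𝒜 𝔸 (Omega k H 𝔸) = twistedAct5 k H 𝒜 𝔸 (omegaAux k H 𝔸) := rfl

variable (k H) in
/-- The linear map `a ⊗ h ↦ γ(a) v(φ · h)`, as a linear function of `φ`. -/
def evalRight (γ : 𝔸 →ₐ[k] B) (v : 𝒜 →ₗ[k] B) : 𝒜 →ₗ[k] 𝔸 ⊗[k] H →ₗ[k] B where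
  toFun φ := prodMap γ.toLinearMap (vR v φ)
  map_add' φ φ' := TensorProduct.ext' fun a h => by simp [vR, mul_add]
  map_smul' c φ := TensorProduct.ext' fun a h => by simp only [vR, map_smul]; simp

theorem evalRight_apply (γ : 𝔸 →ₐ[k] B) (v : 𝒜 →ₗ[k] B) (φ : 𝒜) :
    evalRight k H γ v φ = prodMap γ.toLinearMap (vR v φ) := rfl

@[simp] theorem evalRight_tmul (γ : 𝔸 →ₐ[k] B) (v : 𝒜 →ₗ[k] B) (φ : 𝒜) (a : 𝔸) (h : H) :
    evalRight k H γ v φ (a ⊗ₜ[k] h) = γ a * v (op h • φ) := by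
  simp [evalRight_apply, vR_apply]

theorem evalRight_tmul_mul (γ : 𝔸 →ₐ[k] B) (v : 𝒜 →ₗ[k] B) (φ : 𝒜) (a : 𝔸) (h : H)
    (t : 𝔸 ⊗[k] H) : evalRight k H γ v φ (a ⊗ₜ[k] h * t) = γ a * evalRight k H γ v (op h • φ) t := by
  induction t using TensorProduct.induction_on with
  | zero => simp
  | add x y hx hy => simp only [map_add, mul_add, hx, hy]
  | tmul b c => simp [mul_smul, mul_assoc]

section Right

variable [RightComoduleAlgebra k H 𝔸]

variable (H) in
/-- The linear map `φ ↦ γ(q̃¹) v(φ · q̃²)`. -/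
def vTilde (γ : 𝔸 →ₐ[k] B) (v : 𝒜 →ₗ[k] B) : 𝒜 →ₗ[k] B :=
  (evalRight k H γ v).flip (qRho k H 𝔸)

theorem vTilde_apply (γ : 𝔸 →ₐ[k] B) (v : 𝒜 →ₗ[k] B) (φ : 𝒜) :
    vTilde H γ v φ = evalRight k H γ v φ (qRho k H 𝔸) := rfl

variable (H) in
/-- The linear map `φ ⊗ u ↦ γ(q̃¹) v(φ · q̃²) γ(u)`. -/
def wTilde (γ : 𝔸 →ₐ[k] B) (v : 𝒜 →ₗ[k] B) : 𝒜 ⊗[k] 𝔸 →ₗ[k] B :=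
  prodMap (vTilde H γ v) γ.toLinearMap

@[simp] theorem wTilde_tmul (γ : 𝔸 →ₐ[k] B) (v : 𝒜 →ₗ[k] B) (φ : 𝒜) (u : 𝔸) :
    wTilde H γ v (φ ⊗ₜ u) = vTilde H γ v φ * γ u := by
  simp [wTilde]

theorem wTilde_lTensor_mulRight (γ : 𝔸 →ₐ[k] B) (v : 𝒜 →ₗ[k] B) (x : 𝒜 ⊗[k] 𝔸) (u : 𝔸) :
    wTilde H γ v ((LinearMap.mulRight k u).lTensor 𝒜 x) = wTilde H γ v x * γ u := by
  induction x using TensorProduct.induction_on with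
  | zero => simp
  | add x y hx hy => simp only [map_add, add_mul, hx, hy]
  | tmul φ a => simp [mul_assoc]

end Right

section Commutation

variable [BicomoduleAlgebra k H 𝔸] [SMulCommClass H Hᵐᵒᵖ 𝒜] {γ : 𝔸 →ₐ[k] B} {v : 𝒜 →ₗ[k] B}

/-- The commutation hypothesis is applied to φ·t². The left action can then be moved next to φ
because the two actions commute. -/
theorem evalRight_mul_rho (hcomm : ∀ (φ : 𝒜) (u : 𝔸),
      prodMap γ.toLinearMap (vR v φ) (rho (k := k) (H := H) u) =
        prodMap (vL v φ) γ.toLinearMap (lam (k := k) (H := H) u))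
    (t : 𝔸 ⊗[k] H) (φ : 𝒜) (u : 𝔸) :
    evalRight k H γ v φ (t * rho u) =
      prodMap ((evalRight k H γ v).flip t ∘ₗ (actL k H 𝒜).flip φ) γ.toLinearMap
        (lam (k := k) (H := H) u) := by
  induction t using TensorProduct.induction_on with
  | zero => simp [prodMap]
  | add x y hx hy =>
    rw [add_mul, map_add, hx, hy, ← LinearMap.add_apply]
    congr 1
    exact TensorProduct.ext' fun a b => by simp [add_mul]
  | tmul a b =>
    rw [evalRight_tmul_mul, evalRight_apply, hcomm, ← LinearMap.mulLeft_apply k,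
      ← LinearMap.comp_apply]
    congr 1
    refine TensorProduct.ext' fun h c => ?_
    simp [vL_apply, mul_assoc, smul_comm h (op b)]

/-- `w(x_{[-1]} · φ · S⁻¹(h) ⊗ x_{[0]})` for `w = γ(q̃¹) v(- · q̃²) γ(-)`, as an expression in the
right coaction. -/
theorem wTilde_twistedAct3 (hcomm : ∀ (φ : 𝒜) (u : 𝔸),
      prodMap γ.toLinearMap (vR v φ) (rho (k := k) (H := H) u) =
        prodMap (vL v φ) γ.toLinearMap (lam (k := k) (H := H) u))
    (r : 𝔸 ⊗[k] H) (φ : 𝒜) :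
    wTilde H γ v (twistedAct3 k H 𝒜 𝔸 (splitFst H (lam (k := k) (H := H)) r) (φ ⊗ₜ 1)) =
      evalRight k H γ v φ
        (qMap k H 𝔸 (phiRho k H 𝔸 * splitFst H (rho (k := k) (H := H)) r)) := by
  induction r using TensorProduct.induction_on with
  | zero => simp
  | add x y hx hy => simp only [map_add, mul_add, LinearMap.add_apply, hx, hy]
  | tmul a h =>
    rw [qMap_mul_splitFst_tmul, mul_assoc, evalRight_tmul_mul, evalRight_mul_rho hcomm, map_one,
      one_mul, splitFst_tmul, ← qRho_eq]
    generalize lam (k := k) (H := H) a = l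
    induction l using TensorProduct.induction_on with
    | zero => simp
    | add x y hx hy => simp only [map_add, TensorProduct.add_tmul, LinearMap.add_apply, hx, hy]
    | tmul b c => simp [-LinearEquiv.coe_coe, vTilde_apply]

/-- In terms of w this says w(j(u) x) = γ(u) w(x); it comes from [1 ⊗ S⁻¹(u_{<1>})] q̃ ρ(u_{<0>}) =
[u ⊗ 1] q̃. -/
theorem wTilde_twistedAct3_rho (hcomm : ∀ (φ : 𝒜) (u : 𝔸),
      prodMap γ.toLinearMap (vR v φ) (rho (k := k) (H := H) u) =
        prodMap (vL v φ) γ.toLinearMap (lam (k := k) (H := H) u))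
    (u u' : 𝔸) (φ : 𝒜) :
    wTilde H γ v (twistedAct3 k H 𝒜 𝔸 (splitFst H (lam (k := k) (H := H)) (rho u)) (φ ⊗ₜ u')) =
      γ u * vTilde H γ v φ * γ u' := by
  rw [← one_mul u', twistedAct3_apply_tmul, wTilde_lTensor_mulRight, wTilde_twistedAct3 hcomm,
    qMap_phiRho_mul_splitFst_rho, evalRight_tmul_mul, op_one, one_smul, vTilde_apply, one_mul]

end Commutation

end CrossedAction

/-! ### Rewriting the words γ v γ v γ given by the product hypothesis. -/

section Multiplicativity

variable {k H 𝒜 𝔸 B : Type*} [Field k] [Ring H] [Algebra k H] [QuasiHopfAlgebra k H]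
  [NonAssocRing 𝒜] [Module k 𝒜] [SMulCommClass k 𝒜 𝒜] [IsScalarTower k 𝒜 𝒜]
  [Module H 𝒜] [IsScalarTower k H 𝒜] [Module Hᵐᵒᵖ 𝒜] [IsScalarTower k Hᵐᵒᵖ 𝒜]
  [SMulCommClass H Hᵐᵒᵖ 𝒜]
  [Ring 𝔸] [Algebra k 𝔸] [Ring B] [Algebra k B]

open QuasiBialgebra QuasiHopfAlgebra RightComoduleAlgebra LeftComoduleAlgebra BicomoduleAlgebra
open MulOpposite

section Words

variable (γ : 𝔸 →ₐ[k] B) (v : 𝒜 →ₗ[k] B) (R R' : 𝔸 ⊗[k] (H ⊗[k] H))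
    (T T' : H ⊗[k] (𝔸 ⊗[k] H)) (L L' : H ⊗[k] (H ⊗[k] 𝔸)) (φ φ' : 𝒜)

theorem vMulExpr_add_fst : vMulExpr γ v (R + R') T L φ φ' =
    vMulExpr γ v R T L φ φ' + vMulExpr γ v R' T L φ φ' := by
  simp only [vMulExpr, map_add, LinearMap.add_apply]

theorem vMulExpr_add_snd : vMulExpr γ v R (T + T') L φ φ' =
    vMulExpr γ v R T L φ φ' + vMulExpr γ v R T' L φ φ' := by
  simp only [vMulExpr, map_add, LinearMap.add_apply]

theorem vMulExpr_add_trd : vMulExpr γ v R T (L + L') φ φ' =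
    vMulExpr γ v R T L φ φ' + vMulExpr γ v R T L' φ φ' := by
  simp only [vMulExpr, map_add, LinearMap.add_apply]

@[simp] theorem vMulExpr_zero_fst : vMulExpr γ v 0 T L φ φ' = 0 := by
  simp only [vMulExpr, map_zero, LinearMap.zero_apply]

@[simp] theorem vMulExpr_zero_snd : vMulExpr γ v R 0 L φ φ' = 0 := by
  simp only [vMulExpr, map_zero, LinearMap.zero_apply]

@[simp] theorem vMulExpr_zero_trd : vMulExpr γ v R T 0 φ φ' = 0 := by
  simp only [vMulExpr, map_zero, LinearMap.zero_apply]

theorem vMulExpr_tmul_one (x₁ t₂ : 𝔸) (x₂ x₃ t₁ t₃ : H) :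
    vMulExpr γ v (x₁ ⊗ₜ (x₂ ⊗ₜ x₃)) (t₁ ⊗ₜ (t₂ ⊗ₜ t₃)) 1 φ φ' =
      γ x₁ * v (t₁ • op x₂ • φ) * γ t₂ * v (op (x₃ * t₃) • φ') := by
  rw [Algebra.TensorProduct.one_def, Algebra.TensorProduct.one_def, vMulExpr_tmul, mul_one,
    one_smul, map_one, mul_one]

/-- Two functions of `R` and `T` that are additive in both agree if they agree on pure tensors. -/
theorem word_induction {M : Type*} [AddCommMonoid M]
    {F G : 𝔸 ⊗[k] (H ⊗[k] H) → H ⊗[k] (𝔸 ⊗[k] H) → M}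
    (hF0 : ∀ T, F 0 T = 0) (hG0 : ∀ T, G 0 T = 0) (hF0' : ∀ R, F R 0 = 0) (hG0' : ∀ R, G R 0 = 0)
    (hF : ∀ R R' T, F (R + R') T = F R T + F R' T) (hG : ∀ R R' T, G (R + R') T = G R T + G R' T)
    (hF' : ∀ R T T', F R (T + T') = F R T + F R T')
    (hG' : ∀ R T T', G R (T + T') = G R T + G R T')
    (h : ∀ x₁ x₂ x₃ t₁ t₂ t₃, F (x₁ ⊗ₜ (x₂ ⊗ₜ x₃)) (t₁ ⊗ₜ (t₂ ⊗ₜ t₃)) =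
      G (x₁ ⊗ₜ (x₂ ⊗ₜ x₃)) (t₁ ⊗ₜ (t₂ ⊗ₜ t₃))) : F R T = G R T := by
  induction R using TensorProduct.induction_on with
  | zero => rw [hF0, hG0]
  | add x y hx hy => rw [hF, hG, hx, hy]
  | tmul x₁ x =>
  induction x using TensorProduct.induction_on with
  | zero => rw [TensorProduct.tmul_zero, hF0, hG0]
  | add x y hx hy => rw [TensorProduct.tmul_add, hF, hG, hx, hy]
  | tmul x₂ x₃ =>
  induction T using TensorProduct.induction_on with
  | zero => rw [hF0', hG0']
  | add x y hx hy => rw [hF', hG', hx, hy]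
  | tmul t₁ t =>
  induction t using TensorProduct.induction_on with
  | zero => rw [TensorProduct.tmul_zero, hF0', hG0']
  | add x y hx hy => rw [TensorProduct.tmul_add, hF', hG', hx, hy]
  | tmul t₂ t₃ => exact h ..

/-- The third legs of R and T act on φ' through the single product X³θ³, so a factor between them
may be assigned to either. -/
theorem vMulExpr_mul_one_tmul (s : H) :
    vMulExpr γ v (R * 1 ⊗ₜ (1 ⊗ₜ s)) T 1 φ φ' = vMulExpr γ v R (1 ⊗ₜ (1 ⊗ₜ s) * T) 1 φ φ' := by
  refine word_induction (F := fun R T => vMulExpr γ v (R * 1 ⊗ₜ (1 ⊗ₜ s)) T 1 φ φ')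
    (G := fun R T => vMulExpr γ v R (1 ⊗ₜ (1 ⊗ₜ s) * T) 1 φ φ') R T
    (by simp) (by simp) (by simp) (by simp) (by simp [add_mul, vMulExpr_add_fst])
    (by simp [vMulExpr_add_fst]) (by simp [vMulExpr_add_snd])
    (by simp [mul_add, vMulExpr_add_snd]) ?_
  intros
  simp only [Algebra.TensorProduct.tmul_mul_tmul, vMulExpr_tmul_one, mul_one, one_mul, mul_assoc]

theorem mul_vMulExpr_mul (b a : 𝔸) (c₁ c₂ h₁ h₂ h₄ h₅ : H) :
    γ b * vMulExpr γ v R T L (op c₁ • h₁ • op h₅ • φ) (op c₂ • h₂ • op h₄ • φ') * γ a =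
      vMulExpr γ v (b ⊗ₜ ((h₅ * c₁) ⊗ₜ (h₄ * c₂)) * R) T (L * h₁ ⊗ₜ (h₂ ⊗ₜ a)) φ φ' := by
  induction L using TensorProduct.induction_on with
  | zero => simp
  | add x y hx hy => simp only [vMulExpr_add_trd, add_mul, mul_add, hx, hy]
  | tmul y₁ y =>
  induction y using TensorProduct.induction_on with
  | zero => simp
  | add x y hx hy => simp only [TensorProduct.tmul_add, vMulExpr_add_trd, add_mul, mul_add, hx, hy]
  | tmul y₂ y₃ =>
  refine word_induction
    (F := fun R T => γ b * vMulExpr γ v R T (y₁ ⊗ₜ (y₂ ⊗ₜ y₃)) (op c₁ • h₁ • op h₅ • φ)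
      (op c₂ • h₂ • op h₄ • φ') * γ a)
    (G := fun R T => vMulExpr γ v (b ⊗ₜ ((h₅ * c₁) ⊗ₜ (h₄ * c₂)) * R) T
      (y₁ ⊗ₜ (y₂ ⊗ₜ y₃) * h₁ ⊗ₜ (h₂ ⊗ₜ a)) φ φ') R T
    (by simp) (by simp) (by simp) (by simp) (by simp [add_mul, mul_add, vMulExpr_add_fst])
    (by simp [mul_add, vMulExpr_add_fst]) (by simp [add_mul, mul_add, vMulExpr_add_snd])
    (by simp [vMulExpr_add_snd]) ?_
  intro x₁ x₂ x₃ t₁ t₂ t₃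
  simp only [Algebra.TensorProduct.tmul_mul_tmul, vMulExpr_tmul, op_mul, mul_smul, map_mul,
    mul_assoc, smul_comm h₁ (op _), smul_comm h₂ (op _)]

variable [BicomoduleAlgebra k H 𝔸]

variable {γ v} in
-- The commutation hypothesis at the second v turns the trailing v(b_{[-1]}·–) γ(b_{[0]}) into
-- γ(b_{<0>}) v(–·b_{<1>}), which is absorbed into θ² and θ³.
theorem vMulExpr_onRight_lam (hcomm : ∀ (φ : 𝒜) (u : 𝔸),
      prodMap γ.toLinearMap (vR v φ) (rho (k := k) (H := H) u) =
        prodMap (vL v φ) γ.toLinearMap (lam (k := k) (H := H) u)) (s : H ⊗[k] 𝔸) :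
    vMulExpr γ v R T (onRight H (lam (k := k) (H := H)) s) φ φ' =
      vMulExpr γ v R (T * onRight H (rho (k := k) (H := H)) s) 1 φ φ' := by
  induction s using TensorProduct.induction_on with
  | zero => simp
  | add x y hx hy =>
    simp only [map_add, mul_add, vMulExpr_add_trd, vMulExpr_add_snd, hx, hy]
  | tmul h b =>
  refine word_induction
    (F := fun R T => vMulExpr γ v R T (onRight H (lam (k := k) (H := H)) (h ⊗ₜ b)) φ φ')
    (G := fun R T => vMulExpr γ v R (T * onRight H (rho (k := k) (H := H)) (h ⊗ₜ b)) 1 φ φ') R T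
    (by simp) (by simp) (by simp) (by simp) (by simp [vMulExpr_add_fst])
    (by simp [vMulExpr_add_fst]) (by simp [vMulExpr_add_snd])
    (by simp [add_mul, vMulExpr_add_snd]) ?_
  intro x₁ x₂ x₃ t₁ t₂ t₃
  have h1 : ∀ l : H ⊗[k] 𝔸, vMulExpr γ v (x₁ ⊗ₜ (x₂ ⊗ₜ x₃)) (t₁ ⊗ₜ (t₂ ⊗ₜ t₃)) (h ⊗ₜ l) φ φ' =
      γ x₁ * v ((t₁ * h) • op x₂ • φ) * γ t₂ *
        prodMap (vL v (op (x₃ * t₃) • φ')) γ.toLinearMap l := by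
    intro l
    induction l using TensorProduct.induction_on with
    | zero => simp
    | add x y hx hy => simp only [map_add, TensorProduct.tmul_add, vMulExpr_add_trd, hx, hy, mul_add]
    | tmul c d => simp only [vMulExpr_tmul, prodMap_tmul, vL_apply, mul_assoc,
        AlgHom.toLinearMap_apply]
  have h2 : ∀ r : 𝔸 ⊗[k] H, vMulExpr γ v (x₁ ⊗ₜ (x₂ ⊗ₜ x₃)) ((t₁ * h) ⊗ₜ ((t₂ ⊗ₜ t₃) * r)) 1 φ φ' =
      γ x₁ * v ((t₁ * h) • op x₂ • φ) * γ t₂ *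
        prodMap γ.toLinearMap (vR v (op (x₃ * t₃) • φ')) r := by
    intro r
    induction r using TensorProduct.induction_on with
    | zero => simp
    | add x y hx hy =>
      simp only [map_add, TensorProduct.tmul_add, vMulExpr_add_snd, hx, hy, mul_add]
    | tmul c d => simp only [vMulExpr_tmul_one, prodMap_tmul, vR_apply, mul_assoc, map_mul, op_mul,
        mul_smul, AlgHom.toLinearMap_apply, Algebra.TensorProduct.tmul_mul_tmul]
  simp only [onRight_tmul, Algebra.TensorProduct.tmul_mul_tmul]
  rw [h1, h2, hcomm]

variable {γ v} in
-- The same exchange at the first v: the left coaction standing before T becomes a right coaction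
-- standing after R.
theorem vMulExpr_splitFst_lam_mul (hcomm : ∀ (φ : 𝒜) (u : 𝔸),
      prodMap γ.toLinearMap (vR v φ) (rho (k := k) (H := H) u) =
        prodMap (vL v φ) γ.toLinearMap (lam (k := k) (H := H) u)) (r : 𝔸 ⊗[k] H) :
    vMulExpr γ v R (splitFst H (lam (k := k) (H := H)) r * T) 1 φ φ' =
      vMulExpr γ v (R * splitFst H (rho (k := k) (H := H)) r) T 1 φ φ' := by
  induction r using TensorProduct.induction_on with
  | zero => simp
  | add x y hx hy =>
    simp only [map_add, mul_add, add_mul, vMulExpr_add_fst, vMulExpr_add_snd, hx, hy]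
  | tmul u d =>
  refine word_induction
    (F := fun R T => vMulExpr γ v R (splitFst H (lam (k := k) (H := H)) (u ⊗ₜ d) * T) 1 φ φ')
    (G := fun R T => vMulExpr γ v (R * splitFst H (rho (k := k) (H := H)) (u ⊗ₜ d)) T 1 φ φ') R T
    (by simp) (by simp) (by simp) (by simp) (by simp [vMulExpr_add_fst])
    (by simp [add_mul, vMulExpr_add_fst]) (by simp [mul_add, vMulExpr_add_snd])
    (by simp [vMulExpr_add_snd]) ?_
  intro x₁ x₂ x₃ t₁ t₂ t₃
  have h1 : ∀ l : H ⊗[k] 𝔸, vMulExpr γ v (x₁ ⊗ₜ (x₂ ⊗ₜ x₃))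
      (TensorProduct.assoc k H 𝔸 H (l ⊗ₜ d) * (t₁ ⊗ₜ (t₂ ⊗ₜ t₃))) 1 φ φ' =
      γ x₁ * prodMap (vL v (t₁ • op x₂ • φ)) γ.toLinearMap l * (γ t₂ *
        v (op (x₃ * d * t₃) • φ')) := by
    intro l
    induction l using TensorProduct.induction_on with
    | zero => simp
    | add x y hx hy => simp only [map_add, TensorProduct.add_tmul, vMulExpr_add_snd, hx, hy,
        mul_add, add_mul]
    | tmul c e => simp only [TensorProduct.assoc_tmul, Algebra.TensorProduct.tmul_mul_tmul,
        vMulExpr_tmul_one, prodMap_tmul, vL_apply, mul_assoc, AlgHom.toLinearMap_apply, mul_smul,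
        map_mul]
  have h2 : ∀ r : 𝔸 ⊗[k] H, vMulExpr γ v
      (x₁ ⊗ₜ (x₂ ⊗ₜ x₃) * TensorProduct.assoc k 𝔸 H H (r ⊗ₜ d)) (t₁ ⊗ₜ (t₂ ⊗ₜ t₃)) 1 φ φ' =
      γ x₁ * prodMap γ.toLinearMap (vR v (t₁ • op x₂ • φ)) r * (γ t₂ *
        v (op (x₃ * d * t₃) • φ')) := by
    intro r
    induction r using TensorProduct.induction_on with
    | zero => simp
    | add x y hx hy => simp only [map_add, TensorProduct.add_tmul, vMulExpr_add_fst, hx, hy,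
        mul_add, add_mul]
    | tmul c e => simp only [TensorProduct.assoc_tmul, Algebra.TensorProduct.tmul_mul_tmul,
        vMulExpr_tmul_one, prodMap_tmul, vR_apply, mul_assoc, AlgHom.toLinearMap_apply, op_mul,
        mul_smul, map_mul, smul_comm t₁ (op e)]
  simp only [splitFst_tmul]
  rw [h1, h2, hcomm]

end Words

variable [BicomoduleAlgebra k H 𝔸] [BimoduleAlgebra k H 𝒜] {γ : 𝔸 →ₐ[k] B} {v : 𝒜 →ₗ[k] B}

/-- The right action on a product distributes through Δ, which is how the coproduct of q̃² enters.
-/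
theorem evalRight_mul (hmul : ∀ φ φ' : 𝒜, v (φ * φ') =
      vMulExpr γ v (phiRho k H 𝔸) (theta k H 𝔸) (phiLam k H 𝔸) φ φ')
    (t : 𝔸 ⊗[k] H) (h₁ h₂ h₄ h₅ : H) (a : 𝔸) (φ φ' : 𝒜) :
    evalRight k H γ v ((h₁ • op h₅ • φ) * (h₂ • op h₄ • φ')) t * γ a =
      vMulExpr γ v (1 ⊗ₜ (h₅ ⊗ₜ h₄) * onRight 𝔸 (Delta k H) t * phiRho k H 𝔸) (theta k H 𝔸)
        (phiLam k H 𝔸 * h₁ ⊗ₜ (h₂ ⊗ₜ a)) φ φ' := by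
  induction t using TensorProduct.induction_on with
  | zero => simp
  | add x y hx hy => simp only [map_add, mul_add, add_mul, vMulExpr_add_fst, hx, hy]
  | tmul b c =>
    rw [evalRight_tmul, BimoduleAlgebra.mul_smul' (k := k), onRight_tmul,
      Algebra.TensorProduct.tmul_mul_tmul, one_mul]
    change γ b * v (prodMap LinearMap.id LinearMap.id (tensorAct _ _ (Delta k H c) _)) * γ a = _
    generalize Delta k H c = d
    induction d using TensorProduct.induction_on with
    | zero => simp
    | add x y hx hy =>
      simp only [map_add, LinearMap.add_apply, TensorProduct.tmul_add, mul_add, add_mul,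
        vMulExpr_add_fst, hx, hy]
    | tmul c₁ c₂ =>
      rw [Algebra.TensorProduct.tmul_mul_tmul, ← mul_vMulExpr_mul, ← hmul]
      simp

/-- The algebra map `h ⊗ h' ⊗ a ↦ h ⊗ h' ⊗ a ⊗ 1 ⊗ 1`. -/
abbrev extendRight (k H 𝔸 : Type*) [Field k] [Ring H] [Algebra k H] [Ring 𝔸] [Algebra k 𝔸] :
    H ⊗[k] (H ⊗[k] 𝔸) →ₐ[k] H ⊗[k] (H ⊗[k] (𝔸 ⊗[k] (H ⊗[k] H))) :=
  onRight H (onRight H (tmulOne 𝔸 (H ⊗[k] H)))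

theorem wTilde_mulFst_twistedAct5 (hmul : ∀ φ φ' : 𝒜, v (φ * φ') =
      vMulExpr γ v (phiRho k H 𝔸) (theta k H 𝔸) (phiLam k H 𝔸) φ φ')
    (L : H ⊗[k] (H ⊗[k] 𝔸)) (P : H ⊗[k] H) (φ φ' : 𝒜) :
    wTilde H γ v (mulFst k 𝒜 𝔸 (twistedAct5 k H 𝒜 𝔸
        (extendRight k H 𝔸 L * 1 ⊗ₜ (1 ⊗ₜ (1 ⊗ₜ P))) (φ ⊗ₜ (φ' ⊗ₜ 1)))) =
      vMulExpr γ v (1 ⊗ₜ swapInv k H P * onRight 𝔸 (Delta k H) (qRho k H 𝔸) * phiRho k H 𝔸)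
        (theta k H 𝔸) (phiLam k H 𝔸 * L) φ φ' := by
  induction L using TensorProduct.induction_on with
  | zero => simp
  | add x y hx hy =>
    simp only [map_add, mul_add, add_mul, LinearMap.add_apply, vMulExpr_add_trd, hx, hy]
  | tmul h₁ L =>
  induction L using TensorProduct.induction_on with
  | zero => simp
  | add x y hx hy =>
    simp only [map_add, mul_add, add_mul, LinearMap.add_apply, vMulExpr_add_trd,
      TensorProduct.tmul_add, hx, hy]
  | tmul h₂ a =>
  induction P using TensorProduct.induction_on with
  | zero => simp
  | add x y hx hy =>
    simp only [map_add, mul_add, add_mul, LinearMap.add_apply, vMulExpr_add_fst,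
      TensorProduct.tmul_add, hx, hy]
  | tmul p₄ p₅ =>
    rw [onRight_tmul, onRight_tmul, tmulOne_apply, Algebra.TensorProduct.tmul_mul_tmul,
      Algebra.TensorProduct.tmul_mul_tmul, Algebra.TensorProduct.tmul_mul_tmul,
      one_mul, mul_one, mul_one, mul_one, twistedAct5_tmul, mulFst_tmul, wTilde_tmul, mul_one,
      vTilde_apply, evalRight_mul hmul, swapInv_tmul]

end Multiplicativity

/-! ### Cancellation of Ω: w of a product whose left factor is φ ⋈ 1. -/

section Homomorphism

variable {k H 𝒜 𝔸 B : Type*} [Field k] [Ring H] [Algebra k H] [QuasiHopfAlgebra k H]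
  [NonAssocRing 𝒜] [Module k 𝒜] [SMulCommClass k 𝒜 𝒜] [IsScalarTower k 𝒜 𝒜]
  [Module H 𝒜] [IsScalarTower k H 𝒜] [Module Hᵐᵒᵖ 𝒜] [IsScalarTower k Hᵐᵒᵖ 𝒜]
  [SMulCommClass H Hᵐᵒᵖ 𝒜]
  [Ring 𝔸] [Algebra k 𝔸] [Ring B] [Algebra k B]
  [BicomoduleAlgebra k H 𝔸] [BimoduleAlgebra k H 𝒜] {γ : 𝔸 →ₐ[k] B} {v : 𝒜 →ₗ[k] B}

open QuasiBialgebra QuasiHopfAlgebra RightComoduleAlgebra LeftComoduleAlgebra BicomoduleAlgebra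
open MulOpposite

variable (k H 𝔸) in
/-- The element `omegaAux` with `Φ_ρ` and `Φ_{λ,ρ}⁻¹` replaced by `z` and `t`. -/
def omegaGen (z : 𝔸 ⊗[k] (H ⊗[k] H)) (t : H ⊗[k] (𝔸 ⊗[k] H)) :
    H ⊗[k] (H ⊗[k] (𝔸 ⊗[k] (H ⊗[k] H))) :=
  oneTmul H _ (oneTmul H _ (oneTmul 𝔸 _ (drinfeldTwist k H))) *
    splitFst (𝔸 ⊗[k] (H ⊗[k] H)) (Delta k H)
      (splitFst (H ⊗[k] H) (lam (k := k) (H := H) (A := 𝔸)) z) *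
    extendRight k H 𝔸 (phiLamInv k H 𝔸) *
    onRight H (onRight H (onRight 𝔸 (tmulOne H H)))
      (onRight H (splitFst H (lam (k := k) (H := H) (A := 𝔸))) t)

theorem omegaGen_phiRho_theta :
    omegaGen k H 𝔸 (phiRho k H 𝔸) (theta k H 𝔸) = omegaAux k H 𝔸 := rfl

theorem extendRight_mul_comm (L : H ⊗[k] (H ⊗[k] 𝔸)) (P : H ⊗[k] H) :
    1 ⊗ₜ (1 ⊗ₜ (1 ⊗ₜ P)) * extendRight k H 𝔸 L = extendRight k H 𝔸 L * 1 ⊗ₜ (1 ⊗ₜ (1 ⊗ₜ P)) := by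
  induction L using TensorProduct.induction_on with
  | zero => simp
  | add x y hx hy => simp only [map_add, mul_add, add_mul, hx, hy]
  | tmul h L =>
  induction L using TensorProduct.induction_on with
  | zero => simp
  | add x y hx hy => simp only [map_add, mul_add, add_mul, TensorProduct.tmul_add, hx, hy]
  | tmul h' a => simp

theorem splitFst_splitFst_lam_tmul (z : 𝔸) (z' : H ⊗[k] H) :
    splitFst (𝔸 ⊗[k] (H ⊗[k] H)) (Delta k H)
      (splitFst (H ⊗[k] H) (lam (k := k) (H := H) (A := 𝔸)) (z ⊗ₜ z')) =
    extendRight k H 𝔸 (splitFst 𝔸 (Delta k H) (lam z)) * 1 ⊗ₜ (1 ⊗ₜ (1 ⊗ₜ z')) := by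
  rw [splitFst_tmul]
  generalize lam (k := k) (H := H) z = l
  induction l using TensorProduct.induction_on with
  | zero => simp
  | add x y hx hy => simp only [map_add, add_mul, TensorProduct.add_tmul, hx, hy]
  | tmul h a =>
    rw [TensorProduct.assoc_tmul, splitFst_tmul, splitFst_tmul]
    generalize Delta k H h = d
    induction d using TensorProduct.induction_on with
    | zero => simp
    | add x y hx hy => simp only [map_add, add_mul, TensorProduct.add_tmul, hx, hy]
    | tmul b c => simp

theorem onRight_splitFst_lam_tmul (t₁ t₃ : H) (t₂ : 𝔸) :
    onRight H (onRight H (onRight 𝔸 (tmulOne H H)))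
      (onRight H (splitFst H (lam (k := k) (H := H) (A := 𝔸))) (t₁ ⊗ₜ (t₂ ⊗ₜ t₃))) =
    extendRight k H 𝔸 (onRight H (lam (k := k) (H := H)) (t₁ ⊗ₜ t₂)) *
      1 ⊗ₜ (1 ⊗ₜ (1 ⊗ₜ (t₃ ⊗ₜ 1))) := by
  rw [onRight_tmul, splitFst_tmul, onRight_tmul, onRight_tmul (lam (k := k) (H := H))]
  generalize lam (k := k) (H := H) t₂ = l
  induction l using TensorProduct.induction_on with
  | zero => simp
  | add x y hx hy =>
    simp only [map_add, add_mul, TensorProduct.add_tmul, TensorProduct.tmul_add, hx, hy]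
  | tmul h a => simp

theorem extendRight_mul_left_comm (L : H ⊗[k] (H ⊗[k] 𝔸)) (P : H ⊗[k] H)
    (x : H ⊗[k] (H ⊗[k] (𝔸 ⊗[k] (H ⊗[k] H)))) :
    1 ⊗ₜ (1 ⊗ₜ (1 ⊗ₜ P)) * (extendRight k H 𝔸 L * x) =
      extendRight k H 𝔸 L * (1 ⊗ₜ (1 ⊗ₜ (1 ⊗ₜ P)) * x) := by
  rw [← mul_assoc, extendRight_mul_comm, mul_assoc]

/-- Legs one to three commute with legs four and five, so Ω separates into a part that multiplies
Φ_λ and a part that meets the coproduct of q̃. -/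
theorem omegaGen_tmul (z t₂ : 𝔸) (z' : H ⊗[k] H) (t₁ t₃ : H) :
    omegaGen k H 𝔸 (z ⊗ₜ z') (t₁ ⊗ₜ (t₂ ⊗ₜ t₃)) =
      extendRight k H 𝔸 (splitFst 𝔸 (Delta k H) (lam z) * phiLamInv k H 𝔸 *
        onRight H (lam (k := k) (H := H)) (t₁ ⊗ₜ t₂)) *
      1 ⊗ₜ (1 ⊗ₜ (1 ⊗ₜ (drinfeldTwist k H * z' * t₃ ⊗ₜ 1))) := by
  have h1 : ∀ P Q : H ⊗[k] H, (1 : H) ⊗ₜ[k] ((1 : H) ⊗ₜ[k] ((1 : 𝔸) ⊗ₜ[k] (P * Q))) =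
      1 ⊗ₜ (1 ⊗ₜ (1 ⊗ₜ P)) * 1 ⊗ₜ (1 ⊗ₜ (1 ⊗ₜ Q)) := by
    intro P Q
    simp
  rw [omegaGen, splitFst_splitFst_lam_tmul, onRight_splitFst_lam_tmul]
  simp only [oneTmul_apply, mul_assoc, map_mul, extendRight_mul_left_comm, h1]

/-- The Φ_λ from the product hypothesis is moved across (Δ ⊗ id)λ(z) and cancels the Φ_λ⁻¹ of Ω.
What is left lies in the image of id ⊗ λ, so the commutation hypothesis makes it a right coaction; θ
intertwines λ(z) past, and a second use converts that coaction as well. -/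
theorem wTilde_mulFst_omegaGen_tmul (hcomm : ∀ (φ : 𝒜) (u : 𝔸),
      prodMap γ.toLinearMap (vR v φ) (rho (k := k) (H := H) u) =
        prodMap (vL v φ) γ.toLinearMap (lam (k := k) (H := H) u))
    (hmul : ∀ φ φ' : 𝒜, v (φ * φ') =
      vMulExpr γ v (phiRho k H 𝔸) (theta k H 𝔸) (phiLam k H 𝔸) φ φ')
    (z t₂ : 𝔸) (z' : H ⊗[k] H) (t₁ t₃ : H) (φ φ' : 𝒜) :
    wTilde H γ v (mulFst k 𝒜 𝔸 (twistedAct5 k H 𝒜 𝔸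
        (omegaGen k H 𝔸 (z ⊗ₜ z') (t₁ ⊗ₜ (t₂ ⊗ₜ t₃))) (φ ⊗ₜ (φ' ⊗ₜ 1)))) =
      vMulExpr γ v (1 ⊗ₜ (1 ⊗ₜ SInv k H t₃) * (oneTmul 𝔸 _ (swapInv k H (drinfeldTwist k H * z')) *
          (onRight 𝔸 (Delta k H) (qRho k H 𝔸) * phiRho k H 𝔸 *
            splitFst H (rho (k := k) (H := H)) (rho z))))
        (theta k H 𝔸 * onRight H (rho (k := k) (H := H)) (t₁ ⊗ₜ t₂)) 1 φ φ' := by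
  have h1 : phiLam k H 𝔸 * (splitFst 𝔸 (Delta k H) (lam z) * phiLamInv k H 𝔸 *
        onRight H (lam (k := k) (H := H)) (t₁ ⊗ₜ t₂)) =
      onRight H (lam (k := k) (H := H)) (lam z * t₁ ⊗ₜ t₂) := by
    rw [← mul_assoc, ← mul_assoc, phiLam_mul_splitFst_lam, mul_assoc (onRight H _ _),
      phiLam_mul_phiLamInv, mul_one, ← map_mul]
  rw [omegaGen_tmul, wTilde_mulFst_twistedAct5 hmul, h1, vMulExpr_onRight_lam _ _ _ _ hcomm,
    map_mul (onRight H (rho (k := k) (H := H))), ← mul_assoc, theta_mul_onRight_rho,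
    mul_assoc (splitFst H _ _), vMulExpr_splitFst_lam_mul _ _ _ _ hcomm,
    swapInv_mul, swapInv_tmul, SInv_one]
  simp only [oneTmul_apply, ← mul_assoc, Algebra.TensorProduct.tmul_mul_tmul, one_mul]

/-- This is the core of multiplicativity. Φ_ρ and θ occur linearly in Ω, so each is freed in turn,
treated on pure tensors, and specialized back. -/
theorem wTilde_mulFst_omegaAux (hcomm : ∀ (φ : 𝒜) (u : 𝔸),
      prodMap γ.toLinearMap (vR v φ) (rho (k := k) (H := H) u) =
        prodMap (vL v φ) γ.toLinearMap (lam (k := k) (H := H) u))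
    (hmul : ∀ φ φ' : 𝒜, v (φ * φ') =
      vMulExpr γ v (phiRho k H 𝔸) (theta k H 𝔸) (phiLam k H 𝔸) φ φ') (φ φ' : 𝒜) :
    wTilde H γ v (mulFst k 𝒜 𝔸 (twistedAct5 k H 𝒜 𝔸 (omegaAux k H 𝔸) (φ ⊗ₜ (φ' ⊗ₜ 1)))) =
      vTilde H γ v φ * vTilde H γ v φ' := by
  have h1 : ∀ z t₁ t₂ t₃, wTilde H γ v (mulFst k 𝒜 𝔸 (twistedAct5 k H 𝒜 𝔸
        (omegaGen k H 𝔸 z (t₁ ⊗ₜ (t₂ ⊗ₜ t₃))) (φ ⊗ₜ (φ' ⊗ₜ 1)))) =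
      vMulExpr γ v (1 ⊗ₜ (1 ⊗ₜ SInv k H t₃) *
        prodMap ((oneTmul 𝔸 (H ⊗[k] H)).toLinearMap ∘ₗ swapInv k H ∘ₗ
          LinearMap.mulLeft k (drinfeldTwist k H))
        (LinearMap.mulLeft k (onRight 𝔸 (Delta k H) (qRho k H 𝔸) * phiRho k H 𝔸) ∘ₗ
          (splitFst H (rho (k := k) (H := H))).toLinearMap ∘ₗ
            (rho (k := k) (H := H) (A := 𝔸)).toLinearMap)
        (TensorProduct.comm k 𝔸 (H ⊗[k] H) z))
        (theta k H 𝔸 * onRight H (rho (k := k) (H := H)) (t₁ ⊗ₜ t₂)) 1 φ φ' := by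
    intro z t₁ t₂ t₃
    induction z using TensorProduct.induction_on with
    | zero => simp [omegaGen]
    | add x y hx hy =>
      have h : omegaGen k H 𝔸 (x + y) (t₁ ⊗ₜ (t₂ ⊗ₜ t₃)) =
          omegaGen k H 𝔸 x (t₁ ⊗ₜ (t₂ ⊗ₜ t₃)) + omegaGen k H 𝔸 y (t₁ ⊗ₜ (t₂ ⊗ₜ t₃)) := by
        simp only [omegaGen, map_add, add_mul, mul_add]
      simp only [h, map_add, mul_add, LinearMap.add_apply, vMulExpr_add_fst, hx, hy]
    | tmul z z' =>
      rw [wTilde_mulFst_omegaGen_tmul hcomm hmul, TensorProduct.comm_tmul, prodMap_tmul]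
      rfl
  have h2 : ∀ (q : 𝔸 ⊗[k] H) (s : H),
      1 ⊗ₜ (1 ⊗ₜ s) * onRight 𝔸 (tmulOne H H) q = onRight 𝔸 (tmulOne H H) q * 1 ⊗ₜ (1 ⊗ₜ s) := by
    intro q s
    induction q using TensorProduct.induction_on with
    | zero => simp
    | add x y hx hy => simp only [map_add, mul_add, add_mul, hx, hy]
    | tmul a b => simp
  -- With z = Φ_ρ the coproduct formula gives (q̃ ⊗ 1)(ρ ⊗ id)(q̃). The second factor returns to the
  -- θ slot as (λ ⊗ id)(q̃), and S⁻¹(t₃) slides over to it. The outcome is the expression that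
  -- `lTensor_qMap_theta` evaluates at t = θ.
  have h3 : ∀ t, wTilde H γ v (mulFst k 𝒜 𝔸 (twistedAct5 k H 𝒜 𝔸
        (omegaGen k H 𝔸 (phiRho k H 𝔸) t) (φ ⊗ₜ (φ' ⊗ₜ 1)))) =
      vMulExpr γ v (onRight 𝔸 (tmulOne H H) (qRho k H 𝔸)) ((qMap k H 𝔸).lTensor H
        (splitFst (H ⊗[k] H) (lam (k := k) (H := H)) (phiRho k H 𝔸) *
          onRight H (onRight 𝔸 (tmulOne H H)) (theta k H 𝔸) *
          onRight H (splitFst H (rho (k := k) (H := H))) t)) 1 φ φ' := by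
    have hadd : ∀ x y, omegaGen k H 𝔸 (phiRho k H 𝔸) (x + y) =
          omegaGen k H 𝔸 (phiRho k H 𝔸) x + omegaGen k H 𝔸 (phiRho k H 𝔸) y := by
      intro x y
      simp only [omegaGen, map_add, mul_add]
    intro t
    induction t using TensorProduct.induction_on with
    | zero => simp [omegaGen]
    | add x y hx hy =>
      simp only [hadd, map_add, mul_add, LinearMap.add_apply, vMulExpr_add_snd, hx, hy]
    | tmul t₁ t =>
    induction t using TensorProduct.induction_on with
    | zero => simp [omegaGen]
    | add x y hx hy =>
      simp only [hadd, TensorProduct.tmul_add, map_add, mul_add, LinearMap.add_apply,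
        vMulExpr_add_snd, hx, hy]
    | tmul t₂ t₃ =>
      rw [h1, onRight_comul_qRho, ← mul_assoc, h2, ← vMulExpr_splitFst_lam_mul _ _ _ _ hcomm,
        vMulExpr_mul_one_tmul, lTensor_qMap_mul_splitFst_tmul, ← splitFst_qMap, ← qRho_eq]
      simp only [mul_assoc]
  -- With nothing linking the two halves any more, the word is a product of two separate
  -- evaluations.
  have h4 : ∀ q q' : 𝔸 ⊗[k] H, vMulExpr γ v (onRight 𝔸 (tmulOne H H) q) (1 ⊗ₜ q') 1 φ φ' =
      evalRight k H γ v φ q * evalRight k H γ v φ' q' := by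
    intro q q'
    induction q using TensorProduct.induction_on with
    | zero => simp
    | add x y hx hy => simp only [map_add, add_mul, vMulExpr_add_fst, hx, hy]
    | tmul a b =>
    induction q' using TensorProduct.induction_on with
    | zero => simp
    | add x y hx hy => simp only [map_add, mul_add, TensorProduct.tmul_add, vMulExpr_add_snd, hx, hy]
    | tmul c d =>
      simp [vMulExpr_tmul_one, mul_assoc]
  rw [← omegaGen_phiRho_theta, h3, lTensor_qMap_theta, h4]
  rfl

theorem twistedAct5_apply_tmul (s : H ⊗[k] (H ⊗[k] (𝔸 ⊗[k] (H ⊗[k] H)))) (φ φ' : 𝒜) (u : 𝔸) :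
    mulFst k 𝒜 𝔸 (twistedAct5 k H 𝒜 𝔸 s (φ ⊗ₜ (φ' ⊗ₜ u))) =
      (LinearMap.mulRight k u).lTensor 𝒜
        (mulFst k 𝒜 𝔸 (twistedAct5 k H 𝒜 𝔸 s (φ ⊗ₜ (φ' ⊗ₜ 1)))) := by
  induction s using TensorProduct.induction_on with
  | zero => simp
  | add x y hx hy => simp only [map_add, LinearMap.add_apply, hx, hy]
  | tmul s₁ s =>
  induction s using TensorProduct.induction_on with
  | zero => simp
  | add x y hx hy => simp only [map_add, LinearMap.add_apply, TensorProduct.tmul_add, hx, hy]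
  | tmul s₂ s =>
  induction s using TensorProduct.induction_on with
  | zero => simp
  | add x y hx hy => simp only [map_add, LinearMap.add_apply, TensorProduct.tmul_add, hx, hy]
  | tmul s₃ s =>
  induction s using TensorProduct.induction_on with
  | zero => simp
  | add x y hx hy => simp only [map_add, LinearMap.add_apply, TensorProduct.tmul_add, hx, hy]
  | tmul s₄ s₅ =>
    rw [twistedAct5_tmul, twistedAct5_tmul, mulFst_tmul, mulFst_tmul, mul_one,
      LinearMap.lTensor_tmul, LinearMap.mulRight_apply]

theorem wTilde_mulFst_omegaAux_tmul (hcomm : ∀ (φ : 𝒜) (u : 𝔸),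
      prodMap γ.toLinearMap (vR v φ) (rho (k := k) (H := H) u) =
        prodMap (vL v φ) γ.toLinearMap (lam (k := k) (H := H) u))
    (hmul : ∀ φ φ' : 𝒜, v (φ * φ') =
      vMulExpr γ v (phiRho k H 𝔸) (theta k H 𝔸) (phiLam k H 𝔸) φ φ') (φ : 𝒜) (x : 𝒜 ⊗[k] 𝔸) :
    wTilde H γ v (mulFst k 𝒜 𝔸 (twistedAct5 k H 𝒜 𝔸 (omegaAux k H 𝔸) (φ ⊗ₜ x))) =
      vTilde H γ v φ * wTilde H γ v x := by
  induction x using TensorProduct.induction_on with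
  | zero => simp
  | add x y hx hy => simp only [map_add, TensorProduct.tmul_add, mul_add, hx, hy]
  | tmul φ' u =>
    rw [twistedAct5_apply_tmul, wTilde_lTensor_mulRight, wTilde_mulFst_omegaAux hcomm hmul,
      wTilde_tmul, mul_assoc]

end Homomorphism

/-! ### Multiplication by elements of 𝔸, units, and the formula forced on w. -/

section Unit

variable {k H 𝒜 𝔸 B : Type*} [Field k] [Ring H] [Algebra k H] [QuasiHopfAlgebra k H]
  [NonAssocRing 𝒜] [Module k 𝒜] [SMulCommClass k 𝒜 𝒜] [IsScalarTower k 𝒜 𝒜]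
  [Module H 𝒜] [IsScalarTower k H 𝒜] [Module Hᵐᵒᵖ 𝒜] [IsScalarTower k Hᵐᵒᵖ 𝒜]
  [SMulCommClass H Hᵐᵒᵖ 𝒜]
  [Ring 𝔸] [Algebra k 𝔸] [Ring B] [Algebra k B]
  [BicomoduleAlgebra k H 𝔸] [BimoduleAlgebra k H 𝒜] {γ : 𝔸 →ₐ[k] B} {v : 𝒜 →ₗ[k] B}

open QuasiBialgebra QuasiHopfAlgebra RightComoduleAlgebra LeftComoduleAlgebra BicomoduleAlgebra
open MulOpposite DiagonalCrossedProduct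

theorem onRight_onRight_splitFst_lam {X Y : Type*} [Ring X] [Algebra k X] [Ring Y] [Algebra k Y]
    (e : X →ₐ[k] Y) (t : 𝔸 ⊗[k] X) :
    onRight H (onRight 𝔸 e) (splitFst X (lam (k := k) (H := H)) t) =
      splitFst Y (lam (k := k) (H := H)) (onRight 𝔸 e t) := by
  induction t using TensorProduct.induction_on with
  | zero => simp
  | add x y hx hy => simp only [map_add, hx, hy]
  | tmul a t =>
    rw [splitFst_tmul, onRight_tmul, splitFst_tmul]
    generalize lam (k := k) (H := H) a = r
    induction r using TensorProduct.induction_on with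
    | zero => simp
    | add x y hx hy => simp only [map_add, TensorProduct.add_tmul, hx, hy]
    | tmul b c => simp

variable (k H 𝔸) in
/-- The algebra map `h₁ ⊗ h₂ ⊗ a ⊗ h₄ ⊗ h₅ ↦ ε(h₁) ε(h₅) h₂ ⊗ a ⊗ h₄`. -/
def counitOuter : H ⊗[k] (H ⊗[k] (𝔸 ⊗[k] (H ⊗[k] H))) →ₐ[k] H ⊗[k] (𝔸 ⊗[k] H) :=
  (onRight H (onRight 𝔸 (counitSnd k H H))).comp (counitFst k H _)

variable (k H 𝔸) in
/-- The algebra map `h₁ ⊗ h₂ ⊗ a ⊗ h₄ ⊗ h₅ ↦ ε(h₂) ε(h₄) h₁ ⊗ a ⊗ h₅`. -/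
def counitInner : H ⊗[k] (H ⊗[k] (𝔸 ⊗[k] (H ⊗[k] H))) →ₐ[k] H ⊗[k] (𝔸 ⊗[k] H) :=
  (onRight H (onRight 𝔸 (counitFst k H H))).comp (onRight H (counitFst k H _))

/-- An algebra map, so the four factors of Ω are normalized separately. This uses the derived
normalizations of f and of Φ_{λ,ρ}. -/
theorem counitOuter_omegaAux : counitOuter k H 𝔸 (omegaAux k H 𝔸) = 1 := by
  have h1 : counitOuter k H 𝔸
      (oneTmul H _ (oneTmul H _ (oneTmul 𝔸 _ (drinfeldTwist k H)))) = 1 := by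
    simp [counitOuter, counitSnd_drinfeldTwist, Algebra.TensorProduct.one_def]
  have h2 : counitOuter k H 𝔸 (splitFst (𝔸 ⊗[k] (H ⊗[k] H)) (Delta k H)
      (splitFst (H ⊗[k] H) (lam (k := k) (H := H) (A := 𝔸)) (phiRho k H 𝔸))) = 1 := by
    rw [counitOuter, AlgHom.comp_apply, counitFst_splitFst_comul, onRight_onRight_splitFst_lam,
      onRight_counitSnd_phiRho, map_one]
  have h3 : counitOuter k H 𝔸 (extendRight k H 𝔸 (phiLamInv k H 𝔸)) = 1 := by
    rw [counitOuter, AlgHom.comp_apply, counitFst_onRight,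
      map_phiLamInv_eq_one _ counitFst_phiLam, map_one, map_one]
  have h4 : counitOuter k H 𝔸 (onRight H (onRight H (onRight 𝔸 (tmulOne H H)))
      (onRight H (splitFst H (lam (k := k) (H := H) (A := 𝔸))) (theta k H 𝔸))) = 1 := by
    rw [counitOuter, AlgHom.comp_apply, counitFst_onRight, counitFst_onRight,
      map_theta_eq_one _ counitFst_phiLamRho, map_one, map_one, map_one]
  rw [omegaAux, map_mul, map_mul, map_mul, h1, h2, h3, h4, one_mul, one_mul, one_mul]

theorem onRight_onRight_counitTo_theta (E) [Ring E] [Algebra k E] :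
    onRight H (onRight 𝔸 (counitTo k H E)) (theta k H 𝔸) = 1 := by
  have h : onRight 𝔸 (counitTo k H E) = (tmulOne 𝔸 E).comp (counitSnd k H 𝔸) := by
    ext <;> simp [counitTo_apply, TensorProduct.smul_tmul']
  rw [h, ← onRight_comp_apply, map_theta_eq_one _ onRight_counitSnd_phiLamRho, map_one]

theorem counitInner_omegaAux : counitInner k H 𝔸 (omegaAux k H 𝔸) = 1 := by
  have h1 : counitInner k H 𝔸
      (oneTmul H _ (oneTmul H _ (oneTmul 𝔸 _ (drinfeldTwist k H)))) = 1 := by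
    simp [counitInner, counitFst_drinfeldTwist, Algebra.TensorProduct.one_def]
  have h2 : counitInner k H 𝔸 (splitFst (𝔸 ⊗[k] (H ⊗[k] H)) (Delta k H)
      (splitFst (H ⊗[k] H) (lam (k := k) (H := H) (A := 𝔸)) (phiRho k H 𝔸))) = 1 := by
    rw [counitInner, AlgHom.comp_apply, onRight_counitFst_splitFst _ counitSnd_comul,
      onRight_onRight_splitFst_lam, onRight_counitFst_phiRho, map_one]
  have h3 : counitInner k H 𝔸 (extendRight k H 𝔸 (phiLamInv k H 𝔸)) = 1 := by
    rw [counitInner, AlgHom.comp_apply, onRight_counitFst_onRight_onRight,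
      map_phiLamInv_eq_one _ onRight_counitFst_phiLam, map_one, map_one]
  have h4 : counitInner k H 𝔸 (onRight H (onRight H (onRight 𝔸 (tmulOne H H)))
      (onRight H (splitFst H (lam (k := k) (H := H) (A := 𝔸))) (theta k H 𝔸))) = 1 := by
    have h5 : (counitFst k H H).comp (tmulOne H H) = counitTo k H H :=
      AlgHom.ext fun h => by simp [counitTo_apply]
    have h6 : (counitFst k H (𝔸 ⊗[k] H)).comp (splitFst H (lam (k := k) (H := H))) =
        AlgHom.id k _ := AlgHom.ext counitFst_splitFst_lam
    rw [counitInner, AlgHom.comp_apply, onRight_counitFst_onRight_onRight,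
      onRight_comp_apply (counitFst k H (𝔸 ⊗[k] H)), h6, onRight_comp_apply, ← onRight_comp, h5,
      onRight_comp_apply, AlgHom.comp_id, onRight_onRight_counitTo_theta]
  rw [omegaAux, map_mul, map_mul, map_mul, h1, h2, h3, h4, one_mul, one_mul, one_mul]

theorem smul_op_SInv_smul_one (h h' : H) :
    h • op (SInv k H h') • (1 : 𝒜) = ((counit h * counit h' : k)) • (1 : 𝒜) := by
  rw [BimoduleAlgebra.one_smul' (k := k), counit_SInv, ← actL_apply k H 𝒜, map_smul, actL_apply,
    BimoduleAlgebra.smul_one' (k := k), smul_smul, mul_comm]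

/-- Legs one and five act on the unit through ε, and ε ∘ S⁻¹ = ε. -/
theorem mulFst_twistedAct5_one_tmul (s : H ⊗[k] (H ⊗[k] (𝔸 ⊗[k] (H ⊗[k] H)))) (φ : 𝒜) (u : 𝔸) :
    mulFst k 𝒜 𝔸 (twistedAct5 k H 𝒜 𝔸 s (1 ⊗ₜ (φ ⊗ₜ u))) =
      twistedAct3 k H 𝒜 𝔸 (counitOuter k H 𝔸 s) (φ ⊗ₜ u) := by
  induction s using TensorProduct.induction_on with
  | zero => simp
  | add x y hx hy => simp only [map_add, LinearMap.add_apply, hx, hy]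
  | tmul s₁ s =>
  induction s using TensorProduct.induction_on with
  | zero => simp
  | add x y hx hy => simp only [map_add, LinearMap.add_apply, TensorProduct.tmul_add, hx, hy]
  | tmul s₂ s =>
  induction s using TensorProduct.induction_on with
  | zero => simp
  | add x y hx hy => simp only [map_add, LinearMap.add_apply, TensorProduct.tmul_add, hx, hy]
  | tmul s₃ s =>
  induction s using TensorProduct.induction_on with
  | zero => simp
  | add x y hx hy => simp only [map_add, LinearMap.add_apply, TensorProduct.tmul_add, hx, hy]
  | tmul s₄ s₅ =>
    rw [twistedAct5_tmul, mulFst_tmul, smul_op_SInv_smul_one, smul_mul_assoc, one_mul]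
    simp [-LinearEquiv.coe_coe, counitOuter, TensorProduct.smul_tmul', smul_smul, mul_comm]

theorem mulFst_twistedAct5_tmul_one (s : H ⊗[k] (H ⊗[k] (𝔸 ⊗[k] (H ⊗[k] H)))) (φ : 𝒜) (u : 𝔸) :
    mulFst k 𝒜 𝔸 (twistedAct5 k H 𝒜 𝔸 s (φ ⊗ₜ (1 ⊗ₜ u))) =
      twistedAct3 k H 𝒜 𝔸 (counitInner k H 𝔸 s) (φ ⊗ₜ u) := by
  induction s using TensorProduct.induction_on with
  | zero => simp
  | add x y hx hy => simp only [map_add, LinearMap.add_apply, hx, hy]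
  | tmul s₁ s =>
  induction s using TensorProduct.induction_on with
  | zero => simp
  | add x y hx hy => simp only [map_add, LinearMap.add_apply, TensorProduct.tmul_add, hx, hy]
  | tmul s₂ s =>
  induction s using TensorProduct.induction_on with
  | zero => simp
  | add x y hx hy => simp only [map_add, LinearMap.add_apply, TensorProduct.tmul_add, hx, hy]
  | tmul s₃ s =>
  induction s using TensorProduct.induction_on with
  | zero => simp
  | add x y hx hy => simp only [map_add, LinearMap.add_apply, TensorProduct.tmul_add, hx, hy]
  | tmul s₄ s₅ =>
    rw [twistedAct5_tmul, mulFst_tmul, smul_op_SInv_smul_one, mul_smul_comm, mul_one]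
    simp [-LinearEquiv.coe_coe, counitInner, TensorProduct.smul_tmul', smul_smul, mul_comm]

theorem twistedAct3_splitFst_lam_one_tmul (r : 𝔸 ⊗[k] H) (u : 𝔸) :
    twistedAct3 k H 𝒜 𝔸 (splitFst H (lam (k := k) (H := H)) r) (1 ⊗ₜ u) =
      1 ⊗ₜ (counitSnd k H 𝔸 r * u) := by
  have h1 : ∀ s : H ⊗[k] (𝔸 ⊗[k] H), twistedAct3 k H 𝒜 𝔸 s (1 ⊗ₜ u) =
      1 ⊗ₜ (counitSnd k H 𝔸 (counitFst k H _ s) * u) := by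
    intro s
    induction s using TensorProduct.induction_on with
    | zero => simp
    | add x y hx hy => simp only [map_add, LinearMap.add_apply, add_mul, TensorProduct.tmul_add,
        hx, hy]
    | tmul s₁ s =>
    induction s using TensorProduct.induction_on with
    | zero => simp
    | add x y hx hy => simp only [map_add, LinearMap.add_apply, add_mul, TensorProduct.tmul_add,
        hx, hy]
    | tmul s₂ s₃ =>
      rw [twistedAct3_tmul, smul_op_SInv_smul_one]
      simp [TensorProduct.smul_tmul', smul_smul, mul_comm]
  rw [h1, counitFst_splitFst_lam]

/-- Both the coaction terms and the legs Ω², Ω⁴ act on the unit of 𝒜, so counit normalization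
removes them. -/
theorem mk_mul_mk_one (φ : 𝒜) (u u' : 𝔸) :
    (mk H φ u * mk H 1 u' : DiagonalCrossedProduct k H 𝒜 𝔸) = mk H φ (u * u') := by
  rw [mk_mul_mk, act3_lamSInv, act5_Omega, twistedAct3_splitFst_lam_one_tmul, counitSnd_rho,
    mulFst_twistedAct5_tmul_one, counitInner_omegaAux, twistedAct3_one]
  rfl

theorem mk_one_mul (u : 𝔸) (x : 𝒜 ⊗[k] 𝔸) :
    (mk H 1 u * of k H 𝒜 𝔸 x : DiagonalCrossedProduct k H 𝒜 𝔸) =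
      of k H 𝒜 𝔸 (twistedAct3 k H 𝒜 𝔸 (splitFst H (lam (k := k) (H := H)) (rho u)) x) := by
  have h1 : ∀ y : 𝒜 ⊗[k] 𝔸,
      mulFst k 𝒜 𝔸 (twistedAct5 k H 𝒜 𝔸 (omegaAux k H 𝔸) (1 ⊗ₜ y)) = y := by
    intro y
    induction y using TensorProduct.induction_on with
    | zero => simp
    | add x y hx hy => simp only [map_add, TensorProduct.tmul_add, hx, hy]
    | tmul φ a =>
      rw [mulFst_twistedAct5_one_tmul, counitOuter_omegaAux, twistedAct3_one]
      rfl
  conv_rhs => rw [← h1 (twistedAct3 _ _ _ _ _ _)]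
  rfl

theorem Gam_apply (φ : 𝒜) : Gam k H 𝒜 𝔸 φ = of k H 𝒜 𝔸
    (twistedAct3 k H 𝒜 𝔸 (splitFst H (lam (k := k) (H := H)) (pRho k H 𝔸)) (φ ⊗ₜ 1)) := rfl

/-- Since ε is multiplicative, ε ∘ S⁻¹ = ε and ε(α) = 1, this reduces to the normalization of Φ_ρ.
-/
theorem counitSnd_qRho : counitSnd k H 𝔸 (qRho k H 𝔸) = 1 := by
  have h1 : ∀ t, counitSnd k H 𝔸 (qMap k H 𝔸 t) =
      counitSnd k H 𝔸 (onRight 𝔸 (counitSnd k H H) t) := by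
    intro t
    induction t using TensorProduct.induction_on with
    | zero => simp
    | add x y hx hy => simp only [map_add, hx, hy]
    | tmul a t =>
    induction t using TensorProduct.induction_on with
    | zero => simp
    | add x y hx hy => simp only [map_add, TensorProduct.tmul_add, hx, hy]
    | tmul b c =>
      rw [qMap_tmul, counitSnd_tmul, counit_SInv, evalAlpha_tmul, map_mul, map_mul, counit_S,
        counit_alpha, onRight_tmul, counitSnd_tmul, counitSnd_tmul, map_smul]
      simp [mul_comm]
  rw [qRho_eq, h1, onRight_counitSnd_phiRho, map_one]

theorem vTilde_one (hone : v 1 = 1) : vTilde H γ v (1 : 𝒜) = 1 := by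
  have h1 : ∀ t : 𝔸 ⊗[k] H, evalRight k H γ v (1 : 𝒜) t = γ (counitSnd k H 𝔸 t) := by
    intro t
    induction t using TensorProduct.induction_on with
    | zero => simp
    | add x y hx hy => simp only [map_add, hx, hy]
    | tmul a b => rw [evalRight_tmul, BimoduleAlgebra.one_smul' (k := k)]; simp [hone]
  rw [vTilde_apply, h1, counitSnd_qRho, map_one]

/-- An algebra map `w` with `w ∘ Γ = v` and `w ∘ j = γ` is given by `γ(q̃¹) v(φ · q̃²) γ(u)`. -/
theorem IsAlgMap.apply_mk {w : DiagonalCrossedProduct k H 𝒜 𝔸 →ₗ[k] B} (hw : IsAlgMap w)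
    (hΓ : w ∘ₗ Gam k H 𝒜 𝔸 = v) (hj : w ∘ₗ j k H 𝒜 𝔸 = γ.toLinearMap) (φ : 𝒜) (u : 𝔸) :
    w (mk H φ u) = vTilde H γ v φ * γ u := by
  have hj' : ∀ a, w (mk H 1 a) = γ a := fun a => LinearMap.congr_fun hj a
  -- For t = a ⊗ h this is w(j(a) Γ(φ·h)) = γ(a) v(φ·h). The factor S(h) yields φ·h because the
  -- twisted action applies S⁻¹.
  have h1 : ∀ t : 𝔸 ⊗[k] H, w (of k H 𝒜 𝔸 (twistedAct3 k H 𝒜 𝔸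
      (splitFst H (lam (k := k) (H := H))
        (prodMap (LinearMap.mulRight k (pRho k H 𝔸) ∘ₗ (rho (k := k) (H := H)).toLinearMap)
          ((oneTmul 𝔸 H).toLinearMap ∘ₗ S k H) t)) (φ ⊗ₜ 1))) = evalRight k H γ v φ t := by
    intro t
    induction t using TensorProduct.induction_on with
    | zero => simp
    | add x y hx hy => simp only [map_add, LinearMap.add_apply, hx, hy]
    | tmul a h =>
      have h2 : twistedAct3 k H 𝒜 𝔸
          (splitFst H (lam (k := k) (H := H)) (1 ⊗ₜ S k H h)) (φ ⊗ₜ 1) = (op h • φ) ⊗ₜ 1 := by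
        rw [splitFst_tmul, map_one, Algebra.TensorProduct.one_def, TensorProduct.assoc_tmul,
          twistedAct3_tmul, SInv_S, one_smul, one_mul]
      rw [prodMap_tmul]
      simp only [LinearMap.comp_apply, LinearMap.mulRight_apply, AlgHom.toLinearMap_apply,
        oneTmul_apply]
      rw [map_mul (splitFst H (lam (k := k) (H := H))),
        map_mul (splitFst H (lam (k := k) (H := H))), twistedAct3_mul, twistedAct3_mul,
        Module.End.mul_apply, Module.End.mul_apply, h2, ← mk_one_mul, ← Gam_apply, hw.map_mul, hj',
        evalRight_tmul, ← hΓ]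
      rfl
  -- At t = q̃ the acting element is 1 ⊗ 1, so the left side is w(φ ⋈ 1).
  have h3 := h1 (qRho k H 𝔸)
  rw [rho_qRho_mul_pRho, map_one, twistedAct3_one] at h3
  have h4 := hw.map_mul (mk H φ 1) (mk H 1 u)
  rw [mk_mul_mk_one, one_mul, hj'] at h4
  rw [h4, vTilde_apply, ← h3]
  rfl

end Unit

end QuasiHopf

end

/-! ### Existence, uniqueness and the explicit formula. -/

theorem proposition7p1 {k H 𝒜 𝔸 B : Type*} [Field k]
    [Ring H] [Algebra k H] [QuasiHopfAlgebra k H]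
    [NonAssocRing 𝒜] [Module k 𝒜] [SMulCommClass k 𝒜 𝒜] [IsScalarTower k 𝒜 𝒜]
    [Module H 𝒜] [IsScalarTower k H 𝒜] [Module Hᵐᵒᵖ 𝒜] [IsScalarTower k Hᵐᵒᵖ 𝒜]
    [SMulCommClass H Hᵐᵒᵖ 𝒜] [BimoduleAlgebra k H 𝒜]
    [Ring 𝔸] [Algebra k 𝔸] [BicomoduleAlgebra k H 𝔸]
    [Ring B] [Algebra k B]
    (γ : 𝔸 →ₐ[k] B) (v : 𝒜 →ₗ[k] B)
    (hcomm : ∀ (φ : 𝒜) (u : 𝔸),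
      prodMap γ.toLinearMap (vR v φ) (RightComoduleAlgebra.rho (k := k) (H := H) u) =
        prodMap (vL v φ) γ.toLinearMap (LeftComoduleAlgebra.lam (k := k) (H := H) u))
    (hmul : ∀ φ φ' : 𝒜, v (φ * φ') =
      vMulExpr γ v (phiRho k H 𝔸) (theta k H 𝔸) (phiLam k H 𝔸) φ φ')
    (hone : v 1 = 1) :
    (∃! w : DiagonalCrossedProduct k H 𝒜 𝔸 →ₗ[k] B,
      DiagonalCrossedProduct.IsAlgMap w ∧
        w ∘ₗ DiagonalCrossedProduct.Gam k H 𝒜 𝔸 = v ∧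
        w ∘ₗ DiagonalCrossedProduct.j k H 𝒜 𝔸 = γ.toLinearMap) ∧
    ∀ w : DiagonalCrossedProduct k H 𝒜 𝔸 →ₗ[k] B,
      DiagonalCrossedProduct.IsAlgMap w →
      w ∘ₗ DiagonalCrossedProduct.Gam k H 𝒜 𝔸 = v →
      w ∘ₗ DiagonalCrossedProduct.j k H 𝒜 𝔸 = γ.toLinearMap →
      ∀ (φ : 𝒜) (u : 𝔸), w (DiagonalCrossedProduct.mk H φ u) =
        prodMap γ.toLinearMap (vR v φ) (qRho k H 𝔸) * γ u := by
  have hformula : ∀ w : DiagonalCrossedProduct k H 𝒜 𝔸 →ₗ[k] B,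
      DiagonalCrossedProduct.IsAlgMap w →
      w ∘ₗ DiagonalCrossedProduct.Gam k H 𝒜 𝔸 = v →
      w ∘ₗ DiagonalCrossedProduct.j k H 𝒜 𝔸 = γ.toLinearMap →
      ∀ (φ : 𝒜) (u : 𝔸), w (DiagonalCrossedProduct.mk H φ u) = vTilde H γ v φ * γ u :=
    fun w hw hΓ hj φ u => IsAlgMap.apply_mk hw hΓ hj φ u
  refine ⟨⟨wTilde H γ v ∘ₗ (DiagonalCrossedProduct.of k H 𝒜 𝔸).symm.toLinearMap,
    ⟨⟨?_, ?_⟩, ?_, ?_⟩, ?_⟩, hformula⟩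
  · change wTilde H γ v (1 ⊗ₜ 1) = 1
    rw [wTilde_tmul, vTilde_one hone, map_one, one_mul]
  · intro x y
    obtain ⟨x, rfl⟩ := (DiagonalCrossedProduct.of k H 𝒜 𝔸).surjective x
    obtain ⟨y, rfl⟩ := (DiagonalCrossedProduct.of k H 𝒜 𝔸).surjective y
    change wTilde H γ v (DiagonalCrossedProduct.mulAux k H 𝒜 𝔸 x y) =
      wTilde H γ v x * wTilde H γ v y
    induction x using TensorProduct.induction_on with
    | zero => simp
    | add x x' hx hx' => simp only [map_add, LinearMap.add_apply, add_mul, hx, hx']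
    | tmul φ u =>
    induction y using TensorProduct.induction_on with
    | zero => simp
    | add y y' hy hy' => simp only [map_add, mul_add, hy, hy']
    | tmul φ' u' =>
      change wTilde H γ v (mulFst k 𝒜 𝔸 (act5 k H 𝒜 𝔸 (Omega k H 𝔸)
        (φ ⊗ₜ act3 k H 𝒜 𝔸 (lamSInv k H 𝔸 (RightComoduleAlgebra.rho u)) (φ' ⊗ₜ u')))) = _
      -- The Ω-part splits off the factor from φ; what is left is w(j(u)(φ' ⋈ u')) = γ(u) w(φ' ⋈
      -- u').
      rw [act5_Omega, wTilde_mulFst_omegaAux_tmul hcomm hmul, act3_lamSInv,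
        wTilde_twistedAct3_rho hcomm, wTilde_tmul, wTilde_tmul]
      simp only [mul_assoc]
  · refine LinearMap.ext fun φ => ?_
    change wTilde H γ v (twistedAct3 k H 𝒜 𝔸 (splitFst H
      (LeftComoduleAlgebra.lam (k := k) (H := H)) (pRho k H 𝔸)) (φ ⊗ₜ 1)) = v φ
    rw [wTilde_twistedAct3 hcomm, qMap_phiRho_mul_splitFst_pRho, Algebra.TensorProduct.one_def,
      evalRight_tmul, map_one, one_mul, MulOpposite.op_one, one_smul]
  · refine LinearMap.ext fun u => ?_
    change wTilde H γ v (1 ⊗ₜ u) = γ u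
    rw [wTilde_tmul, vTilde_one hone, one_mul]
  · rintro w ⟨hw, hΓ, hj⟩
    refine LinearMap.ext fun x => ?_
    obtain ⟨x, rfl⟩ := (DiagonalCrossedProduct.of k H 𝒜 𝔸).surjective x
    refine LinearMap.congr_fun (f := w ∘ₗ (DiagonalCrossedProduct.of k H 𝒜 𝔸).toLinearMap)
      (g := wTilde H γ v) (TensorProduct.ext' fun φ u => ?_) x
    rw [wTilde_tmul]
    exact hformula w hw hΓ hj φ u
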